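/- Setting. Let $A$ be a non-zero finite-dimensional complex Hilbert space with a fixed orthonormal basis $\{|i\rangle\}_{i\in I}$, so that operators on $A$ are complex matrices, and let $B$ be a copy of $A$. Write $X\le Y$ if $Y-X$ is positive semidefinite, and $|\Phi\rangle=\sum_i|i\rangle\otimes|i\rangle\in A\otimes B$. A non-commutative graph is a subspace $S\subseteq L(A)$ with $S=S^\dagger$ and $I\in S$. For $W\ge 0$ put $$\theta(S,W)=\min\{\lambda\in\mathbb R: \exists\, Y\in S\otimes L(B),\ \mathrm{Tr}_A Y\le\lambda I,\ Y\ge(\sqrt W\otimes I)|\Phi\rangle\langle\Phi|(\sqrt W\otimes I)\}.$$ For a set $C$ of positive semidefinite operators let $C^\sharp=\{B\ge0:\mathrm{Tr}(AB)\le1\ \forall A\in C\}$ and $\mathrm{her}(C)=\{A\ge0:\exists B\in C,\ A\le B\}$. The theta body is $TH(S)=\{X\ge0:\mathrm{Tr}(XW)\le1\text{ for all }W\ge0\text{ with }\theta(S,W)\le1\}$, and $TH^\sharp(S)=TH(S)^\sharp$. Let $S_0\subseteq L(A)$ be a unital $*$-subalgebra with commutant $S_0'$. A non-commutative graph $S$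 is an $S_0$-graph if $S_0\subseteq S$ and $S_0SS_0=S$ (products of spaces being spans of products); its complement is $S^c=S^\perp+S_0$, where $\perp$ is taken for the inner product $\mathrm{Tr}(X^\dagger Y)$. A block decomposition of $S_0$ is a unitary identification $A=\bigoplus_{i=1}^r A_i\otimes Y_i$ with non-zero Hilbert spaces $A_i,Y_i$ under which $S_0=\bigoplus_i L(A_i)\otimes I_{Y_i}$. With $P_i$ the projection onto $A_i\otimes Y_i$, it defines $$\Psi(W)=\sum_i(\dim Y_i)^{-1}\,I_{A_i}\otimes\mathrm{Tr}_{A_i}(P_iWP_i).$$ Theorem. Let $S$ be an $S_0$-graph. Then $S_0$ has a block decomposition, the minimum defining $\theta(S,W)$ is attained for every $W\ge0$, and for the map $\Psi$ of any block decomposition of $S_0$: $$TH(S)=\{W\ge0:\Psi(W)\in TH^\sharp(S^c)\},\qquad TH^\sharp(S)=\mathrm{her}\bigl(TH^\sharp(S)\cap S_0'\bigr).$$ Equivalently, for every $W\ge0$, $$\theta(S,W)=\max\{\mathrm{Tr}(WZ):Z\ge0,\ \theta(S^c,\Psi(Z))\le1\}=\min\{\theta(S,X):X\ge W,\ X\in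 S_0'\},$$ with the maximum and the minimum attained. All maximal elements of $TH^\sharp(S)$ (for $\le$) lie in $S_0'$. In particular, for a simple graph $G$ on the index set $I$ and $S_G=\mathrm{span}\{|i\rangle\langle j|: i=j\text{ or }i\sim j\}$, all maximal elements of $TH^\sharp(S_G)$ are diagonal. -/

import Mathlib

open scoped Matrix MatrixOrder Kronecker

/-!
Operators on a finite-dimensional Hilbert space with a fixed orthonormal basis indexed by `n`
are matrices in `Matrix n n ℂ`; operators on `A ⊗ B`, with `B` a copy of `A`, are matrices in
`Matrix (n × n) (n × n) ℂ`, the first factor being `A`. The order `≤` on matrices is the Loewner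
order (`X ≤ Y` iff `Y - X` is positive semidefinite, scope `MatrixOrder`).
-/

namespace NCTheta

noncomputable section

/-- Partial trace over the first tensor factor. -/
def partialTrace {a b : Type*} [Fintype a] (Y : Matrix (a × b) (a × b) ℂ) : Matrix b b ℂ :=
  Matrix.of fun j k => ∑ i, Y (i, j) (i, k)

section Basic

variable {n : Type*} [Fintype n] [DecidableEq n]

/-- A non-commutative graph: an operator space `S` with `S = S†` and `I ∈ S`. -/
structure IsNCGraph (S : Submodule ℂ (Matrix n n ℂ)) : Prop where
  conjTranspose_mem : ∀ X ∈ S, Xᴴ ∈ S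
  one_mem : (1 : Matrix n n ℂ) ∈ S

/-- The linear space underlying a `*`-algebra of matrices. -/
def algSpace (S₀ : StarSubalgebra ℂ (Matrix n n ℂ)) : Submodule ℂ (Matrix n n ℂ) :=
  Subalgebra.toSubmodule S₀.toSubalgebra

/-- `S` is an `S₀`-graph: a non-commutative graph with `S₀ ⊆ S` and `S₀ S S₀ = S`
(the product of subspaces being the span of the products). -/
structure IsAlgGraph (S₀ : StarSubalgebra ℂ (Matrix n n ℂ)) (S : Submodule ℂ (Matrix n n ℂ)) :
    Prop where
  isNCGraph : IsNCGraph S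
  le : algSpace S₀ ≤ S
  bimodule : algSpace S₀ * S * algSpace S₀ = S

/-- The orthogonal complement for the Hilbert-Schmidt inner product `Tr(Y† X)`. -/
def perp (S : Submodule ℂ (Matrix n n ℂ)) : Submodule ℂ (Matrix n n ℂ) where
  carrier := {X | ∀ Y ∈ S, (Yᴴ * X).trace = 0}
  zero_mem' := by intro Y _; simp
  add_mem' := by
    intro X X' hX hX' Y hY
    rw [Matrix.mul_add, Matrix.trace_add, hX Y hY, hX' Y hY, add_zero]
  smul_mem' := by
    intro c X hX Y hY
    rw [Matrix.mul_smul, Matrix.trace_smul, hX Y hY, smul_zero]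

/-- The complement `Sᶜ = S^⊥ + S₀` of an `S₀`-graph `S`. -/
def graphCompl (S₀ : StarSubalgebra ℂ (Matrix n n ℂ)) (S : Submodule ℂ (Matrix n n ℂ)) :
    Submodule ℂ (Matrix n n ℂ) :=
  perp S ⊔ algSpace S₀

/-- The operator space `S ⊗ L(B)`, for `B` a copy of the underlying Hilbert space. -/
def tensorFull (S : Submodule ℂ (Matrix n n ℂ)) : Submodule ℂ (Matrix (n × n) (n × n) ℂ) :=
  Submodule.span ℂ {Y | ∃ X ∈ S, ∃ M : Matrix n n ℂ, Y = X ⊗ₖ M}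

/-- The vector `|Φ⟩ = ∑ i, |i⟩ ⊗ |i⟩`. -/
def maxEnt : n × n → ℂ := fun p => if p.1 = p.2 then 1 else 0

/-- The vector `(√W ⊗ I) |Φ⟩`. -/
def sqrtVec (W : Matrix n n ℂ) : n × n → ℂ :=
  (CFC.sqrt W ⊗ₖ (1 : Matrix n n ℂ)) *ᵥ maxEnt

/-- The real numbers `l` for which there is `Y ∈ S ⊗ L(B)` with `Tr_A Y ≤ l I` and
`Y ≥ (√W ⊗ I) |Φ⟩⟨Φ| (√W ⊗ I)`. -/
def thetaValues (S : Submodule ℂ (Matrix n n ℂ)) (W : Matrix n n ℂ) : Set ℝ :=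
  {l | ∃ Y ∈ tensorFull S,
    partialTrace Y ≤ (l : ℂ) • (1 : Matrix n n ℂ) ∧
    Matrix.vecMulVec (sqrtVec W) (star (sqrtVec W)) ≤ Y}

/-- The weighted theta function `θ(S, W)`, for `W ≥ 0`. -/
def theta (S : Submodule ℂ (Matrix n n ℂ)) (W : Matrix n n ℂ) : ℝ :=
  sInf (thetaValues S W)

/-- The anti-blocker of a set of positive semidefinite matrices. (The trace of a product of two
positive semidefinite matrices is real.) -/
def antiblocker (C : Set (Matrix n n ℂ)) : Set (Matrix n n ℂ) :=
  {B | 0 ≤ B ∧ ∀ A ∈ C, (A * B).trace.re ≤ 1}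

/-- The theta body `TH(S)`. -/
def thetaBody (S : Submodule ℂ (Matrix n n ℂ)) : Set (Matrix n n ℂ) :=
  {X | 0 ≤ X ∧ ∀ W : Matrix n n ℂ, 0 ≤ W → theta S W ≤ 1 → (X * W).trace.re ≤ 1}

/-- The hereditary closure of a set of positive semidefinite matrices. -/
def her (C : Set (Matrix n n ℂ)) : Set (Matrix n n ℂ) :=
  {A | 0 ≤ A ∧ ∃ B ∈ C, A ≤ B}

/-- The commutant `S₀'`. -/
def commutant (S₀ : StarSubalgebra ℂ (Matrix n n ℂ)) : Set (Matrix n n ℂ) :=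
  Set.centralizer (S₀ : Set (Matrix n n ℂ))

/-- The non-commutative graph `span {|i⟩⟨j| : i = j or i ∼ j}` of a classical graph. -/
def classicalGraph (G : SimpleGraph n) : Submodule ℂ (Matrix n n ℂ) :=
  Submodule.span ℂ {X | ∃ i j, (i = j ∨ G.Adj i j) ∧ X = Matrix.single i j 1}

/-- A decomposition of the Hilbert space as `⨁ i, A i ⊗ Y i` (with `dim (A i) = a i > 0` and
`dim (Y i) = y i > 0`) for which `S₀ = ⨁ i, L(A i) ⊗ I`. The identification of
`⨁ i, A i ⊗ Y i` with the given Hilbert space is the unitary `U`. -/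
structure BlockDecomposition (S₀ : StarSubalgebra ℂ (Matrix n n ℂ)) where
  r : ℕ
  a : Fin r → ℕ
  y : Fin r → ℕ
  a_pos : ∀ i, 0 < a i
  y_pos : ∀ i, 0 < y i
  U : Matrix n (Σ i, Fin (a i) × Fin (y i)) ℂ
  conjTranspose_mul_self : Uᴴ * U = 1
  mul_conjTranspose_self : U * Uᴴ = 1
  mem_iff : ∀ X : Matrix n n ℂ, X ∈ S₀ ↔
    ∃ M : ∀ i, Matrix (Fin (a i)) (Fin (a i)) ℂ,
      X = U * Matrix.blockDiagonal'
        (fun i => M i ⊗ₖ (1 : Matrix (Fin (y i)) (Fin (y i)) ℂ)) * Uᴴ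

/-- `Ψ(W) = ∑ i, (dim (Y i))⁻¹ I_{A i} ⊗ Tr_{A i} (P i W P i)`, where `P i` is the projection
onto the block `A i ⊗ Y i`. -/
def BlockDecomposition.psi {S₀ : StarSubalgebra ℂ (Matrix n n ℂ)} (D : BlockDecomposition S₀)
    (W : Matrix n n ℂ) : Matrix n n ℂ :=
  D.U * Matrix.blockDiagonal'
    (fun i => ((D.y i : ℂ)⁻¹) •
      ((1 : Matrix (Fin (D.a i)) (Fin (D.a i)) ℂ) ⊗ₖ
        partialTrace (Matrix.blockDiag' (D.Uᴴ * W * D.U) i))) * D.Uᴴ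

end Basic

end

end NCTheta

namespace NCTheta

set_option linter.unusedSectionVars false

section Slices

open scoped ComplexOrder

variable {n m m' ι : Type*} [Fintype n] [Fintype m] [Fintype m'] [Fintype ι]
  [DecidableEq n] [DecidableEq m] [DecidableEq m'] [DecidableEq ι]

/-- The operator-valued matrix entries of an operator on `A ⊗ B`. -/
def slice (Y : Matrix (n × m) (n × m) ℂ) (j k : m) : Matrix n n ℂ :=
  Matrix.of fun i i' => Y (i, j) (i', k)

/-- The vector `(V ⊗ I) |Φ⟩`. -/
def vec (V : Matrix n m ℂ) : n × m → ℂ := fun p => V p.1 p.2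

/-- The rank-one operator `|v⟩⟨v|`. -/
def rankOne (v : ι → ℂ) : Matrix ι ι ℂ := Matrix.vecMulVec v (star v)

/-- Conjugation by `I ⊗ C`. -/
def amp (C : Matrix m' m ℂ) (Y : Matrix (n × m) (n × m) ℂ) : Matrix (n × m') (n × m') ℂ :=
  ((1 : Matrix n n ℂ) ⊗ₖ C) * Y * ((1 : Matrix n n ℂ) ⊗ₖ C)ᴴ

theorem slice_ext {Y Y' : Matrix (n × m) (n × m) ℂ} (h : ∀ j k, slice Y j k = slice Y' j k) :
    Y = Y' := by
  ext ⟨i, j⟩ ⟨i', k⟩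
  exact congrFun (congrFun (h j k) i) i'

theorem slice_kronecker (X : Matrix n n ℂ) (M : Matrix m m ℂ) (j k : m) :
    slice (X ⊗ₖ M) j k = M j k • X := by
  ext i i'
  simp [slice, mul_comm]

theorem partialTrace_apply (Y : Matrix (n × m) (n × m) ℂ) (j k : m) :
    partialTrace Y j k = (slice Y j k).trace := rfl

theorem trace_partialTrace (Y : Matrix (n × m) (n × m) ℂ) :
    (partialTrace Y).trace = Y.trace := by
  simp only [Matrix.trace, partialTrace, Matrix.diag_apply, Matrix.of_apply]
  rw [Fintype.sum_prod_type, Finset.sum_comm]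

theorem trace_mul_eq_sum_slice (Y Y' : Matrix (n × m) (n × m) ℂ) :
    (Y * Y').trace = ∑ j, ∑ k, (slice Y j k * slice Y' k j).trace := by
  simp only [Matrix.trace, Matrix.diag_apply, Matrix.mul_apply, Fintype.sum_prod_type, slice,
    Matrix.of_apply]
  rw [Finset.sum_comm]
  refine Finset.sum_congr rfl fun j _ => ?_
  conv_rhs => rw [Finset.sum_comm]
  exact Finset.sum_congr rfl fun i _ => Finset.sum_comm

theorem slice_amp (C : Matrix m' m ℂ) (Y : Matrix (n × m) (n × m) ℂ) (j k : m') :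
    slice (amp C Y) j k = ∑ p, ∑ q, (C j p * star (C k q)) • slice Y p q := by
  ext i i'
  simp only [slice, amp, Matrix.of_apply, Matrix.mul_apply, Fintype.sum_prod_type,
    Matrix.kroneckerMap_apply, Matrix.conjTranspose_apply, Matrix.one_apply, Matrix.sum_apply,
    Matrix.smul_apply, smul_eq_mul, ite_mul, one_mul, zero_mul, Finset.sum_mul]
  simp only [apply_ite star, star_zero, mul_ite, mul_zero, Finset.sum_const_zero, Finset.sum_ite_irrel, Finset.sum_ite_eq, Finset.mem_univ, if_true]
  rw [Finset.sum_comm]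
  refine Finset.sum_congr rfl fun p _ => Finset.sum_congr rfl fun q _ => ?_
  ring

theorem partialTrace_amp (C : Matrix m' m ℂ) (Y : Matrix (n × m) (n × m) ℂ) :
    partialTrace (amp C Y) = C * partialTrace Y * Cᴴ := by
  ext j k
  rw [partialTrace_apply, slice_amp]
  simp only [Matrix.trace_sum, Matrix.trace_smul, Matrix.mul_apply, Matrix.conjTranspose_apply,
    Finset.sum_mul, partialTrace_apply, smul_eq_mul]
  rw [Finset.sum_comm]
  refine Finset.sum_congr rfl fun p _ => Finset.sum_congr rfl fun q _ => ?_
  ring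

theorem kronecker_mulVec_vec (C : Matrix m' m ℂ) (V : Matrix n m ℂ) :
    ((1 : Matrix n n ℂ) ⊗ₖ C) *ᵥ vec V = vec (V * Cᵀ) := by
  ext ⟨i, j⟩
  simp only [Matrix.mulVec, dotProduct, vec, Matrix.kroneckerMap_apply, Fintype.sum_prod_type,
    Matrix.mul_apply, Matrix.transpose_apply, Matrix.one_apply, ite_mul, one_mul, zero_mul,
    Finset.sum_ite_irrel, Finset.sum_const_zero, Finset.sum_ite_eq, Finset.mem_univ, if_true]
  exact Finset.sum_congr rfl fun p _ => mul_comm _ _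

theorem conj_rankOne {κ : Type*} (A : Matrix κ ι ℂ) (v : ι → ℂ) :
    A * rankOne v * Aᴴ = rankOne (A *ᵥ v) := by
  rw [rankOne, rankOne, Matrix.mul_vecMulVec, Matrix.vecMulVec_mul, Matrix.star_mulVec]

theorem amp_rankOne_vec (C : Matrix m' m ℂ) (V : Matrix n m ℂ) :
    amp C (rankOne (vec V)) = rankOne (vec (V * Cᵀ)) := by
  rw [amp, conj_rankOne, kronecker_mulVec_vec]

theorem conj_mono {κ : Type*} [Fintype κ] {Y Y' : Matrix ι ι ℂ} (h : Y ≤ Y')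
    (A : Matrix κ ι ℂ) : A * Y * Aᴴ ≤ A * Y' * Aᴴ := by
  rw [Matrix.le_iff] at h ⊢
  have := h.mul_mul_conjTranspose_same A
  rwa [Matrix.mul_sub, Matrix.sub_mul] at this

theorem amp_mono (C : Matrix m' m ℂ) {Y Y' : Matrix (n × m) (n × m) ℂ} (h : Y ≤ Y') :
    amp C Y ≤ amp C Y' := conj_mono h _

theorem rankOne_nonneg (v : ι → ℂ) : 0 ≤ rankOne v :=
  Matrix.nonneg_iff_posSemidef.2 (Matrix.posSemidef_vecMulVec_self_star v)

theorem trace_mul_rankOne (Y : Matrix ι ι ℂ) (v : ι → ℂ) :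
    (Y * rankOne v).trace = star v ⬝ᵥ (Y *ᵥ v) := by
  rw [rankOne, Matrix.mul_vecMulVec, Matrix.trace_vecMulVec, dotProduct_comm]

theorem partialTrace_add (Y Y' : Matrix (n × m) (n × m) ℂ) :
    partialTrace (Y + Y') = partialTrace Y + partialTrace Y' := by
  ext; simp [partialTrace, Finset.sum_add_distrib]

theorem partialTrace_smul (c : ℂ) (Y : Matrix (n × m) (n × m) ℂ) :
    partialTrace (c • Y) = c • partialTrace Y := by
  ext; simp [partialTrace, Finset.mul_sum]

theorem partialTrace_nonneg {Y : Matrix (n × m) (n × m) ℂ} (h : 0 ≤ Y) :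
    0 ≤ partialTrace Y := by
  have : partialTrace Y = ∑ i, Y.submatrix (fun j => (i, j)) (fun j => (i, j)) := by
    ext; simp [partialTrace, Matrix.sum_apply]
  rw [this, Matrix.nonneg_iff_posSemidef]
  exact Matrix.posSemidef_sum _ fun i _ => (Matrix.nonneg_iff_posSemidef.1 h).submatrix _

theorem mem_tensorFull_iff (S : Submodule ℂ (Matrix n n ℂ)) (Y : Matrix (n × n) (n × n) ℂ) :
    Y ∈ tensorFull S ↔ ∀ j k, slice Y j k ∈ S := by
  constructor
  · intro h
    induction h using Submodule.span_induction with
    | mem x h =>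
      obtain ⟨X, hX, M, rfl⟩ := h
      intro j k
      rw [slice_kronecker]
      exact S.smul_mem _ hX
    | zero => intro j k; exact S.zero_mem
    | add x y _ _ hx hy => intro j k; exact S.add_mem (hx j k) (hy j k)
    | smul a x _ hx => intro j k; exact S.smul_mem a (hx j k)
  · intro h
    have : Y = ∑ j, ∑ k, slice Y j k ⊗ₖ Matrix.single j k (1 : ℂ) := by
      ext ⟨i, j⟩ ⟨i', k⟩
      simp [Matrix.sum_apply, slice, Matrix.single_apply, ite_and, Finset.sum_ite_irrel]
    rw [this]
    exact Submodule.sum_mem _ fun j _ => Submodule.sum_mem _ fun k _ =>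
      Submodule.subset_span ⟨_, h j k, _, rfl⟩

theorem sqrt_mul_conjTranspose {W : Matrix n n ℂ} (h : 0 ≤ W) :
    CFC.sqrt W * (CFC.sqrt W)ᴴ = W := by
  have h1 : (CFC.sqrt W)ᴴ = CFC.sqrt W :=
    (Matrix.nonneg_iff_posSemidef.1 (CFC.sqrt_nonneg W)).isHermitian
  rw [h1, CFC.sqrt_mul_sqrt_self W h]

theorem isHermitian_sqrt (W : Matrix n n ℂ) : (CFC.sqrt W)ᴴ = CFC.sqrt W :=
  (Matrix.nonneg_iff_posSemidef.1 (CFC.sqrt_nonneg W)).isHermitian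

theorem sqrtVec_eq (W : Matrix n n ℂ) : sqrtVec W = vec (CFC.sqrt W) := by
  ext ⟨i, j⟩
  simp [sqrtVec, vec, Matrix.mulVec, dotProduct, maxEnt, Matrix.one_apply,
    Fintype.sum_prod_type]

theorem trace_mul_nonneg {A B : Matrix ι ι ℂ} (hA : 0 ≤ A) (hB : 0 ≤ B) :
    0 ≤ (A * B).trace := by
  have := ((Matrix.nonneg_iff_posSemidef.1 hB).mul_mul_conjTranspose_same
    (CFC.sqrt A)).trace_nonneg
  rwa [isHermitian_sqrt, Matrix.trace_mul_cycle, CFC.sqrt_mul_sqrt_self A hA] at this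

theorem trace_mul_mono_right {A B C : Matrix ι ι ℂ} (hA : 0 ≤ A) (h : B ≤ C) :
    (A * B).trace.re ≤ (A * C).trace.re := by
  have := (Complex.le_def.1 (trace_mul_nonneg hA (sub_nonneg.2 h))).1
  rw [Matrix.mul_sub, Matrix.trace_sub, Complex.sub_re, Complex.zero_re] at this
  linarith

theorem trace_mul_mono_left {A B C : Matrix ι ι ℂ} (hA : 0 ≤ A) (h : B ≤ C) :
    (B * A).trace.re ≤ (C * A).trace.re := by
  rw [Matrix.trace_mul_comm B, Matrix.trace_mul_comm C]
  exact trace_mul_mono_right hA h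

end Slices

section Contractions

open scoped ComplexOrder

theorem exists_contraction_comp {E F G : Type*} [NormedAddCommGroup E] [InnerProductSpace ℂ E]
    [NormedAddCommGroup F] [InnerProductSpace ℂ F] [FiniteDimensional ℂ F]
    [NormedAddCommGroup G] [InnerProductSpace ℂ G]
    (f : E →ₗ[ℂ] F) (g : E →ₗ[ℂ] G) (h : ∀ x, ‖g x‖ ≤ ‖f x‖) :
    ∃ k : F →ₗ[ℂ] G, k ∘ₗ f = g ∧ ∀ y, ‖k y‖ ≤ ‖y‖ := by
  obtain ⟨s, hs⟩ := f.rangeRestrict.exists_rightInverse_of_surjective f.range_rangeRestrict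
  have hs' : ∀ y, f (s y) = y := fun y => congrArg Subtype.val (LinearMap.congr_fun hs y)
  refine ⟨g ∘ₗ s ∘ₗ (LinearMap.range f).orthogonalProjectionOnto.toLinearMap, ?_, ?_⟩
  · ext x
    have h1 : (LinearMap.range f).orthogonalProjectionOnto (f x) = ⟨f x, x, rfl⟩ :=
      Submodule.orthogonalProjectionOnto_mem_subspace_eq_self (K := LinearMap.range f) ⟨f x, x, rfl⟩
    have h2 := h (s ⟨f x, x, rfl⟩ - x)
    rw [map_sub f, hs', sub_self, norm_zero, norm_le_zero_iff, map_sub, sub_eq_zero] at h2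
    simpa [h1] using h2
  · intro y
    refine (h _).trans ?_
    rw [LinearMap.comp_apply, hs']
    exact Submodule.norm_orthogonalProjectionOnto_apply_le _ y

variable {n m m' ι : Type*} [Fintype n] [Fintype m] [Fintype m'] [Fintype ι]
  [DecidableEq n] [DecidableEq m] [DecidableEq m'] [DecidableEq ι]

theorem star_dotProduct_self (v : ι → ℂ) :
    star v ⬝ᵥ v = ((‖WithLp.toLp 2 v‖ ^ 2 : ℝ) : ℂ) := by
  rw [dotProduct_comm, EuclideanSpace.norm_sq_eq]
  simp [dotProduct, Complex.mul_conj, Complex.normSq_eq_norm_sq]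

theorem dotProduct_conjTranspose_mul (A : Matrix m ι ℂ) (v : ι → ℂ) :
    star v ⬝ᵥ ((Aᴴ * A) *ᵥ v) = ((‖WithLp.toLp 2 (A *ᵥ v)‖ ^ 2 : ℝ) : ℂ) := by
  rw [← star_dotProduct_self, Matrix.star_mulVec, ← Matrix.dotProduct_mulVec, Matrix.mulVec_mulVec]

theorem conjTranspose_mul_le_iff (A : Matrix m ι ℂ) (B : Matrix m' ι ℂ) :
    Aᴴ * A ≤ Bᴴ * B ↔
      ∀ v : ι → ℂ, ‖WithLp.toLp 2 (A *ᵥ v)‖ ≤ ‖WithLp.toLp 2 (B *ᵥ v)‖ := by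
  have key : ∀ v : ι → ℂ, 0 ≤ star v ⬝ᵥ ((Bᴴ * B - Aᴴ * A) *ᵥ v) ↔
      ‖WithLp.toLp 2 (A *ᵥ v)‖ ≤ ‖WithLp.toLp 2 (B *ᵥ v)‖ := by
    intro v
    rw [Matrix.sub_mulVec, dotProduct_sub, dotProduct_conjTranspose_mul,
      dotProduct_conjTranspose_mul, sub_nonneg, Complex.real_le_real]
    exact pow_le_pow_iff_left₀ (norm_nonneg _) (norm_nonneg _) two_ne_zero
  rw [Matrix.le_iff]
  refine ⟨fun h v => (key v).1 (h.dotProduct_mulVec_nonneg v), fun h =>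
    Matrix.PosSemidef.of_dotProduct_mulVec_nonneg ?_ fun v => (key v).2 (h v)⟩
  exact (Matrix.isHermitian_conjTranspose_mul_self B).sub
    (Matrix.isHermitian_conjTranspose_mul_self A)

theorem mul_conjTranspose_le_one {D : Matrix m ι ℂ} (h : Dᴴ * D ≤ 1) : D * Dᴴ ≤ 1 := by
  have h1 := conj_mono h D
  have h2 := Matrix.posSemidef_self_mul_conjTranspose (1 - D * Dᴴ)
  rw [← Matrix.nonneg_iff_posSemidef] at h2
  have h3 : (1 - D * Dᴴ) * (1 - D * Dᴴ)ᴴ + (D * (1 : Matrix ι ι ℂ) * Dᴴ - D * (Dᴴ * D) * Dᴴ) = 1 - D * Dᴴ := by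
    simp only [Matrix.conjTranspose_sub, Matrix.conjTranspose_one, Matrix.conjTranspose_mul,
      Matrix.conjTranspose_conjTranspose, Matrix.mul_sub, Matrix.sub_mul, Matrix.mul_one,
      Matrix.one_mul, Matrix.mul_assoc]
    abel
  rw [← sub_nonneg, ← h3]
  exact add_nonneg h2 (sub_nonneg.2 h1)

/-- Douglas' factorization lemma. -/
theorem exists_contraction_of_le {V : Matrix n m ℂ} {V' : Matrix n m' ℂ}
    (h : V' * V'ᴴ ≤ V * Vᴴ) : ∃ C : Matrix m m' ℂ, V' = V * C ∧ Cᴴ * C ≤ 1 := by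
  have h' : V'ᴴᴴ * V'ᴴ ≤ Vᴴᴴ * Vᴴ := by simpa using h
  rw [conjTranspose_mul_le_iff] at h'
  obtain ⟨k, hk, hk'⟩ := exists_contraction_comp (Matrix.toEuclideanLin Vᴴ)
    (Matrix.toEuclideanLin V'ᴴ) (fun x => h' (WithLp.ofLp x))
  obtain ⟨D, rfl⟩ := Matrix.toEuclideanLin.surjective k
  have hD : D * Vᴴ = V'ᴴ := by
    apply Matrix.toEuclideanLin.injective
    rw [← hk]
    ext x i
    simp [Matrix.toLpLin_apply, Matrix.mulVec_mulVec]
  refine ⟨Dᴴ, ?_, ?_⟩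
  · rw [← Matrix.conjTranspose_inj, ← hD]
    simp
  · rw [Matrix.conjTranspose_conjTranspose]
    apply mul_conjTranspose_le_one
    have := (conjTranspose_mul_le_iff D (1 : Matrix m m ℂ)).2 (fun v => by
      simpa [Matrix.toLpLin_apply] using hk' (WithLp.toLp 2 v))
    simpa using this

end Contractions

section Feasible

open scoped ComplexOrder

variable {n m m' : Type*} [Fintype n] [Fintype m] [Fintype m']
  [DecidableEq n] [DecidableEq m] [DecidableEq m']

/-- `V` is dominated with value `l`: some `Y ∈ S ⊗ L(B)` has `Tr_A Y ≤ l I` and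
`Y ≥ (V ⊗ I) |Φ⟩⟨Φ| (V ⊗ I)†`. -/
def Feasible (S : Submodule ℂ (Matrix n n ℂ)) (l : ℝ) (V : Matrix n m ℂ) : Prop :=
  ∃ Y : Matrix (n × m) (n × m) ℂ, (∀ j k, slice Y j k ∈ S) ∧
    partialTrace Y ≤ (l : ℂ) • (1 : Matrix m m ℂ) ∧ rankOne (vec V) ≤ Y

variable {S : Submodule ℂ (Matrix n n ℂ)}

theorem mem_thetaValues_iff {W : Matrix n n ℂ} {l : ℝ} :
    l ∈ thetaValues S W ↔ Feasible S l (CFC.sqrt W) := by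
  simp only [thetaValues, Set.mem_ofPred_eq, Feasible, mem_tensorFull_iff, sqrtVec_eq, rankOne]

theorem slice_amp_mem (C : Matrix m' m ℂ) {Y : Matrix (n × m) (n × m) ℂ}
    (hY : ∀ j k, slice Y j k ∈ S) (j k : m') : slice (amp C Y) j k ∈ S := by
  rw [slice_amp]
  exact S.sum_mem fun p _ => S.sum_mem fun q _ => S.smul_mem _ (hY p q)

theorem Feasible.of_le {l : ℝ} (hl : 0 ≤ l) {V : Matrix n m ℂ} (h : Feasible S l V)
    {V' : Matrix n m' ℂ} (hV : V' * V'ᴴ ≤ V * Vᴴ) : Feasible S l V' := by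
  obtain ⟨Y, hYS, hYl, hYV⟩ := h
  obtain ⟨C, rfl, hC⟩ := exists_contraction_of_le hV
  refine ⟨amp Cᵀ Y, slice_amp_mem _ hYS, ?_, ?_⟩
  · rw [partialTrace_amp]
    refine (conj_mono hYl _).trans ?_
    have h1 : Cᵀ * Cᵀᴴ ≤ 1 := by
      rw [Matrix.le_iff] at hC ⊢
      have h2 := hC.transpose
      rwa [Matrix.transpose_sub, Matrix.transpose_one, Matrix.transpose_mul] at h2
    rw [Matrix.mul_smul, Matrix.smul_mul, Matrix.mul_one]
    rw [Matrix.le_iff] at h1 ⊢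
    rw [← smul_sub]
    exact h1.smul (by exact_mod_cast hl)
  · have := amp_mono Cᵀ hYV
    rwa [amp_rankOne_vec, Matrix.transpose_transpose] at this

theorem Feasible.mono {l l' : ℝ} (hl : l ≤ l') {V : Matrix n m ℂ} (h : Feasible S l V) :
    Feasible S l' V := by
  obtain ⟨Y, hYS, hYl, hYV⟩ := h
  refine ⟨Y, hYS, hYl.trans ?_, hYV⟩
  rw [Matrix.le_iff, ← sub_smul]
  exact Matrix.PosSemidef.one.smul (by rw [sub_nonneg]; exact_mod_cast hl)

theorem smul_one_nonneg_imp [Nonempty m] {l : ℝ} (h : 0 ≤ (l : ℂ) • (1 : Matrix m m ℂ)) :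
    0 ≤ l := by
  have := (Matrix.nonneg_iff_posSemidef.1 h).diag_nonneg (i := Classical.arbitrary m)
  simpa using this

theorem Feasible.nonneg [Nonempty m] {l : ℝ} {V : Matrix n m ℂ} (h : Feasible S l V) :
    0 ≤ l := by
  obtain ⟨Y, hYS, hYl, hYV⟩ := h
  exact smul_one_nonneg_imp ((partialTrace_nonneg ((rankOne_nonneg _).trans hYV)).trans hYl)

theorem vec_smul (c : ℂ) (V : Matrix n m ℂ) : vec (c • V) = c • vec V := rfl

theorem rankOne_smul {ι : Type*} (c : ℂ) (v : ι → ℂ) :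
    rankOne (c • v) = (c * star c) • rankOne v := by
  ext i j
  simp [rankOne, Matrix.vecMulVec_apply]
  ring

theorem slice_smul (c : ℂ) (Y : Matrix (n × m) (n × m) ℂ) (j k : m) :
    slice (c • Y) j k = c • slice Y j k := rfl

theorem slice_add (Y Y' : Matrix (n × m) (n × m) ℂ) (j k : m) :
    slice (Y + Y') j k = slice Y j k + slice Y' j k := rfl

theorem smul_le_smul_nonneg {ι : Type*} {A B : Matrix ι ι ℂ} (h : A ≤ B) {c : ℂ} (hc : 0 ≤ c) :
    c • A ≤ c • B := by
  rw [Matrix.le_iff] at h ⊢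
  rw [← smul_sub]
  exact h.smul hc

theorem Feasible.smul {l : ℝ} {V : Matrix n m ℂ} (h : Feasible S l V) (c : ℝ) :
    Feasible S (c ^ 2 * l) ((c : ℂ) • V) := by
  obtain ⟨Y, hYS, hYl, hYV⟩ := h
  have hc : (0 : ℂ) ≤ (c : ℂ) ^ 2 := by exact_mod_cast sq_nonneg c
  refine ⟨((c : ℂ) ^ 2) • Y, fun j k => S.smul_mem _ (hYS j k), ?_, ?_⟩
  · rw [partialTrace_smul]
    refine (smul_le_smul_nonneg hYl hc).trans_eq ?_
    rw [smul_smul]; push_cast; rfl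
  · rw [vec_smul, rankOne_smul]
    have : (c : ℂ) * star (c : ℂ) = (c : ℂ) ^ 2 := by simp [sq]
    rw [this]
    exact smul_le_smul_nonneg hYV hc

/-- The set `{W ≥ 0 : θ(S, W) ≤ 1}`, expressed without an infimum. -/
def level (S : Submodule ℂ (Matrix n n ℂ)) : Set (Matrix n n ℂ) :=
  {W | 0 ≤ W ∧ Feasible S 1 (CFC.sqrt W)}

theorem Feasible.mem_level {V : Matrix n m ℂ} (h : Feasible S 1 V) : V * Vᴴ ∈ level S := by
  have h0 : 0 ≤ V * Vᴴ := Matrix.nonneg_iff_posSemidef.2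
    (Matrix.posSemidef_self_mul_conjTranspose V)
  exact ⟨h0, h.of_le zero_le_one (sqrt_mul_conjTranspose h0).le⟩

theorem level_of_le {W W' : Matrix n n ℂ} (h : W ∈ level S) (h0 : 0 ≤ W') (hW : W' ≤ W) :
    W' ∈ level S :=
  ⟨h0, h.2.of_le zero_le_one (by
    rwa [sqrt_mul_conjTranspose h0, sqrt_mul_conjTranspose h.1])⟩

theorem Feasible.of_mem_level {W : Matrix n n ℂ} (h : W ∈ level S) {V : Matrix n m ℂ}
    (hV : V * Vᴴ ≤ W) : Feasible S 1 V :=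
  h.2.of_le zero_le_one (by rwa [sqrt_mul_conjTranspose h.1])

theorem feasible_sqrt_iff {W : Matrix n n ℂ} (h0 : 0 ≤ W) {l : ℝ} (hl : 0 < l) :
    Feasible S l (CFC.sqrt W) ↔ ((l⁻¹ : ℝ) : ℂ) • W ∈ level S := by
  have hli : (0 : ℂ) ≤ ((l⁻¹ : ℝ) : ℂ) := by exact_mod_cast (inv_pos.2 hl).le
  have h1 : 0 ≤ ((l⁻¹ : ℝ) : ℂ) • W := by
    simpa using smul_le_smul_nonneg h0 hli
  have e : ∀ (c : ℝ) (V : Matrix n n ℂ),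
      ((c : ℂ) • V) * ((c : ℂ) • V)ᴴ = ((c ^ 2 : ℝ) : ℂ) • (V * Vᴴ) := by
    intro c V
    rw [Matrix.conjTranspose_smul, Matrix.smul_mul, Matrix.mul_smul, smul_smul]
    simp [sq]
  constructor
  · intro h
    have h2 := h.smul (Real.sqrt l⁻¹)
    rw [Real.sq_sqrt (inv_pos.2 hl).le, inv_mul_cancel₀ hl.ne'] at h2
    have h3 := h2.mem_level
    rwa [e, sqrt_mul_conjTranspose h0, Real.sq_sqrt (inv_pos.2 hl).le] at h3
  · rintro ⟨_, h⟩
    have h2 := h.smul (Real.sqrt l)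
    rw [Real.sq_sqrt hl.le, mul_one] at h2
    refine h2.of_le hl.le ?_
    rw [e, sqrt_mul_conjTranspose h0, sqrt_mul_conjTranspose h1, Real.sq_sqrt hl.le, smul_smul,
      ← Complex.ofReal_mul, mul_inv_cancel₀ hl.ne', Complex.ofReal_one, one_smul]

end Feasible

section Topology

open scoped ComplexOrder Pointwise

variable {m ι : Type*} [Fintype m] [DecidableEq m] [Fintype ι] [DecidableEq ι]

theorem locallyConvexSpace_matrix : LocallyConvexSpace ℝ (Matrix ι ι ℂ) :=
  inferInstanceAs (LocallyConvexSpace ℝ (ι → ι → ℂ))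

theorem isClosed_nonneg : IsClosed {A : Matrix ι ι ℂ | 0 ≤ A} := by
  have : {A : Matrix ι ι ℂ | 0 ≤ A} = {A | Aᴴ = A} ∩ ⋂ v : ι → ℂ, {A | 0 ≤ star v ⬝ᵥ (A *ᵥ v)} := by
    ext A
    simp only [Set.mem_ofPred_eq, Set.mem_inter_iff, Set.mem_iInter,
      Matrix.nonneg_iff_posSemidef, Matrix.posSemidef_iff_dotProduct_mulVec]
    rfl
  rw [this]
  refine (isClosed_eq continuous_id.matrix_conjTranspose continuous_id).inter
    (isClosed_iInter fun v => ?_)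
  exact isClosed_le continuous_const
    (continuous_const.dotProduct (continuous_id.matrix_mulVec continuous_const))

theorem isClosed_le_matrix {X : Type*} [TopologicalSpace X] {f g : X → Matrix ι ι ℂ}
    (hf : Continuous f) (hg : Continuous g) : IsClosed {x | f x ≤ g x} := by
  have := isClosed_nonneg.preimage (hg.sub hf)
  convert this using 1
  ext x
  simp

theorem norm_apply_le_trace {A : Matrix ι ι ℂ} (hA : 0 ≤ A) (i j : ι) :
    ‖A i j‖ ≤ A.trace.re := by
  have hA' := Matrix.nonneg_iff_posSemidef.1 hA
  have hd : ∀ i, 0 ≤ (A i i).re := fun i => (Complex.le_def.1 (hA'.diag_nonneg (i := i))).1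
  have ht : ∀ i, (A i i).re ≤ A.trace.re := by
    intro i
    simp only [Matrix.trace, Matrix.diag_apply, Complex.re_sum]
    exact Finset.single_le_sum (fun j _ => hd j) (Finset.mem_univ i)
  set R := CFC.sqrt A
  have hR : R * Rᴴ = A := sqrt_mul_conjTranspose hA
  have hdiag : ∀ i, (A i i).re = ∑ k, ‖R i k‖ ^ 2 := by
    intro i
    rw [← hR]
    simp [Matrix.mul_apply, Complex.mul_conj, Complex.normSq_eq_norm_sq, -Complex.ofReal_pow]
  have : ‖A i j‖ ≤ ((A i i).re + (A j j).re) / 2 := by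
    rw [hdiag, hdiag, ← Finset.sum_add_distrib, Finset.sum_div]
    conv_lhs => rw [← hR, Matrix.mul_apply]
    refine (norm_sum_le _ _).trans (Finset.sum_le_sum fun k _ => ?_)
    rw [Matrix.conjTranspose_apply, norm_mul, norm_star]
    nlinarith [sq_nonneg (‖R i k‖ - ‖R j k‖)]
  linarith [ht i, ht j]

theorem isCompact_norm_le (c : ℝ) :
    IsCompact {A : Matrix m ι ℂ | ∀ i j, ‖A i j‖ ≤ c} := by
  have := IsCompact.matrix (m := m) (n := ι) (isCompact_closedBall (0 : ℂ) c)
  convert this using 1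
  ext A
  simp [Set.mem_matrix]

theorem isCompact_nonneg_trace_le (c : ℝ) :
    IsCompact {A : Matrix ι ι ℂ | 0 ≤ A ∧ A.trace.re ≤ c} := by
  refine (isCompact_norm_le c).of_isClosed_subset ?_ fun A hA i j =>
    (norm_apply_le_trace hA.1 i j).trans hA.2
  exact isClosed_nonneg.inter
    (isClosed_le (Complex.continuous_re.comp continuous_id.matrix_trace) continuous_const)

theorem exists_isHermitian_trace_eq (f : Matrix ι ι ℂ →ₗ[ℝ] ℝ) :
    ∃ G : Matrix ι ι ℂ, Gᴴ = G ∧ ∀ X, (G * X).trace.re = (f X + f Xᴴ) / 2 := by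
  let F : Matrix ι ι ℂ := Matrix.of fun j i =>
    (f (Matrix.single i j 1) : ℂ) - f (Matrix.single i j Complex.I) * Complex.I
  have hF : ∀ X, (F * X).trace.re = f X := by
    intro X
    have h1 : ∀ i j, f (Matrix.single i j (X i j)) = (F j i * X i j).re := by
      intro i j
      have : Matrix.single i j (X i j) = (X i j).re • Matrix.single i j (1 : ℂ)
          + (X i j).im • Matrix.single i j Complex.I := by
        rw [Matrix.smul_single, Matrix.smul_single, ← Matrix.single_add]
        congr 1
        apply Complex.ext <;> simp
      rw [this, map_add, map_smul, map_smul]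
      simp [F]
      ring
    conv_rhs => rw [Matrix.matrix_eq_sum_single X]
    simp only [map_sum, h1, Matrix.trace, Matrix.diag_apply, Matrix.mul_apply, Complex.re_sum]
    rw [Finset.sum_comm]
  refine ⟨(2⁻¹ : ℂ) • (F + Fᴴ), ?_, fun X => ?_⟩
  · rw [Matrix.conjTranspose_smul, Matrix.conjTranspose_add, Matrix.conjTranspose_conjTranspose,
      add_comm]
    simp
  · have h2 : (Fᴴ * X).trace.re = f Xᴴ := by
      have h3 : (F * Xᴴ).trace = star (Fᴴ * X).trace := by
        rw [← Matrix.trace_conjTranspose, Matrix.conjTranspose_mul,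
          Matrix.conjTranspose_conjTranspose, Matrix.trace_mul_comm]
      rw [← hF, h3]
      exact (Complex.conj_re _).symm
    rw [Matrix.smul_mul, Matrix.trace_smul, Matrix.add_mul, Matrix.trace_add, ← hF X, ← h2]
    have : (2⁻¹ : ℂ) = ((2⁻¹ : ℝ) : ℂ) := by simp
    rw [smul_eq_mul, this, Complex.re_ofReal_mul, Complex.add_re]
    ring

theorem nonneg_of_trace_rankOne {G : Matrix ι ι ℂ} (hG : Gᴴ = G)
    (h : ∀ v, 0 ≤ (G * rankOne v).trace.re) : 0 ≤ G := by
  rw [Matrix.nonneg_iff_posSemidef]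
  refine Matrix.PosSemidef.of_dotProduct_mulVec_nonneg hG fun v => ?_
  have h1 := h v
  rw [trace_mul_rankOne] at h1
  have h2 : (star v ⬝ᵥ G *ᵥ v).im = 0 := Matrix.IsHermitian.im_star_dotProduct_mulVec_self hG v
  exact Complex.le_def.2 ⟨h1, h2.symm⟩

theorem isHermitian_of_nonneg {A : Matrix ι ι ℂ} (h : 0 ≤ A) : Aᴴ = A :=
  (Matrix.nonneg_iff_posSemidef.1 h).isHermitian

theorem forall_nonneg_smul {A : Matrix ι ι ℂ} (h : 0 ≤ A) {t : ℝ} (ht : 0 ≤ t) : 0 ≤ t • A := by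
  have := smul_le_smul_nonneg h (c := (t : ℂ)) (by exact_mod_cast ht)
  rw [smul_zero] at this
  convert this using 1
  ext i j
  simp

theorem convex_nonneg : Convex ℝ {A : Matrix ι ι ℂ | 0 ≤ A} := by
  intro A hA B hB a b ha hb _
  exact add_nonneg (forall_nonneg_smul hA ha) (forall_nonneg_smul hB hb)

theorem nonneg_of_forall_neg_mul_lt {a u x : ℝ} (h : ∀ t : ℝ, 0 ≤ t → x - t * a < u) : 0 ≤ a := by
  by_contra! ha
  have h0 := h 0 le_rfl
  have := h ((u - x) / (-a)) (div_nonneg (by linarith) (by linarith))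
  have e : (u - x) / (-a) * a = -(u - x) := by
    have := ha.ne
    field_simp
  linarith

/-- The bipolar theorem for hereditary closures of compact convex sets. -/
theorem exists_le_of_forall_antiblocker {K : Set (Matrix ι ι ℂ)} (hK : IsCompact K)
    (hKc : Convex ℝ K) (hK0 : K.Nonempty) (hKp : ∀ X ∈ K, 0 ≤ X) {W : Matrix ι ι ℂ} (hW : 0 ≤ W)
    (h : ∀ Z, Z ∈ antiblocker K → (W * Z).trace.re ≤ 1) : ∃ X ∈ K, W ≤ X := by
  by_contra! hcon
  have := locallyConvexSpace_matrix (ι := ι)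
  have hcl : IsClosed (-{A : Matrix ι ι ℂ | 0 ≤ A} + K) :=
    isClosed_nonneg.neg.add_right_of_isCompact hK
  have hnot : W ∉ (-{A : Matrix ι ι ℂ | 0 ≤ A} + K) := by
    rintro ⟨Q, hQ, X, hX, rfl⟩
    refine hcon X hX ?_
    have : 0 ≤ -Q := hQ
    simpa using this
  obtain ⟨f, u, hf, hfW⟩ := geometric_hahn_banach_closed_point
    (convex_nonneg.neg.add hKc) hcl hnot
  obtain ⟨G, hG, hGf⟩ := exists_isHermitian_trace_eq (f : Matrix ι ι ℂ →ₗ[ℝ] ℝ)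
  have hGf' : ∀ X : Matrix ι ι ℂ, 0 ≤ X → (G * X).trace.re = f X := by
    intro X hX
    rw [hGf, isHermitian_of_nonneg hX]
    simp
  obtain ⟨X₀, hX₀⟩ := hK0
  have hG0 : 0 ≤ G := by
    refine nonneg_of_trace_rankOne hG fun v => ?_
    rw [hGf' _ (rankOne_nonneg v)]
    refine nonneg_of_forall_neg_mul_lt (x := f X₀) (u := u) fun t ht => ?_
    have := hf (-(t • rankOne v) + X₀) (Set.add_mem_add
      (by simpa using forall_nonneg_smul (rankOne_nonneg v) ht) hX₀)
    rw [map_add, map_neg, map_smul, smul_eq_mul] at this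
    linarith
  have hfK : ∀ X ∈ K, f X < u := by
    intro X hX
    have := hf (0 + X) (Set.add_mem_add (by simp) hX)
    rwa [zero_add] at this
  have hu : 0 < u := by
    refine lt_of_le_of_lt ?_ (hfK X₀ hX₀)
    rw [← hGf' _ (hKp _ hX₀)]
    exact (Complex.le_def.1 (trace_mul_nonneg hG0 (hKp _ hX₀))).1
  have e : ∀ X : Matrix ι ι ℂ, 0 ≤ X → (X * u⁻¹ • G).trace.re = u⁻¹ * f X := by
    intro X hX
    rw [Matrix.mul_smul, Matrix.trace_smul, Matrix.trace_mul_comm, Complex.real_smul,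
      Complex.re_ofReal_mul, hGf' X hX]
  have := h (u⁻¹ • G) ⟨forall_nonneg_smul hG0 (inv_pos.2 hu).le, fun X hX => by
    rw [e X (hKp X hX), inv_mul_le_iff₀ hu, mul_one]
    exact (hfK X hX).le⟩
  rw [e W hW, inv_mul_le_iff₀ hu, mul_one] at this
  linarith

theorem isClosed_submodule_sub_nonneg (V : Submodule ℂ (Matrix ι ι ℂ))
    (hV : ∀ X ∈ V, X.trace = 0) :
    IsClosed ((V : Set (Matrix ι ι ℂ)) + -{A : Matrix ι ι ℂ | 0 ≤ A}) := by
  set C := (V : Set (Matrix ι ι ℂ)) + -{A : Matrix ι ι ℂ | 0 ≤ A}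
  refine isClosed_of_closure_subset fun c hc => ?_
  let U : Set (Matrix ι ι ℂ) := {A | c.trace.re - 1 < A.trace.re}
  have hU : IsOpen U := isOpen_lt continuous_const
    (Complex.continuous_re.comp continuous_id.matrix_trace)
  let C' := (V : Set (Matrix ι ι ℂ)) + -{A : Matrix ι ι ℂ | 0 ≤ A ∧ A.trace.re ≤ 1 - c.trace.re}
  have hC' : IsClosed C' :=
    IsClosed.add_right_of_isCompact V.closed_of_finiteDimensional
      (isCompact_nonneg_trace_le _).neg
  have hsub : U ∩ C ⊆ C' := by
    rintro _ ⟨hu, X, hX, Q, hQ, rfl⟩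
    refine ⟨X, hX, Q, ⟨hQ, ?_⟩, rfl⟩
    have h1 : c.trace.re - 1 < (X + Q).trace.re := hu
    rw [Matrix.trace_add, hV X hX, zero_add] at h1
    rw [Matrix.trace_neg, Complex.neg_re]
    linarith
  have h1 : c ∈ C' := by
    have h2 := hU.inter_closure ⟨(by simp [U] : c ∈ U), hc⟩
    exact hC'.closure_subset_iff.2 hsub h2
  obtain ⟨X, hX, Q, hQ, rfl⟩ := h1
  exact ⟨X, hX, Q, hQ.1, rfl⟩

/-- A Farkas lemma for the cone of positive semidefinite matrices and a space of traceless
matrices. -/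
theorem exists_mem_submodule_ge (V : Submodule ℂ (Matrix ι ι ℂ))
    (hV : ∀ X ∈ V, X.trace = 0) (hVs : ∀ X ∈ V, Xᴴ ∈ V) {A : Matrix ι ι ℂ} (hA : Aᴴ = A)
    (h : ∀ Y, 0 ≤ Y → (∀ X ∈ V, (Y * X).trace = 0) → (Y * A).trace.re ≤ 0) :
    ∃ X ∈ V, A ≤ X := by
  by_contra! hcon
  have := locallyConvexSpace_matrix (ι := ι)
  have hnot : A ∉ (V : Set (Matrix ι ι ℂ)) + -{A : Matrix ι ι ℂ | 0 ≤ A} := by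
    rintro ⟨X, hX, Q, hQ, rfl⟩
    refine hcon X hX ?_
    have : 0 ≤ -Q := hQ
    simpa using this
  have hVc : Convex ℝ (V : Set (Matrix ι ι ℂ)) := (V.restrictScalars ℝ).convex
  obtain ⟨f, u, hf, hfA⟩ := geometric_hahn_banach_closed_point
    (hVc.add convex_nonneg.neg) (isClosed_submodule_sub_nonneg V hV) hnot
  obtain ⟨G, hG, hGf⟩ := exists_isHermitian_trace_eq (f : Matrix ι ι ℂ →ₗ[ℝ] ℝ)
  have hu : 0 < u := by
    have := hf (0 + 0) (Set.add_mem_add V.zero_mem (by simp))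
    simpa using this
  have hfV : ∀ X ∈ V, f X = 0 := by
    have key : ∀ X ∈ V, 0 ≤ f X := by
      intro X hX
      refine nonneg_of_forall_neg_mul_lt (x := 0) (u := u) fun t _ => ?_
      have h1 : (-(t : ℂ)) • X ∈ V := V.smul_mem _ hX
      have h2 := hf ((-(t : ℂ)) • X + 0) (Set.add_mem_add h1 (by simp))
      have h3 : (-(t : ℂ)) • X + 0 = -(t • X) := by
        ext i j; simp
      rw [h3, map_neg, map_smul, smul_eq_mul] at h2
      linarith
    intro X hX
    have h1 := key X hX
    have h2 := key (-X) (V.neg_mem hX)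
    rw [map_neg] at h2
    linarith
  have hre : ∀ X ∈ V, (G * X).trace.re = 0 := by
    intro X hX
    rw [hGf]
    simp [hfV X hX, hfV _ (hVs X hX)]
  have hG0 : 0 ≤ G := by
    refine nonneg_of_trace_rankOne hG fun v => ?_
    rw [hGf, isHermitian_of_nonneg (rankOne_nonneg v)]
    refine nonneg_of_forall_neg_mul_lt (x := 0) (u := u) fun t ht => ?_
    have := hf (0 + -(t • rankOne v)) (Set.add_mem_add V.zero_mem
      (by simpa using forall_nonneg_smul (rankOne_nonneg v) ht))
    rw [zero_add, map_neg, map_smul, smul_eq_mul] at this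
    have e : ((f : Matrix ι ι ℂ →ₗ[ℝ] ℝ) (rankOne v) + (f : Matrix ι ι ℂ →ₗ[ℝ] ℝ) (rankOne v)) / 2
        = f (rankOne v) := by simp
    rw [e]
    linarith
  have h1 := h G hG0 fun X hX => by
    refine Complex.ext (hre X hX) ?_
    have := hre (Complex.I • X) (V.smul_mem _ hX)
    rw [Matrix.mul_smul, Matrix.trace_smul, smul_eq_mul, Complex.I_mul_re] at this
    simpa using this
  rw [hGf, hA] at h1
  have e : ((f : Matrix ι ι ℂ →ₗ[ℝ] ℝ) A + (f : Matrix ι ι ℂ →ₗ[ℝ] ℝ) A) / 2 = f A := by simp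
  rw [e] at h1
  linarith

end Topology

section Level

open scoped ComplexOrder

variable {n m m' ι : Type*} [Fintype n] [Fintype m] [Fintype m'] [Fintype ι]
  [DecidableEq n] [DecidableEq m] [DecidableEq m'] [DecidableEq ι]

theorem rankOne_le_one {v : ι → ℂ} (h : (star v ⬝ᵥ v).re ≤ 1) : rankOne v ≤ 1 := by
  have h1 : (Matrix.replicateCol Unit v)ᴴ * Matrix.replicateCol Unit v ≤ 1 := by
    have e : (Matrix.replicateCol Unit v)ᴴ * Matrix.replicateCol Unit v
        = Matrix.diagonal fun _ => star v ⬝ᵥ v := by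
      ext i j
      simp [Matrix.mul_apply, dotProduct]
    rw [e, ← Matrix.diagonal_one, Matrix.le_iff, Matrix.diagonal_sub, Matrix.posSemidef_diagonal_iff]
    intro _
    rw [sub_nonneg, star_dotProduct_self] at *
    exact_mod_cast h
  have h2 := mul_conjTranspose_le_one h1
  convert h2 using 1
  ext i j
  simp [rankOne, Matrix.vecMulVec_apply, Matrix.mul_apply]

/-- A Cauchy-Schwarz inequality for a positive semidefinite matrix. -/
theorem rankOne_mulVec_le {Y : Matrix ι ι ℂ} (hY : 0 ≤ Y) {x : ι → ℂ} {q : ℝ} (hq : 0 < q)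
    (hx : (star x ⬝ᵥ (Y *ᵥ x)).re ≤ q) : rankOne (((Real.sqrt q : ℂ)⁻¹) • (Y *ᵥ x)) ≤ Y := by
  set R := CFC.sqrt Y
  have hR : R * Rᴴ = Y := sqrt_mul_conjTranspose hY
  have hRs : Rᴴ = R := isHermitian_sqrt Y
  have h1 : rankOne (((Real.sqrt q : ℂ)⁻¹) • (R *ᵥ x)) ≤ 1 := by
    refine rankOne_le_one ?_
    have e : star (R *ᵥ x) ⬝ᵥ (R *ᵥ x) = star x ⬝ᵥ (Y *ᵥ x) := by
      rw [Matrix.star_mulVec, hRs, ← Matrix.dotProduct_mulVec, Matrix.mulVec_mulVec, ← hR, hRs]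
    have e2 : star ((Real.sqrt q : ℂ)⁻¹) * (Real.sqrt q : ℂ)⁻¹ = ((q⁻¹ : ℝ) : ℂ) := by
      rw [star_inv₀, ← mul_inv]
      have : star (Real.sqrt q : ℂ) = (Real.sqrt q : ℂ) := Complex.conj_ofReal _
      rw [this, ← Complex.ofReal_mul, Real.mul_self_sqrt hq.le, Complex.ofReal_inv]
    rw [star_smul, smul_dotProduct, dotProduct_smul, e, smul_smul, e2, smul_eq_mul,
      Complex.re_ofReal_mul, inv_mul_le_iff₀ hq, mul_one]
    exact hx
  have h2 := conj_mono h1 R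
  have hRR : R * R = Y := by rw [← hR, hRs]
  rwa [conj_rankOne, Matrix.mulVec_smul, Matrix.mulVec_mulVec, Matrix.mul_one, hR, hRR] at h2

variable {S : Submodule ℂ (Matrix n n ℂ)}

theorem continuous_vec : Continuous (vec : Matrix n m ℂ → n × m → ℂ) :=
  continuous_pi fun p => continuous_id.matrix_elem p.1 p.2

theorem continuous_slice (j k : m) :
    Continuous fun Y : Matrix (n × m) (n × m) ℂ => slice Y j k :=
  continuous_id.matrix_submatrix _ _

theorem continuous_partialTrace :
    Continuous (partialTrace : Matrix (n × m) (n × m) ℂ → Matrix m m ℂ) :=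
  continuous_matrix fun _ _ => continuous_finsetSum _ fun _ _ => continuous_id.matrix_elem _ _

theorem continuous_rankOne : Continuous (rankOne : (ι → ℂ) → Matrix ι ι ℂ) :=
  continuous_id.matrix_vecMulVec (continuous_pi fun i => (continuous_apply i).star)

theorem smul_one_le_smul_one {a b : ℝ} (h : a ≤ b) :
    (a : ℂ) • (1 : Matrix ι ι ℂ) ≤ (b : ℂ) • 1 := by
  rw [Matrix.le_iff, ← sub_smul]
  exact Matrix.PosSemidef.one.smul (by rw [sub_nonneg]; exact_mod_cast h)

theorem trace_re_le_of_le {A B : Matrix ι ι ℂ} (h : A ≤ B) : A.trace.re ≤ B.trace.re := by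
  have := trace_mul_mono_right (A := (1 : Matrix ι ι ℂ))
    (Matrix.nonneg_iff_posSemidef.2 Matrix.PosSemidef.one) h
  simpa using this

theorem trace_le_of_partialTrace_le {Y : Matrix (n × m) (n × m) ℂ} {l : ℝ}
    (h : partialTrace Y ≤ (l : ℂ) • (1 : Matrix m m ℂ)) : Y.trace.re ≤ l * Fintype.card m := by
  have := trace_re_le_of_le h
  rw [trace_partialTrace, Matrix.trace_smul, Matrix.trace_one] at this
  simpa using this

theorem isCompact_feasiblePairs (S : Submodule ℂ (Matrix n n ℂ)) (l : ℝ) :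
    IsCompact {p : Matrix n m ℂ × Matrix (n × m) (n × m) ℂ | (∀ j k, slice p.2 j k ∈ S) ∧
      partialTrace p.2 ≤ (l : ℂ) • (1 : Matrix m m ℂ) ∧ rankOne (vec p.1) ≤ p.2} := by
  have hS : IsClosed (S : Set (Matrix n n ℂ)) := S.closed_of_finiteDimensional
  set c := l * Fintype.card m
  refine ((isCompact_norm_le (c + 1)).prod (isCompact_norm_le c)).of_isClosed_subset ?_ ?_
  · refine IsClosed.inter ?_ (IsClosed.inter ?_ ?_)
    · have : {p : Matrix n m ℂ × Matrix (n × m) (n × m) ℂ | ∀ j k, slice p.2 j k ∈ S} =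
        ⋂ j, ⋂ k, {p | slice p.2 j k ∈ S} := by ext; simp
      change IsClosed {p : Matrix n m ℂ × Matrix (n × m) (n × m) ℂ | ∀ j k, slice p.2 j k ∈ S}
      rw [this]
      exact isClosed_iInter fun j => isClosed_iInter fun k =>
        hS.preimage ((continuous_slice j k).comp continuous_snd)
    · exact isClosed_le_matrix (continuous_partialTrace.comp continuous_snd) continuous_const
    · exact isClosed_le_matrix (continuous_rankOne.comp (continuous_vec.comp continuous_fst))
        continuous_snd
  · rintro ⟨V, Y⟩ ⟨-, hl, hV⟩
    have hY : 0 ≤ Y := (rankOne_nonneg _).trans hV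
    have ht : Y.trace.re ≤ c := trace_le_of_partialTrace_le hl
    refine ⟨fun i j => ?_, fun i j => (norm_apply_le_trace hY i j).trans ht⟩
    have h1 := norm_apply_le_trace (rankOne_nonneg (vec V)) (i, j) (i, j)
    have h2 := (h1.trans (trace_re_le_of_le hV)).trans ht
    simp only [rankOne, Matrix.vecMulVec_apply, vec, Pi.star_apply, norm_mul, norm_star] at h2
    nlinarith [sq_nonneg (‖V i j‖ - 1), norm_nonneg (V i j)]

theorem level_eq_image (S : Submodule ℂ (Matrix n n ℂ)) :
    level S = (fun p : Matrix n n ℂ × Matrix (n × n) (n × n) ℂ => p.1 * p.1ᴴ) ''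
      {p | (∀ j k, slice p.2 j k ∈ S) ∧
        partialTrace p.2 ≤ ((1 : ℝ) : ℂ) • (1 : Matrix n n ℂ) ∧ rankOne (vec p.1) ≤ p.2} := by
  ext W
  constructor
  · rintro ⟨h0, Y, hY⟩
    exact ⟨(CFC.sqrt W, Y), hY, sqrt_mul_conjTranspose h0⟩
  · rintro ⟨⟨V, Y⟩, hY, rfl⟩
    exact Feasible.mem_level ⟨Y, hY⟩

theorem isCompact_level (S : Submodule ℂ (Matrix n n ℂ)) : IsCompact (level S) := by
  rw [level_eq_image]
  exact (isCompact_feasiblePairs S 1).image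
    (continuous_fst.matrix_mul continuous_fst.matrix_conjTranspose)

theorem zero_mem_level (S : Submodule ℂ (Matrix n n ℂ)) : 0 ∈ level S := by
  refine ⟨le_rfl, 0, fun j k => S.zero_mem, ?_, ?_⟩
  · have : partialTrace (0 : Matrix (n × n) (n × n) ℂ) = 0 := by ext; simp [partialTrace]
    rw [this]
    simp
  · have : rankOne (vec (CFC.sqrt (0 : Matrix n n ℂ))) = 0 := by
      ext; simp [rankOne, vec, Matrix.vecMulVec_apply]
    exact this.le

theorem partialTrace_smul_one (c : ℂ) :
    partialTrace (c • (1 : Matrix (n × m) (n × m) ℂ)) = (c * Fintype.card n) • 1 := by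
  ext j k
  by_cases h : j = k
  · subst h; simp [partialTrace, mul_comm]
  · simp [partialTrace, h, Matrix.one_apply]

theorem exists_feasible (h1 : (1 : Matrix n n ℂ) ∈ S) (V : Matrix n m ℂ) :
    ∃ l, 0 < l ∧ Feasible S l V := by
  set c : ℝ := (star (vec V) ⬝ᵥ vec V).re + 1
  have hc0 : 0 ≤ (star (vec V) ⬝ᵥ vec V).re := by
    rw [star_dotProduct_self, Complex.ofReal_re]; positivity
  have hc : 0 < c := by positivity
  refine ⟨c * Fintype.card n + 1, by positivity, ((c : ℝ) : ℂ) • 1, fun j k => ?_, ?_, ?_⟩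
  · rw [slice_smul]
    refine S.smul_mem _ ?_
    have : slice (1 : Matrix (n × m) (n × m) ℂ) j k = ((1 : Matrix m m ℂ) j k) • 1 := by
      rw [← Matrix.one_kronecker_one, slice_kronecker]
    rw [this]
    exact S.smul_mem _ h1
  · rw [partialTrace_smul_one]
    have := smul_one_le_smul_one (ι := m) (a := c * Fintype.card n) (b := c * Fintype.card n + 1)
      (by linarith)
    simpa using this
  · have h2 : rankOne ((((Real.sqrt c)⁻¹ : ℝ) : ℂ) • vec V) ≤ 1 := by
      refine rankOne_le_one ?_
      rw [star_smul, smul_dotProduct, dotProduct_smul, smul_smul, smul_eq_mul]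
      have : star (((Real.sqrt c)⁻¹ : ℝ) : ℂ) * (((Real.sqrt c)⁻¹ : ℝ) : ℂ) = ((c⁻¹ : ℝ) : ℂ) := by
        have : star (((Real.sqrt c)⁻¹ : ℝ) : ℂ) = (((Real.sqrt c)⁻¹ : ℝ) : ℂ) :=
          Complex.conj_ofReal _
        rw [this, ← Complex.ofReal_mul, ← mul_inv, Real.mul_self_sqrt hc.le]
      rw [this, Complex.re_ofReal_mul, inv_mul_le_iff₀ hc]
      simp [c]
    have h3 := smul_le_smul_nonneg h2 (c := (c : ℂ)) (by exact_mod_cast hc.le)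
    rw [rankOne_smul, smul_smul] at h3
    have : (c : ℂ) * ((((Real.sqrt c)⁻¹ : ℝ) : ℂ) * star (((Real.sqrt c)⁻¹ : ℝ) : ℂ)) = 1 := by
      have : star (((Real.sqrt c)⁻¹ : ℝ) : ℂ) = (((Real.sqrt c)⁻¹ : ℝ) : ℂ) :=
        Complex.conj_ofReal _
      rw [this, ← Complex.ofReal_mul, ← mul_inv, Real.mul_self_sqrt hc.le, ← Complex.ofReal_mul,
        mul_inv_cancel₀ hc.ne', Complex.ofReal_one]
    rwa [this, one_smul] at h3

variable [Nonempty n]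

theorem isLeast_theta (h1 : (1 : Matrix n n ℂ) ∈ S) (W : Matrix n n ℂ) :
    IsLeast (thetaValues S W) (theta S W) := by
  obtain ⟨l₀, -, hl₀⟩ := exists_feasible h1 (CFC.sqrt W)
  have hbd : BddBelow (thetaValues S W) := ⟨0, fun l hl => (mem_thetaValues_iff.1 hl).nonneg⟩
  have hcomp : IsCompact {p : ℝ × Matrix (n × n) (n × n) ℂ | p.1 ∈ Set.Icc 0 l₀ ∧
      ((CFC.sqrt W, p.2) : Matrix n n ℂ × Matrix (n × n) (n × n) ℂ) ∈
        {p : Matrix n n ℂ × Matrix (n × n) (n × n) ℂ | (∀ j k, slice p.2 j k ∈ S) ∧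
          partialTrace p.2 ≤ (l₀ : ℂ) • (1 : Matrix n n ℂ) ∧ rankOne (vec p.1) ≤ p.2} ∧
      partialTrace p.2 ≤ (p.1 : ℂ) • (1 : Matrix n n ℂ)} := by
    have hF := isCompact_feasiblePairs (m := n) S l₀
    refine ((isCompact_Icc (a := (0 : ℝ)) (b := l₀)).prod (hF.image continuous_snd)
      ).of_isClosed_subset ?_ ?_
    · refine (isClosed_Icc.preimage continuous_fst).inter (IsClosed.inter ?_ ?_)
      · exact hF.isClosed.preimage (continuous_const.prodMk continuous_snd)
      · refine isClosed_le_matrix (continuous_partialTrace.comp continuous_snd) ?_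
        exact (Complex.continuous_ofReal.comp continuous_fst).smul continuous_const
    · rintro ⟨l, Y⟩ ⟨h, h', -⟩
      exact ⟨h, ⟨_, h', rfl⟩⟩
  have key : ∀ l, l ≤ l₀ → l ∈ thetaValues S W → ∃ Y, (l, Y) ∈
      {p : ℝ × Matrix (n × n) (n × n) ℂ | p.1 ∈ Set.Icc 0 l₀ ∧
      ((CFC.sqrt W, p.2) : Matrix n n ℂ × Matrix (n × n) (n × n) ℂ) ∈
        {p : Matrix n n ℂ × Matrix (n × n) (n × n) ℂ | (∀ j k, slice p.2 j k ∈ S) ∧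
          partialTrace p.2 ≤ (l₀ : ℂ) • (1 : Matrix n n ℂ) ∧ rankOne (vec p.1) ≤ p.2} ∧
      partialTrace p.2 ≤ (p.1 : ℂ) • (1 : Matrix n n ℂ)} := by
    intro l hl h
    obtain ⟨Y, hY1, hY2, hY3⟩ := mem_thetaValues_iff.1 h
    exact ⟨Y, ⟨(mem_thetaValues_iff.1 h).nonneg, hl⟩,
      ⟨hY1, hY2.trans (smul_one_le_smul_one hl), hY3⟩, hY2⟩
  obtain ⟨Y₀, hY₀⟩ := key l₀ le_rfl (mem_thetaValues_iff.2 hl₀)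
  obtain ⟨⟨l, Y⟩, hlY, hmin⟩ := hcomp.exists_isMinOn ⟨_, hY₀⟩ continuous_fst.continuousOn
  have hmem : l ∈ thetaValues S W :=
    mem_thetaValues_iff.2 ⟨Y, hlY.2.1.1, hlY.2.2, hlY.2.1.2.2⟩
  have hleast : IsLeast (thetaValues S W) l := by
    refine ⟨hmem, fun l' hl' => ?_⟩
    rcases le_total l' l₀ with h | h
    · obtain ⟨Y', hY'⟩ := key l' h hl'
      exact hmin hY'
    · exact hlY.1.2.trans h
  rw [theta, hleast.csInf_eq]
  exact hleast

theorem theta_le_iff (h1 : (1 : Matrix n n ℂ) ∈ S) {W : Matrix n n ℂ} {l : ℝ} :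
    theta S W ≤ l ↔ Feasible S l (CFC.sqrt W) := by
  have h := isLeast_theta h1 W
  exact ⟨fun hl => (mem_thetaValues_iff.1 h.1).mono hl, fun hl => h.2 (mem_thetaValues_iff.2 hl)⟩

theorem theta_nonneg (h1 : (1 : Matrix n n ℂ) ∈ S) (W : Matrix n n ℂ) : 0 ≤ theta S W :=
  (mem_thetaValues_iff.1 (isLeast_theta h1 W).1).nonneg

theorem mem_level_iff (h1 : (1 : Matrix n n ℂ) ∈ S) {W : Matrix n n ℂ} :
    W ∈ level S ↔ 0 ≤ W ∧ theta S W ≤ 1 := by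
  rw [theta_le_iff h1]; rfl

theorem theta_le_iff_mem_level (h1 : (1 : Matrix n n ℂ) ∈ S) {W : Matrix n n ℂ} (h0 : 0 ≤ W)
    {l : ℝ} (hl : 0 < l) : theta S W ≤ l ↔ ((l⁻¹ : ℝ) : ℂ) • W ∈ level S := by
  rw [theta_le_iff h1, feasible_sqrt_iff h0 hl]

theorem thetaBody_eq (h1 : (1 : Matrix n n ℂ) ∈ S) : thetaBody S = antiblocker (level S) := by
  ext X
  simp only [thetaBody, antiblocker, Set.mem_ofPred_eq, mem_level_iff h1]
  refine and_congr_right fun _ => ⟨fun h A hA => ?_, fun h W hW hW1 => ?_⟩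
  · rw [Matrix.trace_mul_comm]; exact h A hA.1 hA.2
  · rw [Matrix.trace_mul_comm]; exact h W ⟨hW, hW1⟩

end Level

section Convexity

open scoped ComplexOrder

variable {n m m' : Type*} [Fintype n] [Fintype m] [Fintype m']
  [DecidableEq n] [DecidableEq m] [DecidableEq m']
variable {S : Submodule ℂ (Matrix n n ℂ)}

theorem convex_level (S : Submodule ℂ (Matrix n n ℂ)) : Convex ℝ (level S) := by
  rintro W₁ ⟨h₁, Y₁, hS₁, hl₁, hV₁⟩ W₂ ⟨h₂, Y₂, hS₂, hl₂, hV₂⟩ a b ha hb hab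
  set V₁ := CFC.sqrt W₁ with hV₁_def
  set V₂ := CFC.sqrt W₂ with hV₂_def
  let Y : Matrix (n × (n ⊕ n)) (n × (n ⊕ n)) ℂ :=
    amp (Matrix.fromRows 1 0) Y₁ + amp (Matrix.fromRows 0 1) Y₂
  let V : Matrix n (n ⊕ n) ℂ :=
    Matrix.fromCols ((Real.sqrt a : ℂ) • V₁) ((Real.sqrt b : ℂ) • V₂)
  have hsq : ∀ {c : ℝ}, 0 ≤ c → (Real.sqrt c : ℂ) * (Real.sqrt c : ℂ) = c := fun hc => by
    rw [← Complex.ofReal_mul, Real.mul_self_sqrt hc]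
  have hVV : V * Vᴴ = a • W₁ + b • W₂ := by
    have e : ∀ {c : ℝ} (_ : 0 ≤ c) (U : Matrix n n ℂ),
        ((Real.sqrt c : ℂ) • U) * ((Real.sqrt c : ℂ) • U)ᴴ = c • (U * Uᴴ) := by
      intro c hc U
      rw [Matrix.conjTranspose_smul, Matrix.smul_mul, Matrix.mul_smul, smul_smul]
      have : star (Real.sqrt c : ℂ) = (Real.sqrt c : ℂ) := Complex.conj_ofReal _
      rw [this, hsq hc]
      ext; simp
    simp only [V]
    rw [Matrix.conjTranspose_fromCols_eq_fromRows_conjTranspose, Matrix.fromCols_mul_fromRows, e ha,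
      e hb, sqrt_mul_conjTranspose h₁, sqrt_mul_conjTranspose h₂]
  rw [← hVV]
  refine Feasible.mem_level ⟨Y, fun j k => ?_, ?_, ?_⟩
  · rw [slice_add]
    exact S.add_mem (slice_amp_mem _ hS₁ _ _) (slice_amp_mem _ hS₂ _ _)
  · rw [partialTrace_add, partialTrace_amp, partialTrace_amp]
    refine (add_le_add (conj_mono hl₁ _) (conj_mono hl₂ _)).trans_eq ?_
    simp only [Matrix.conjTranspose_fromRows_eq_fromCols_conjTranspose, ← Matrix.fromBlocks_one]
    ext (i | i) (j | j) <;> simp [Matrix.one_apply]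
  · refine le_trans ?_ (add_le_add (amp_mono _ hV₁) (amp_mono _ hV₂))
    rw [amp_rankOne_vec, amp_rankOne_vec]
    set v₁ := vec (V₁ * (Matrix.fromRows (1 : Matrix n n ℂ) (0 : Matrix n n ℂ))ᵀ)
    set v₂ := vec (V₂ * (Matrix.fromRows (0 : Matrix n n ℂ) (1 : Matrix n n ℂ))ᵀ)
    have hv : vec V = (Real.sqrt a : ℂ) • v₁ + (Real.sqrt b : ℂ) • v₂ := by
      ext ⟨i, j⟩
      rcases j with j | j <;>
      simp [vec, V, v₁, v₂, Matrix.transpose_fromRows, Matrix.mul_fromCols]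
    have hid : rankOne v₁ + rankOne v₂ - rankOne (vec V)
        = rankOne ((Real.sqrt b : ℂ) • v₁ - (Real.sqrt a : ℂ) • v₂) := by
      rw [hv]
      ext p q
      have e1 := hsq ha
      have e2 := hsq hb
      have e3 : (a : ℂ) + b = 1 := by exact_mod_cast hab
      simp only [rankOne, Matrix.sub_apply, Matrix.add_apply, Matrix.vecMulVec_apply,
        Pi.add_apply, Pi.sub_apply, Pi.smul_apply, Pi.star_apply, star_add, star_sub, star_mul',
        smul_eq_mul, RCLike.star_def, Complex.conj_ofReal]
      linear_combination (-(v₁ p * (starRingEnd ℂ) (v₁ q)) - v₂ p * (starRingEnd ℂ) (v₂ q)) *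
        (e1 + e2 + e3)
    rw [← sub_nonneg, hid]
    exact rankOne_nonneg _

theorem antiblocker_antiblocker_level (S : Submodule ℂ (Matrix n n ℂ)) :
    antiblocker (antiblocker (level S)) = level S := by
  ext W
  constructor
  · rintro ⟨hW, h⟩
    obtain ⟨X, hX, hWX⟩ := exists_le_of_forall_antiblocker (isCompact_level S) (convex_level S)
      ⟨0, zero_mem_level S⟩ (fun X hX => hX.1) hW fun Z hZ => by
        rw [Matrix.trace_mul_comm]; exact h Z hZ
    exact level_of_le hX hW hWX
  · intro hW
    refine ⟨hW.1, fun Z hZ => ?_⟩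
    rw [Matrix.trace_mul_comm]
    exact hZ.2 W hW

theorem antiblocker_thetaBody [Nonempty n] (h1 : (1 : Matrix n n ℂ) ∈ S) :
    antiblocker (thetaBody S) = level S := by
  rw [thetaBody_eq h1, antiblocker_antiblocker_level]

end Convexity

section Duality

open scoped ComplexOrder

variable {n m m' m'' ι : Type*} [Fintype n] [Fintype m] [Fintype m'] [Fintype m''] [Fintype ι]
  [DecidableEq n] [DecidableEq m] [DecidableEq m'] [DecidableEq m''] [DecidableEq ι]

theorem exists_trace_mul_eq (φ : Matrix n n ℂ →ₗ[ℂ] ℂ) :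
    ∃ F : Matrix n n ℂ, ∀ X, φ X = (F * X).trace := by
  refine ⟨Matrix.of fun j i => φ (Matrix.single i j 1), fun X => ?_⟩
  conv_lhs => rw [Matrix.matrix_eq_sum_single X]
  have h : ∀ i j, φ (Matrix.single i j (X i j)) = φ (Matrix.single i j 1) * X i j := by
    intro i j
    have : Matrix.single i j (X i j) = X i j • Matrix.single i j (1 : ℂ) := by
      rw [Matrix.smul_single]; simp
    rw [this, map_smul, smul_eq_mul, mul_comm]
  simp only [map_sum, h, Matrix.trace, Matrix.diag_apply, Matrix.mul_apply, Matrix.of_apply]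
  rw [Finset.sum_comm]

theorem IsNCGraph.trace_mul_eq_zero {S : Submodule ℂ (Matrix n n ℂ)} (hS : IsNCGraph S)
    {X Y : Matrix n n ℂ} (hX : X ∈ perp S) (hY : Y ∈ S) : (Y * X).trace = 0 := by
  have := hX Yᴴ (hS.conjTranspose_mem Y hY)
  rwa [Matrix.conjTranspose_conjTranspose] at this

theorem IsNCGraph.conjTranspose_mem_perp {S : Submodule ℂ (Matrix n n ℂ)} (hS : IsNCGraph S)
    {X : Matrix n n ℂ} (hX : X ∈ perp S) : Xᴴ ∈ perp S := by
  intro Y hY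
  rw [← Matrix.conjTranspose_mul, Matrix.trace_conjTranspose, Matrix.trace_mul_comm,
    hS.trace_mul_eq_zero hX hY, star_zero]

theorem IsNCGraph.mem_of_forall_perp {S : Submodule ℂ (Matrix n n ℂ)} (hS : IsNCGraph S)
    {M : Matrix n n ℂ} (hM : ∀ X ∈ perp S, (M * X).trace = 0) : M ∈ S := by
  have : Mᴴ ∈ S := by
    by_contra hn
    obtain ⟨φ, hφ, hφS⟩ := Submodule.exists_le_ker_of_notMem hn
    obtain ⟨F, hF⟩ := exists_trace_mul_eq φ
    have h1 : Fᴴ ∈ perp S := by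
      intro Y hY
      rw [← Matrix.conjTranspose_mul, Matrix.trace_conjTranspose, ← hF,
        LinearMap.mem_ker.1 (hφS hY), star_zero]
    have h2 := hM _ h1
    rw [← Matrix.conjTranspose_conjTranspose M, ← Matrix.conjTranspose_mul,
      Matrix.trace_conjTranspose, ← hF, star_eq_zero] at h2
    exact hφ h2
  simpa using hS.conjTranspose_mem _ this

theorem amp_amp (C : Matrix m'' m' ℂ) (D : Matrix m' m ℂ) (Y : Matrix (n × m) (n × m) ℂ) :
    amp C (amp D Y) = amp (C * D) Y := by
  have h : (1 : Matrix n n ℂ) ⊗ₖ (C * D) = ((1 : Matrix n n ℂ) ⊗ₖ C) * ((1 : Matrix n n ℂ) ⊗ₖ D) := by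
    rw [← Matrix.mul_kronecker_mul, Matrix.mul_one]
  simp only [amp]
  rw [h, Matrix.conjTranspose_mul]
  simp only [Matrix.mul_assoc]

theorem amp_one (Y : Matrix (n × m) (n × m) ℂ) : amp (1 : Matrix m m ℂ) Y = Y := by
  simp [amp]

theorem slice_conjTranspose (Y : Matrix (n × m) (n × m) ℂ) (j k : m) :
    slice Yᴴ j k = (slice Y k j)ᴴ := rfl

theorem star_vec_dotProduct_vec (A B : Matrix n m ℂ) :
    star (vec A) ⬝ᵥ vec B = (Aᴴ * B).trace := by
  simp only [dotProduct, vec, Matrix.trace, Matrix.diag_apply, Matrix.mul_apply,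
    Matrix.conjTranspose_apply, Fintype.sum_prod_type, Pi.star_apply]
  rw [Finset.sum_comm]

theorem norm_trace_sq_le (A B : Matrix n m ℂ) :
    ‖(Aᴴ * B).trace‖ ^ 2 ≤ (Aᴴ * A).trace.re * (Bᴴ * B).trace.re := by
  rw [← star_vec_dotProduct_vec, ← star_vec_dotProduct_vec, ← star_vec_dotProduct_vec,
    star_dotProduct_self, star_dotProduct_self, Complex.ofReal_re, Complex.ofReal_re, ← mul_pow]
  refine pow_le_pow_left₀ (norm_nonneg _) ?_ 2
  have := norm_inner_le_norm (𝕜 := ℂ) (WithLp.toLp 2 (vec A)) (WithLp.toLp 2 (vec B))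
  rwa [EuclideanSpace.inner_eq_star_dotProduct, dotProduct_comm] at this

/-- The space of operators on `A ⊗ B` all of whose slices lie in `S`. -/
def sliceSubmodule (m : Type*) (S : Submodule ℂ (Matrix n n ℂ)) :
    Submodule ℂ (Matrix (n × m) (n × m) ℂ) where
  carrier := {Y | ∀ j k, slice Y j k ∈ S}
  zero_mem' := fun _ _ => S.zero_mem
  add_mem' := fun hX hY j k => S.add_mem (hX j k) (hY j k)
  smul_mem' := fun c _ hX j k => S.smul_mem c (hX j k)

theorem slice_one (j k : m) :
    slice (1 : Matrix (n × m) (n × m) ℂ) j k = ((1 : Matrix m m ℂ) j k) • 1 := by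
  rw [← Matrix.one_kronecker_one, slice_kronecker]

theorem exists_sqrt_inverse {ρ : Matrix m m ℂ} (hρ : ρ.PosDef) :
    ∃ R Ri : Matrix m m ℂ, Rᴴ = R ∧ R * R = ρ ∧ R * Ri = 1 ∧ Ri * R = 1 := by
  have h0 : 0 ≤ ρ := Matrix.nonneg_iff_posSemidef.2 hρ.posSemidef
  have hu : IsUnit (CFC.sqrt ρ) := (CFC.isUnit_sqrt_iff ρ).2 hρ.isUnit
  obtain ⟨u, hu⟩ := hu
  exact ⟨CFC.sqrt ρ, ↑u⁻¹, isHermitian_sqrt ρ, CFC.sqrt_mul_sqrt_self ρ h0,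
    by rw [← hu]; exact u.mul_inv, by rw [← hu]; exact u.inv_mul⟩

variable {S : Submodule ℂ (Matrix n n ℂ)}

/-- Weak duality for a `Y` with non-singular partial trace, in terms of the anti-blocker of
`{W ≥ 0 : θ(S, W) ≤ 1}`. -/
theorem trace_mul_rankOne_le_of_posDef {Z : Matrix n n ℂ} (hZ : Z ∈ antiblocker (level S))
    {Y : Matrix (n × n) (n × n) ℂ} (hY : 0 ≤ Y) (hYS : ∀ j k, slice Y j k ∈ S)
    (hρ : (partialTrace Y).PosDef) :
    (Y * rankOne (vec (CFC.sqrt Z))).trace.re ≤ Y.trace.re := by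
  obtain ⟨R, Ri, hRh, hRR, hRi, hiR⟩ := exists_sqrt_inverse hρ
  have hRi' : R * Riᴴ = 1 := by
    have := congrArg Matrix.conjTranspose hiR
    rwa [Matrix.conjTranspose_mul, hRh, Matrix.conjTranspose_one] at this
  set Y' := amp Ri Y with hY'
  have hY'0 : 0 ≤ Y' := by
    have := amp_mono Ri hY
    simpa [amp, hY'] using this
  have hYY' : Y = amp R Y' := by rw [hY', amp_amp, hRi, amp_one]
  set x := vec (CFC.sqrt Z)
  set z := vec (CFC.sqrt Z * Rᵀ) with hz
  have hzx : ((1 : Matrix n n ℂ) ⊗ₖ R) *ᵥ x = z := kronecker_mulVec_vec R _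
  have hq : star x ⬝ᵥ (Y *ᵥ x) = star z ⬝ᵥ (Y' *ᵥ z) := by
    have hRk : ((1 : Matrix n n ℂ) ⊗ₖ R)ᴴ = (1 : Matrix n n ℂ) ⊗ₖ R := by
      rw [Matrix.conjTranspose_kronecker, hRh, Matrix.conjTranspose_one]
    rw [hYY', amp, hRk, ← Matrix.mulVec_mulVec, ← Matrix.mulVec_mulVec, hzx,
      Matrix.dotProduct_mulVec]
    have : star x ᵥ* ((1 : Matrix n n ℂ) ⊗ₖ R) = star z := by
      rw [← hzx, Matrix.star_mulVec, hRk]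
    rw [this]
  rw [trace_mul_rankOne, hq]
  by_contra! hlt
  set q := (star z ⬝ᵥ (Y' *ᵥ z)).re with hq_def
  have hr0 : 0 ≤ Y.trace.re :=
    (Complex.le_def.1 (Matrix.nonneg_iff_posSemidef.1 hY).trace_nonneg).1
  have hq0 : 0 < q := hr0.trans_lt hlt
  have him : (star z ⬝ᵥ (Y' *ᵥ z)) = (q : ℂ) := by
    refine Complex.ext rfl ?_
    exact Matrix.IsHermitian.im_star_dotProduct_mulVec_self (isHermitian_of_nonneg hY'0) z
  let V : Matrix n n ℂ := Matrix.of fun i j => (((Real.sqrt q : ℂ)⁻¹) • (Y' *ᵥ z)) (i, j)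
  have hV : vec V = ((Real.sqrt q : ℂ)⁻¹) • (Y' *ᵥ z) := rfl
  have hfeas : Feasible S 1 V := by
    refine ⟨Y', slice_amp_mem _ hYS, ?_, ?_⟩
    · rw [hY', partialTrace_amp, ← hRR, ← Matrix.mul_assoc, hiR, Matrix.one_mul, hRi']
      simp
    · rw [hV]
      exact rankOne_mulVec_le hY'0 hq0 le_rfl
  have h1 := hZ.2 _ hfeas.mem_level
  have h2 : (CFC.sqrt Z * Rᵀ)ᴴ * V = (Rᵀ)ᴴ * (CFC.sqrt Z * V) := by
    rw [Matrix.conjTranspose_mul, isHermitian_sqrt, Matrix.mul_assoc]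
  have h3 : star z ⬝ᵥ vec V = ((Real.sqrt q : ℝ) : ℂ) := by
    rw [hV, dotProduct_smul, him, smul_eq_mul]
    have hs : (Real.sqrt q : ℂ) ≠ 0 := by exact_mod_cast (Real.sqrt_pos.2 hq0).ne'
    rw [inv_mul_eq_iff_eq_mul₀ hs, ← Complex.ofReal_mul, Real.mul_self_sqrt hq0.le]
  rw [hz, star_vec_dotProduct_vec, h2] at h3
  have h4 := norm_trace_sq_le (Rᵀ) (CFC.sqrt Z * V)
  rw [h3, Complex.norm_real, Real.norm_eq_abs, sq_abs, Real.sq_sqrt hq0.le] at h4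
  have h5 : ((Rᵀ)ᴴ * Rᵀ).trace = Y.trace := by
    have : (Rᵀ)ᴴ * Rᵀ = (R * R)ᵀ := by
      rw [Matrix.transpose_mul]
      congr 1
      conv_rhs => rw [← hRh]
      rfl
    rw [this, Matrix.trace_transpose, hRR, trace_partialTrace]
  have h6 : ((CFC.sqrt Z * V)ᴴ * (CFC.sqrt Z * V)).trace = (V * Vᴴ * Z).trace := by
    rw [Matrix.conjTranspose_mul, isHermitian_sqrt, Matrix.mul_assoc, ← Matrix.mul_assoc _ _ V,
      CFC.sqrt_mul_sqrt_self Z hZ.1, Matrix.trace_mul_comm, Matrix.mul_assoc,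
      Matrix.trace_mul_comm]
  rw [h5, h6] at h4
  nlinarith

/-- Strong duality for the semidefinite program that defines `θ(S, ·)`. -/
theorem exists_dual_of_mem_antiblocker [Nonempty n] (hS : IsNCGraph S) {Z : Matrix n n ℂ}
    (hZ : Z ∈ antiblocker (level S)) :
    ∃ T : Matrix (n × n) (n × n) ℂ,
      (∀ j k, slice T j k - ((1 : Matrix n n ℂ) j k) • (1 : Matrix n n ℂ) ∈ perp S) ∧
      rankOne (vec (CFC.sqrt Z)) ≤ T := by
  set P := rankOne (vec (CFC.sqrt Z))
  have hP : 0 ≤ P := rankOne_nonneg _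
  have hfark := exists_mem_submodule_ge (sliceSubmodule n (perp S)) (A := P - 1) ?_ ?_ ?_ ?_
  · obtain ⟨X, hX, hXP⟩ := hfark
    refine ⟨X + 1, fun j k => ?_, by rwa [sub_le_iff_le_add] at hXP⟩
    rw [slice_add, slice_one, add_sub_cancel_right]
    exact hX j k
  · intro X hX
    rw [← trace_partialTrace]
    refine Finset.sum_eq_zero fun j _ => ?_
    have := hX j j 1 hS.one_mem
    rwa [Matrix.conjTranspose_one, Matrix.one_mul] at this
  · intro X hX j k
    rw [slice_conjTranspose]
    exact hS.conjTranspose_mem_perp (hX k j)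
  · rw [Matrix.conjTranspose_sub, isHermitian_of_nonneg hP, Matrix.conjTranspose_one]
  · intro Y hY hYX
    have hYS : ∀ j k, slice Y j k ∈ S := by
      intro j k
      refine hS.mem_of_forall_perp fun X hX => ?_
      have h1 := hYX (X ⊗ₖ Matrix.single k j (1 : ℂ)) fun j' k' => by
        rw [slice_kronecker]; exact (perp S).smul_mem _ hX
      rw [trace_mul_eq_sum_slice] at h1
      simpa [slice_kronecker, Matrix.single_apply, ite_and, apply_ite Matrix.trace] using h1
    have key : ∀ ε : ℝ, 0 < ε → (Y * P).trace.re + ε * P.trace.re ≤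
        Y.trace.re + ε * Fintype.card (n × n) := by
      intro ε hε
      have hε1 : (0 : Matrix (n × n) (n × n) ℂ) ≤ (ε : ℂ) • 1 :=
        Matrix.nonneg_iff_posSemidef.2 (Matrix.PosSemidef.one.smul (by exact_mod_cast hε.le))
      have hpd : (partialTrace (Y + (ε : ℂ) • 1)).PosDef := by
        rw [partialTrace_add, partialTrace_smul_one]
        refine Matrix.PosDef.posSemidef_add
          (Matrix.nonneg_iff_posSemidef.1 (partialTrace_nonneg hY)) (Matrix.PosDef.one.smul ?_)
        have : 0 < ε * Fintype.card n := by positivity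
        exact_mod_cast this
      have h1 := trace_mul_rankOne_le_of_posDef hZ (add_nonneg hY hε1) (fun j k => by
        rw [slice_add, slice_smul, slice_one]
        exact S.add_mem (hYS j k) (S.smul_mem _ (S.smul_mem _ hS.one_mem))) hpd
      simpa [Matrix.add_mul, Matrix.trace_add] using h1
    rw [Matrix.mul_sub, Matrix.trace_sub, Matrix.mul_one, Complex.sub_re, sub_nonpos]
    refine le_of_forall_pos_le_add fun δ hδ => ?_
    have hc : (0 : ℝ) < Fintype.card (n × n) := by exact_mod_cast Fintype.card_pos
    have h1 := key (δ / Fintype.card (n × n)) (by positivity)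
    rw [div_mul_cancel₀ _ hc.ne'] at h1
    have h2 : 0 ≤ P.trace.re := (Complex.le_def.1 (Matrix.nonneg_iff_posSemidef.1 hP).trace_nonneg).1
    have h3 : 0 ≤ δ / Fintype.card (n × n) * P.trace.re := by positivity
    linarith

end Duality

section BlockColumns

variable {n : Type*} [Fintype n] [DecidableEq n] {r : ℕ} {a y : Fin r → ℕ}

/-- The columns of `U` that belong to `|p⟩ ⊗ Y i ⊆ A i ⊗ Y i`. -/
def blockCol (U : Matrix n (Σ i, Fin (a i) × Fin (y i)) ℂ) (i : Fin r) (p : Fin (a i)) :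
    Matrix n (Fin (y i)) ℂ :=
  U.submatrix id fun t => ⟨i, p, t⟩

variable (U : Matrix n (Σ i, Fin (a i) × Fin (y i)) ℂ)

theorem mul_blockDiagonal'_mul
    (f : ∀ i, Matrix (Fin (a i) × Fin (y i)) (Fin (a i) × Fin (y i)) ℂ) :
    U * Matrix.blockDiagonal' f * Uᴴ =
      ∑ i, ∑ p, ∑ q, blockCol U i p * (Matrix.of fun s t => f i (p, s) (q, t)) *
        (blockCol U i q)ᴴ := by
  ext k l
  simp only [Matrix.mul_apply, Matrix.sum_apply, blockCol, Matrix.submatrix_apply, id,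
    Matrix.conjTranspose_apply, Matrix.of_apply, Fintype.sum_sigma, Fintype.sum_prod_type,
    Matrix.blockDiagonal'_apply]
  refine Finset.sum_congr rfl fun i _ => ?_
  have h : ∀ (q : Fin (a i)) (t : Fin (y i)),
      (∑ j, ∑ p, ∑ s, U k ⟨j, p, s⟩ *
        (if h : j = i then f j (p, s) (cast (by rw [h]) (q, t)) else 0)) =
      ∑ p, ∑ s, U k ⟨i, p, s⟩ * f i (p, s) (q, t) := by
    intro q t
    rw [Finset.sum_eq_single i]
    · simp
    · intro j _ hj
      simp [hj]
    · simp
  simp only [h]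
  conv_rhs => rw [Finset.sum_comm]
  refine Finset.sum_congr rfl fun q _ => ?_
  conv_rhs => rw [Finset.sum_comm]
  refine Finset.sum_congr rfl fun t _ => ?_
  rw [Finset.sum_mul]

theorem blockCol_conjTranspose_mul (hU : Uᴴ * U = 1) (i : Fin r) (p q : Fin (a i)) :
    (blockCol U i p)ᴴ * blockCol U i q = if p = q then 1 else 0 := by
  have : (blockCol U i p)ᴴ * blockCol U i q =
      (Uᴴ * U).submatrix (fun t => ⟨i, p, t⟩) (fun t => ⟨i, q, t⟩) := rfl
  rw [this, hU]
  ext s t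
  by_cases h : p = q
  · subst h; simp [Matrix.one_apply]
  · simp [h]

theorem blockCol_conjTranspose_mul_of_ne (hU : Uᴴ * U = 1) {i j : Fin r} (hij : i ≠ j)
    (p : Fin (a i)) (q : Fin (a j)) : (blockCol U i p)ᴴ * blockCol U j q = 0 := by
  have : (blockCol U i p)ᴴ * blockCol U j q =
      (Uᴴ * U).submatrix (fun t => ⟨i, p, t⟩) (fun t => ⟨j, q, t⟩) := rfl
  rw [this, hU]
  ext s t
  simp [hij]

theorem sum_blockCol_mul_conjTranspose (hU : U * Uᴴ = 1) :
    ∑ i, ∑ p, blockCol U i p * (blockCol U i p)ᴴ = 1 := by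
  rw [← hU]
  ext k l
  simp [Matrix.mul_apply, Matrix.sum_apply, blockCol, Fintype.sum_sigma, Fintype.sum_prod_type]

theorem mul_blockDiagonal'_kronecker_one_mul (M : ∀ i, Matrix (Fin (a i)) (Fin (a i)) ℂ) :
    U * Matrix.blockDiagonal' (fun i => M i ⊗ₖ (1 : Matrix (Fin (y i)) (Fin (y i)) ℂ)) * Uᴴ =
      ∑ i, ∑ p, ∑ q, M i p q • (blockCol U i p * (blockCol U i q)ᴴ) := by
  rw [mul_blockDiagonal'_mul]
  refine Finset.sum_congr rfl fun i _ => Finset.sum_congr rfl fun p _ =>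
    Finset.sum_congr rfl fun q _ => ?_
  have : (Matrix.of fun s t => (M i ⊗ₖ (1 : Matrix (Fin (y i)) (Fin (y i)) ℂ)) (p, s) (q, t)) =
      M i p q • (1 : Matrix (Fin (y i)) (Fin (y i)) ℂ) := by
    ext s t; simp
  rw [this, Matrix.mul_smul, Matrix.smul_mul, Matrix.mul_one]

end BlockColumns

namespace BlockDecomposition

variable {n : Type*} [Fintype n] [DecidableEq n] {S₀ : StarSubalgebra ℂ (Matrix n n ℂ)}
  (D : BlockDecomposition S₀)

/-- The matrix units of a block decomposition. -/
def unit (i : Fin D.r) (p q : Fin (D.a i)) : Matrix n n ℂ :=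
  blockCol D.U i p * (blockCol D.U i q)ᴴ

theorem unit_mul_unit (i : Fin D.r) (p q p' q' : Fin (D.a i)) :
    D.unit i p q * D.unit i p' q' = if q = p' then D.unit i p q' else 0 := by
  rw [unit, unit, Matrix.mul_assoc, ← Matrix.mul_assoc _ (blockCol D.U i p'),
    blockCol_conjTranspose_mul _ D.conjTranspose_mul_self]
  split_ifs <;> simp [unit]

theorem unit_mul_unit_of_ne {i j : Fin D.r} (hij : i ≠ j) (p q : Fin (D.a i))
    (p' q' : Fin (D.a j)) : D.unit i p q * D.unit j p' q' = 0 := by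
  rw [unit, unit, Matrix.mul_assoc, ← Matrix.mul_assoc _ (blockCol D.U j p'),
    blockCol_conjTranspose_mul_of_ne _ D.conjTranspose_mul_self hij]
  simp

theorem conjTranspose_unit (i : Fin D.r) (p q : Fin (D.a i)) :
    (D.unit i p q)ᴴ = D.unit i q p := by
  simp [unit]

theorem sum_unit : ∑ i, ∑ p, D.unit i p p = 1 :=
  sum_blockCol_mul_conjTranspose _ D.mul_conjTranspose_self

theorem trace_unit (i : Fin D.r) (p q : Fin (D.a i)) :
    (D.unit i p q).trace = if p = q then (D.y i : ℂ) else 0 := by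
  rw [unit, Matrix.trace_mul_comm, blockCol_conjTranspose_mul _ D.conjTranspose_mul_self]
  by_cases h : p = q
  · simp [h]
  · simp [h, Ne.symm h]

theorem mem_iff_unit {X : Matrix n n ℂ} :
    X ∈ S₀ ↔ ∃ M : ∀ i, Matrix (Fin (D.a i)) (Fin (D.a i)) ℂ,
      X = ∑ i, ∑ p, ∑ q, M i p q • D.unit i p q := by
  rw [D.mem_iff]
  simp only [mul_blockDiagonal'_kronecker_one_mul, unit]

theorem unit_mem (i : Fin D.r) (p q : Fin (D.a i)) : D.unit i p q ∈ S₀ := by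
  rw [D.mem_iff_unit]
  refine ⟨Function.update 0 i (Matrix.single p q 1), ?_⟩
  rw [Finset.sum_eq_single i]
  · rw [Function.update_self, Finset.sum_eq_single p, Finset.sum_eq_single q]
    · simp
    · intro q' _ hq; simp [hq.symm]
    · simp
    · intro p' _ hp; simp [hp.symm]
    · simp
  · intro j _ hj
    simp [Function.update_of_ne hj]
  · simp

theorem psi_eq (W : Matrix n n ℂ) :
    D.psi W = ∑ i, ((D.y i : ℂ)⁻¹) • ∑ p, ∑ q, D.unit i p q * W * D.unit i q p := by
  rw [psi, mul_blockDiagonal'_mul]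
  refine Finset.sum_congr rfl fun i _ => ?_
  rw [Finset.smul_sum]
  refine Finset.sum_congr rfl fun p _ => ?_
  have hN : partialTrace (Matrix.blockDiag' (D.Uᴴ * W * D.U) i) =
      ∑ q, (blockCol D.U i q)ᴴ * W * blockCol D.U i q := by
    ext s t
    rw [Matrix.sum_apply]
    rfl
  rw [Finset.sum_eq_single p]
  · have h : (Matrix.of fun s t => (((D.y i : ℂ)⁻¹) • ((1 : Matrix (Fin (D.a i)) (Fin (D.a i)) ℂ) ⊗ₖ
        partialTrace (Matrix.blockDiag' (D.Uᴴ * W * D.U) i))) (p, s) (p, t)) =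
        ((D.y i : ℂ)⁻¹) • partialTrace (Matrix.blockDiag' (D.Uᴴ * W * D.U) i) := by
      ext s t; simp
    rw [h, hN, Matrix.mul_smul, Matrix.smul_mul, Matrix.mul_sum, Matrix.sum_mul]
    simp only [unit, Matrix.mul_assoc]
  · intro q _ hq
    have h : (Matrix.of fun s t => (((D.y i : ℂ)⁻¹) • ((1 : Matrix (Fin (D.a i)) (Fin (D.a i)) ℂ) ⊗ₖ
        partialTrace (Matrix.blockDiag' (D.Uᴴ * W * D.U) i))) (p, s) (q, t)) = 0 := by
      ext s t; simp [hq.symm]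
    rw [h]
    simp
  · simp

theorem trace_psi_mul (Z X : Matrix n n ℂ) :
    (D.psi Z * X).trace = (Z * D.psi X).trace := by
  simp only [psi_eq, Matrix.sum_mul, Matrix.mul_sum, Matrix.smul_mul, Matrix.mul_smul,
    Matrix.trace_sum, Matrix.trace_smul]
  refine Finset.sum_congr rfl fun i _ => ?_
  congr 1
  rw [Finset.sum_comm]
  refine Finset.sum_congr rfl fun p _ => Finset.sum_congr rfl fun q _ => ?_
  rw [Matrix.mul_assoc, Matrix.mul_assoc, Matrix.trace_mul_comm]
  simp only [Matrix.mul_assoc]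

theorem psi_mem_commutant (W : Matrix n n ℂ) : D.psi W ∈ commutant S₀ := by
  rw [commutant, Set.mem_centralizer_iff]
  intro X hX
  obtain ⟨M, rfl⟩ := D.mem_iff_unit.1 hX
  simp only [Matrix.sum_mul, Matrix.mul_sum, Matrix.smul_mul, Matrix.mul_smul]
  refine Finset.sum_congr rfl fun j _ => Finset.sum_congr rfl fun b _ =>
    Finset.sum_congr rfl fun c _ => ?_
  congr 1
  rw [psi_eq, Matrix.mul_sum, Matrix.sum_mul]
  refine Finset.sum_congr rfl fun i _ => ?_
  rw [Matrix.mul_smul, Matrix.smul_mul]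
  congr 1
  simp only [Matrix.mul_sum, Matrix.sum_mul]
  by_cases hij : i = j
  · subst hij
    rw [Finset.sum_comm]
    conv_rhs => rw [Finset.sum_comm]
    refine Finset.sum_congr rfl fun q _ => ?_
    have h1 : ∀ p, D.unit i b c * (D.unit i p q * W * D.unit i q p) =
        if c = p then D.unit i b q * W * D.unit i q c else 0 := by
      intro p
      rw [← Matrix.mul_assoc, ← Matrix.mul_assoc, unit_mul_unit]
      split_ifs with h
      · rw [h]
      · simp
    have h2 : ∀ p, D.unit i p q * W * D.unit i q p * D.unit i b c =
        if p = b then D.unit i b q * W * D.unit i q c else 0 := by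
      intro p
      rw [Matrix.mul_assoc, unit_mul_unit]
      split_ifs with h
      · rw [h]
      · simp
    simp only [h1, h2, Finset.sum_ite_eq, Finset.sum_ite_eq', Finset.mem_univ, if_true]
  · refine Finset.sum_congr rfl fun p _ => Finset.sum_congr rfl fun q _ => ?_
    rw [Matrix.mul_assoc _ _ (D.unit j b c), unit_mul_unit_of_ne D hij, Matrix.mul_assoc,
      ← Matrix.mul_assoc, unit_mul_unit_of_ne D (Ne.symm hij)]
    simp

open scoped ComplexOrder in
theorem psi_nonneg {W : Matrix n n ℂ} (hW : 0 ≤ W) : 0 ≤ D.psi W := by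
  rw [psi_eq]
  refine Finset.sum_nonneg fun i _ => ?_
  have h : 0 ≤ ∑ p, ∑ q, D.unit i p q * W * D.unit i q p := by
    refine Finset.sum_nonneg fun p _ => Finset.sum_nonneg fun q _ => ?_
    rw [← conjTranspose_unit D i p q]
    have := conj_mono hW (D.unit i p q)
    simpa using this
  have := smul_le_smul_nonneg h (c := (D.y i : ℂ)⁻¹) (by
    rw [inv_nonneg]; exact Nat.cast_nonneg _)
  simpa using this

/-- `Ψ` as a linear map. -/
noncomputable def psiLinear : Matrix n n ℂ →ₗ[ℂ] Matrix n n ℂ where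
  toFun := D.psi
  map_add' X Y := by
    simp only [psi_eq, Matrix.mul_add, Matrix.add_mul, Finset.sum_add_distrib, smul_add]
  map_smul' c X := by
    simp only [psi_eq, Matrix.mul_smul, Matrix.smul_mul, ← Finset.smul_sum, RingHom.id_apply]
    simp only [Finset.smul_sum, smul_comm c]

theorem continuous_psi : Continuous D.psi := D.psiLinear.continuous_of_finiteDimensional

end BlockDecomposition

section Stack

open scoped ComplexOrder

variable {n m κ : Type*} [Fintype n] [Fintype m] [Fintype κ]
  [DecidableEq n] [DecidableEq m] [DecidableEq κ]

/-- The operator `∑ k, E k ⊗ I ⊗ |k⟩` from `A ⊗ B` to `A ⊗ B ⊗ ℂ^κ`. -/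
def stack (m : Type*) [DecidableEq m] (E : κ → Matrix n n ℂ) :
    Matrix (n × (m × κ)) (n × m) ℂ :=
  Matrix.of fun p q => if p.2.1 = q.2 then E p.2.2 p.1 q.1 else 0

/-- The matrix `V`, followed by the family `E`, as one matrix with more columns. -/
def stackCols (E : κ → Matrix n n ℂ) (V : Matrix n m ℂ) : Matrix n (m × κ) ℂ :=
  Matrix.of fun i p => (E p.2 * V) i p.1

theorem stack_mulVec_vec (E : κ → Matrix n n ℂ) (V : Matrix n m ℂ) :
    stack m E *ᵥ vec V = vec (stackCols E V) := by
  ext ⟨i, j, k⟩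
  simp [stack, stackCols, vec, Matrix.mulVec, dotProduct, Fintype.sum_prod_type, Matrix.mul_apply]

theorem stackCols_mul_conjTranspose (E : κ → Matrix n n ℂ) (V : Matrix n m ℂ) :
    stackCols E V * (stackCols E V)ᴴ = ∑ k, E k * (V * Vᴴ) * (E k)ᴴ := by
  have h : ∀ k, E k * (V * Vᴴ) * (E k)ᴴ = (E k * V) * (E k * V)ᴴ := by
    intro k
    rw [Matrix.conjTranspose_mul]
    simp only [Matrix.mul_assoc]
  simp only [h]
  ext i i'
  rw [Matrix.sum_apply, Matrix.mul_apply, Fintype.sum_prod_type, Finset.sum_comm]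
  rfl

theorem slice_stack_mul (E : κ → Matrix n n ℂ) (T : Matrix (n × m) (n × m) ℂ) (j j' : m) (k l : κ) :
    slice (stack m E * T * (stack m E)ᴴ) (j, k) (j', l) = E k * slice T j j' * (E l)ᴴ := by
  ext i i'
  simp [slice, stack, Matrix.mul_apply, Fintype.sum_prod_type, apply_ite]

theorem slice_kronecker_one_mul (A B : Matrix n n ℂ) (T : Matrix (n × m) (n × m) ℂ) (j k : m) :
    slice ((A ⊗ₖ (1 : Matrix m m ℂ)) * T * (B ⊗ₖ (1 : Matrix m m ℂ))) j k =
      A * slice T j k * B := by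
  ext i i'
  simp [slice, Matrix.mul_apply, Fintype.sum_prod_type, Matrix.one_apply]

theorem kronecker_one_mul_stack (A : Matrix n n ℂ) (E : κ → Matrix n n ℂ) :
    (A ⊗ₖ (1 : Matrix (m × κ) (m × κ) ℂ)) * stack m E = stack m fun k => A * E k := by
  ext ⟨i, j, k⟩ ⟨i', j'⟩
  simp [stack, Matrix.mul_apply, Fintype.sum_prod_type, Matrix.one_apply, ite_and]

theorem conjTranspose_stack_mul_stack (E F : κ → Matrix n n ℂ) :
    (stack m F)ᴴ * stack m E = (∑ k, (F k)ᴴ * E k) ⊗ₖ (1 : Matrix m m ℂ) := by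
  ext ⟨i, j⟩ ⟨i', j'⟩
  simp only [stack, Matrix.mul_apply, Fintype.sum_prod_type, Matrix.conjTranspose_apply,
    Matrix.of_apply, apply_ite star, star_zero, ite_mul, zero_mul, mul_ite, mul_zero,
    Matrix.kroneckerMap_apply, Matrix.sum_apply]
  by_cases h : j = j'
  · subst h
    simp only [Matrix.one_apply_eq, mul_one]
    conv_rhs => rw [Finset.sum_comm]
    refine Finset.sum_congr rfl fun s _ => ?_
    rw [Finset.sum_comm]
    refine Finset.sum_congr rfl fun k _ => ?_
    simp
  · rw [Matrix.one_apply_ne h, mul_zero]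
    refine Finset.sum_eq_zero fun s _ => Finset.sum_eq_zero fun b _ =>
      Finset.sum_eq_zero fun k _ => ?_
    split_ifs with h1 h2
    · exact absurd (h2.symm.trans h1) h
    · rfl
    · rfl

theorem sum_conj_le {ι α : Type*} [Fintype ι] [DecidableEq ι] [Fintype α] (B : α → Matrix ι ι ℂ)
    {X : Matrix ι ι ℂ} (hX : 0 ≤ X) :
    (∑ q, B q) * X * (∑ q, B q)ᴴ ≤ (Fintype.card α : ℂ) • ∑ q, B q * X * (B q)ᴴ := by
  have h : 0 ≤ (2⁻¹ : ℂ) • ∑ q, ∑ p, (B q - B p) * X * (B q - B p)ᴴ := by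
    have h0 : 0 ≤ ∑ q, ∑ p, (B q - B p) * X * (B q - B p)ᴴ :=
      Finset.sum_nonneg fun q _ => Finset.sum_nonneg fun p _ => by
        have := conj_mono hX (B q - B p)
        simpa using this
    have := smul_le_smul_nonneg h0 (c := (2⁻¹ : ℂ)) (by
      rw [inv_nonneg]
      exact zero_le_two)
    simpa using this
  have e : (2⁻¹ : ℂ) • ∑ q, ∑ p, (B q - B p) * X * (B q - B p)ᴴ =
      (Fintype.card α : ℂ) • ∑ q, B q * X * (B q)ᴴ - (∑ q, B q) * X * (∑ q, B q)ᴴ := by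
    have e1 : (∑ q, B q) * X * (∑ q, B q)ᴴ = ∑ q, ∑ p, B q * X * (B p)ᴴ := by
      rw [Matrix.conjTranspose_sum, Matrix.sum_mul, Matrix.sum_mul]
      simp only [Matrix.mul_sum]
    have e2 : ∑ q, ∑ p, B p * X * (B q)ᴴ = ∑ q, ∑ p, B q * X * (B p)ᴴ := Finset.sum_comm
    simp only [Matrix.conjTranspose_sub, Matrix.mul_sub, Matrix.sub_mul, Finset.sum_sub_distrib]
    rw [e1, e2]
    simp only [Finset.sum_const, Finset.card_univ, ← Finset.smul_sum, ← Nat.cast_smul_eq_nsmul ℂ]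
    rw [show ∀ a b : Matrix ι ι ℂ, a - b - (b - a) = (2 : ℂ) • (a - b) from fun a b => by
      rw [two_smul]; abel]
    rw [smul_smul]
    norm_num
  rw [e, sub_nonneg] at h
  exact h

theorem sum_sum_comm {α β γ δ M : Type*} [Fintype α] [Fintype β] [Fintype γ] [Fintype δ]
    [AddCommMonoid M] (f : α → β → γ → δ → M) :
    ∑ a, ∑ b, ∑ c, ∑ d, f a b c d = ∑ c, ∑ d, ∑ a, ∑ b, f a b c d := by
  have := Finset.sum_comm (s := (Finset.univ : Finset (α × β)))
    (t := (Finset.univ : Finset (γ × δ))) (f := fun x z => f x.1 x.2 z.1 z.2)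
  simpa only [Fintype.sum_prod_type] using this

end Stack

namespace BlockDecomposition

open scoped ComplexOrder

variable {n m : Type*} [Fintype n] [DecidableEq n] [Fintype m] [DecidableEq m]
  {S₀ : StarSubalgebra ℂ (Matrix n n ℂ)} (D : BlockDecomposition S₀)

/-- The index set of the matrix units. -/
abbrev Index : Type := Σ i, Fin (D.a i) × Fin (D.a i)

/-- The matrix units, normalized to an orthonormal basis of `S₀`. -/
noncomputable def onb (k : D.Index) : Matrix n n ℂ :=
  ((Real.sqrt (D.y k.1))⁻¹ : ℂ) • D.unit k.1 k.2.1 k.2.2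

/-- A rescaling of the orthonormal basis that is a left inverse of it. -/
noncomputable def coOnb (k : D.Index) : Matrix n n ℂ :=
  ((Real.sqrt (D.y k.1)) / (D.a k.1) : ℂ) • D.unit k.1 k.2.1 k.2.2

/-- The central element `∑ i, (dim (A i) / dim (Y i)) P i`. -/
noncomputable def weight : Matrix n n ℂ :=
  ∑ i, ((D.a i : ℂ) / D.y i) • ∑ q, D.unit i q q

/-- The orthogonal projection onto `S₀`. -/
noncomputable def condExp (X : Matrix n n ℂ) : Matrix n n ℂ :=
  ∑ i, ((D.y i : ℂ)⁻¹) • ∑ p, ∑ q, (D.unit i q p * X).trace • D.unit i p q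

theorem y_ne_zero (i : Fin D.r) : (D.y i : ℂ) ≠ 0 := by
  exact_mod_cast (D.y_pos i).ne'

theorem a_ne_zero (i : Fin D.r) : (D.a i : ℂ) ≠ 0 := by
  exact_mod_cast (D.a_pos i).ne'

theorem sqrt_mul_sqrt (i : Fin D.r) :
    (Real.sqrt (D.y i) : ℂ) * Real.sqrt (D.y i) = D.y i := by
  rw [← Complex.ofReal_mul, Real.mul_self_sqrt (Nat.cast_nonneg _), Complex.ofReal_natCast]

theorem sqrt_ne_zero (i : Fin D.r) : (Real.sqrt (D.y i) : ℂ) ≠ 0 := by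
  intro h
  have := D.sqrt_mul_sqrt i
  rw [h, zero_mul] at this
  exact D.y_ne_zero i this.symm

theorem onb_mem (k : D.Index) : D.onb k ∈ S₀ := S₀.smul_mem (D.unit_mem _ _ _) _

theorem coOnb_mem (k : D.Index) : D.coOnb k ∈ S₀ := S₀.smul_mem (D.unit_mem _ _ _) _

theorem conjTranspose_onb (k : D.Index) :
    (D.onb k)ᴴ = ((Real.sqrt (D.y k.1))⁻¹ : ℂ) • D.unit k.1 k.2.2 k.2.1 := by
  rw [onb, Matrix.conjTranspose_smul, conjTranspose_unit]
  congr 1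
  simp

theorem conjTranspose_coOnb (k : D.Index) :
    (D.coOnb k)ᴴ = ((Real.sqrt (D.y k.1)) / (D.a k.1) : ℂ) • D.unit k.1 k.2.2 k.2.1 := by
  rw [coOnb, Matrix.conjTranspose_smul, conjTranspose_unit]
  congr 1
  simp

theorem sum_onb_conj (Z : Matrix n n ℂ) : ∑ k, D.onb k * Z * (D.onb k)ᴴ = D.psi Z := by
  rw [psi_eq, Fintype.sum_sigma]
  refine Finset.sum_congr rfl fun i _ => ?_
  rw [Fintype.sum_prod_type, Finset.smul_sum]
  refine Finset.sum_congr rfl fun p _ => ?_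
  rw [Finset.smul_sum]
  refine Finset.sum_congr rfl fun q _ => ?_
  rw [conjTranspose_onb, onb, Matrix.mul_smul, Matrix.smul_mul, Matrix.smul_mul, smul_smul,
    ← mul_inv, sqrt_mul_sqrt]

theorem trace_onb_mul (k l : D.Index) :
    (D.onb k * (D.onb l)ᴴ).trace = if k = l then 1 else 0 := by
  rw [conjTranspose_onb, onb, Matrix.mul_smul, Matrix.smul_mul, smul_smul, Matrix.trace_smul]
  obtain ⟨i, p, q⟩ := k
  obtain ⟨j, p', q'⟩ := l
  by_cases hij : i = j
  · subst hij
    rw [unit_mul_unit]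
    by_cases hq : q = q'
    · subst hq
      simp only [if_true, trace_unit]
      by_cases hp : p = p'
      · subst hp
        simp only [if_true, smul_eq_mul]
        rw [← mul_inv, sqrt_mul_sqrt, inv_mul_cancel₀ (D.y_ne_zero i)]
      · simp [hp]
    · simp [hq]
  · rw [unit_mul_unit_of_ne D hij]
    simp [hij]

theorem sum_coOnb_mul_onb : ∑ k, (D.coOnb k)ᴴ * D.onb k = 1 := by
  rw [← D.sum_unit, Fintype.sum_sigma]
  refine Finset.sum_congr rfl fun i _ => ?_
  rw [Fintype.sum_prod_type]
  have h : ∀ p q, (D.coOnb ⟨i, p, q⟩)ᴴ * D.onb ⟨i, p, q⟩ = ((D.a i : ℂ)⁻¹) • D.unit i q q := by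
    intro p q
    rw [conjTranspose_coOnb, onb, Matrix.mul_smul, Matrix.smul_mul, smul_smul, unit_mul_unit,
      if_pos rfl]
    congr 1
    have := D.sqrt_ne_zero i
    field_simp
  simp only [h]
  rw [Finset.sum_const, Finset.card_univ, Fintype.card_fin, ← Finset.smul_sum,
    ← Nat.cast_smul_eq_nsmul ℂ, smul_smul, mul_inv_cancel₀ (D.a_ne_zero i), one_smul]

theorem weight_mul_unit (i : Fin D.r) (p q : Fin (D.a i)) :
    D.weight * D.unit i p q = ((D.a i : ℂ) / D.y i) • D.unit i p q := by
  rw [weight, Matrix.sum_mul, Finset.sum_eq_single i]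
  · rw [Matrix.smul_mul, Matrix.sum_mul]
    simp [unit_mul_unit]
  · intro j _ hj
    rw [Matrix.smul_mul, Matrix.sum_mul]
    simp [unit_mul_unit_of_ne D hj]
  · simp

theorem sum_coOnb_weight : ∑ k, (D.coOnb k)ᴴ * (D.weight * D.coOnb k) = 1 := by
  rw [← D.sum_coOnb_mul_onb]
  refine Finset.sum_congr rfl fun k _ => ?_
  congr 1
  rw [coOnb, Matrix.mul_smul, weight_mul_unit, smul_smul, onb]
  congr 1
  have h1 := D.sqrt_ne_zero k.1
  have h2 := D.a_ne_zero k.1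
  rw [← D.sqrt_mul_sqrt]
  field_simp

theorem condExp_mem (X : Matrix n n ℂ) : D.condExp X ∈ S₀ :=
  S₀.sum_mem fun i _ => S₀.smul_mem (S₀.sum_mem fun p _ => S₀.sum_mem fun q _ =>
    S₀.smul_mem (D.unit_mem i p q) _) _

theorem trace_unit_mul_sum (M : ∀ i, Matrix (Fin (D.a i)) (Fin (D.a i)) ℂ) (i : Fin D.r)
    (p q : Fin (D.a i)) :
    (D.unit i q p * ∑ i, ∑ p, ∑ q, M i p q • D.unit i p q).trace = D.y i * M i p q := by
  simp only [Matrix.mul_sum, Matrix.mul_smul, Matrix.trace_sum, Matrix.trace_smul]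
  rw [Finset.sum_eq_single i]
  · simp only [unit_mul_unit, apply_ite Matrix.trace, trace_unit, Matrix.trace_zero]
    simp [mul_comm]
  · intro j _ hj
    simp [unit_mul_unit_of_ne D (Ne.symm hj)]
  · simp

theorem condExp_of_mem {X : Matrix n n ℂ} (hX : X ∈ S₀) : D.condExp X = X := by
  obtain ⟨M, rfl⟩ := D.mem_iff_unit.1 hX
  rw [condExp]
  refine Finset.sum_congr rfl fun i _ => ?_
  rw [Finset.smul_sum]
  refine Finset.sum_congr rfl fun p _ => ?_
  rw [Finset.smul_sum]
  refine Finset.sum_congr rfl fun q _ => ?_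
  rw [trace_unit_mul_sum, smul_smul, ← mul_assoc, inv_mul_cancel₀ (D.y_ne_zero i), one_mul]

theorem condExp_add (X Y : Matrix n n ℂ) : D.condExp (X + Y) = D.condExp X + D.condExp Y := by
  simp only [condExp, Matrix.mul_add, Matrix.trace_add, add_smul, Finset.sum_add_distrib, smul_add]

theorem condExp_of_perp {S : Submodule ℂ (Matrix n n ℂ)} (hS : algSpace S₀ ≤ S)
    {X : Matrix n n ℂ} (hX : X ∈ perp S) : D.condExp X = 0 := by
  have h : ∀ i p q, (D.unit i q p * X).trace = 0 := by
    intro i p q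
    have := hX (D.unit i p q) (hS (D.unit_mem i p q))
    rwa [conjTranspose_unit] at this
  simp [condExp, h]

theorem unit_mul_condExp_mul_unit (X : Matrix n n ℂ) (i : Fin D.r) (q : Fin (D.a i)) :
    D.unit i q q * D.condExp X * D.unit i q q =
      ((D.y i : ℂ)⁻¹ * (D.unit i q q * X).trace) • D.unit i q q := by
  rw [condExp, Matrix.mul_sum, Matrix.sum_mul, Finset.sum_eq_single i]
  · simp only [Matrix.mul_smul, Matrix.smul_mul, Matrix.mul_sum, Matrix.sum_mul, unit_mul_unit,
      ite_mul, zero_mul, smul_ite, smul_zero]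
    simp [smul_smul]
  · intro j _ hj
    simp only [Matrix.mul_smul, Matrix.smul_mul, Matrix.mul_sum, Matrix.sum_mul,
      unit_mul_unit_of_ne D hj.symm]
    simp
  · simp

/-- The central projections of `S₀`. -/
noncomputable def centralProj (i : Fin D.r) : Matrix n n ℂ := ∑ q, D.unit i q q

theorem conjTranspose_centralProj (i : Fin D.r) : (D.centralProj i)ᴴ = D.centralProj i := by
  rw [centralProj, Matrix.conjTranspose_sum]
  simp [conjTranspose_unit]

theorem sum_centralProj_conj {X : Matrix n n ℂ} (hX : X ∈ S₀) :
    ∑ i, D.centralProj i * X * D.centralProj i = X := by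
  obtain ⟨M, rfl⟩ := D.mem_iff_unit.1 hX
  refine Finset.sum_congr rfl fun i _ => ?_
  have h1 : D.centralProj i * (∑ i, ∑ p, ∑ q, M i p q • D.unit i p q) =
      ∑ p, ∑ q, M i p q • D.unit i p q := by
    rw [Matrix.mul_sum, Finset.sum_eq_single i]
    · simp only [Matrix.mul_sum]
      refine Finset.sum_congr rfl fun p _ => Finset.sum_congr rfl fun q _ => ?_
      rw [Matrix.mul_smul, centralProj, Matrix.sum_mul]
      simp [unit_mul_unit]
    · intro j _ hj
      simp [centralProj, Matrix.mul_sum, Matrix.sum_mul, unit_mul_unit_of_ne D hj.symm]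
    · simp
  rw [h1, Matrix.sum_mul]
  refine Finset.sum_congr rfl fun p _ => ?_
  rw [Matrix.sum_mul]
  refine Finset.sum_congr rfl fun q _ => ?_
  rw [Matrix.smul_mul, centralProj, Matrix.mul_sum]
  simp [unit_mul_unit]

/-- The elements of the commutant that implement `condExp`. -/
noncomputable def kraus (i : Fin D.r) (s t : Fin (D.y i)) : Matrix n n ℂ :=
  ∑ p, blockCol D.U i p * Matrix.single s t (1 : ℂ) * (blockCol D.U i p)ᴴ

theorem condExp_eq_kraus (X : Matrix n n ℂ) :
    D.condExp X =
      ∑ i, ((D.y i : ℂ)⁻¹) • ∑ s, ∑ t, D.kraus i s t * X * (D.kraus i s t)ᴴ := by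
  rw [condExp]
  refine Finset.sum_congr rfl fun i _ => ?_
  congr 1
  let N : Fin (D.a i) → Fin (D.a i) → Matrix (Fin (D.y i)) (Fin (D.y i)) ℂ :=
    fun p q => (blockCol D.U i p)ᴴ * X * blockCol D.U i q
  have h1 : ∀ s t : Fin (D.y i), D.kraus i s t * X * (D.kraus i s t)ᴴ =
      ∑ p, ∑ q, blockCol D.U i p * Matrix.single s s (N p q t t) * (blockCol D.U i q)ᴴ := by
    intro s t
    rw [kraus, Matrix.conjTranspose_sum, Matrix.sum_mul, Matrix.sum_mul]
    refine Finset.sum_congr rfl fun p _ => ?_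
    rw [Matrix.mul_sum]
    refine Finset.sum_congr rfl fun q _ => ?_
    have := Matrix.single_mul_mul_single s t t s (1 : ℂ) (N p q) 1
    rw [one_mul, mul_one] at this
    rw [← this]
    simp only [N, Matrix.conjTranspose_mul, Matrix.conjTranspose_conjTranspose,
      Matrix.conjTranspose_single, star_one, Matrix.mul_assoc]
  simp only [h1]
  have h2 : ∀ p q, (D.unit i q p * X).trace • D.unit i p q =
      ∑ s : Fin (D.y i), ∑ t : Fin (D.y i),
        blockCol D.U i p * Matrix.single s s (N p q t t) * (blockCol D.U i q)ᴴ := by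
    intro p q
    simp only [← Matrix.sum_mul, ← Matrix.mul_sum]
    have : ∑ s : Fin (D.y i), ∑ t : Fin (D.y i), Matrix.single s s (N p q t t) =
        (D.unit i q p * X).trace • (1 : Matrix (Fin (D.y i)) (Fin (D.y i)) ℂ) := by
      have h4 : (D.unit i q p * X).trace =
          (N p q).trace := by
        rw [unit, Matrix.mul_assoc, Matrix.trace_mul_comm]
      rw [h4]
      ext s' t'
      simp only [Matrix.sum_apply, Matrix.single_apply, Matrix.smul_apply, Matrix.one_apply]
      by_cases h : s' = t'
      · subst h
        simp [Matrix.trace]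
      · have h3 : ∀ s, ¬ (s = s' ∧ s = t') := fun s hs => h (hs.1.symm.trans hs.2)
        simp [h, h3]
    rw [this, Matrix.mul_smul, Matrix.smul_mul, Matrix.mul_one]
    rfl
  simp only [h2]
  exact sum_sum_comm _

end BlockDecomposition

namespace BlockDecomposition

open scoped ComplexOrder

variable {n m : Type*} [Fintype n] [DecidableEq n] [Fintype m] [DecidableEq m]
  {S₀ : StarSubalgebra ℂ (Matrix n n ℂ)} (D : BlockDecomposition S₀)

/-- `condExp ⊗ id`. -/
noncomputable def condExpSlices (Y : Matrix (n × m) (n × m) ℂ) : Matrix (n × m) (n × m) ℂ :=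
  Matrix.of fun p q => D.condExp (slice Y p.2 q.2) p.1 q.1

theorem slice_condExpSlices (Y : Matrix (n × m) (n × m) ℂ) (j k : m) :
    slice (D.condExpSlices Y) j k = D.condExp (slice Y j k) := rfl

theorem slice_sum {α : Type*} (s : Finset α) (f : α → Matrix (n × m) (n × m) ℂ) (j k : m) :
    slice (∑ x ∈ s, f x) j k = ∑ x ∈ s, slice (f x) j k := by
  ext i i'
  simp [slice, Matrix.sum_apply]

theorem conjTranspose_kronecker_one (A : Matrix n n ℂ) :
    (A ⊗ₖ (1 : Matrix m m ℂ))ᴴ = Aᴴ ⊗ₖ (1 : Matrix m m ℂ) := by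
  rw [Matrix.conjTranspose_kronecker, Matrix.conjTranspose_one]

theorem condExpSlices_nonneg {Y : Matrix (n × m) (n × m) ℂ} (hY : 0 ≤ Y) :
    0 ≤ D.condExpSlices Y := by
  have h : D.condExpSlices Y = ∑ i, ((D.y i : ℂ)⁻¹) • ∑ s, ∑ t,
      (D.kraus i s t ⊗ₖ (1 : Matrix m m ℂ)) * Y * (D.kraus i s t ⊗ₖ (1 : Matrix m m ℂ))ᴴ := by
    refine slice_ext fun j k => ?_
    rw [slice_condExpSlices, condExp_eq_kraus]
    simp only [slice_sum, slice_smul, conjTranspose_kronecker_one, slice_kronecker_one_mul]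
  rw [h]
  refine Finset.sum_nonneg fun i _ => ?_
  have h0 : 0 ≤ ∑ s, ∑ t, (D.kraus i s t ⊗ₖ (1 : Matrix m m ℂ)) * Y *
      (D.kraus i s t ⊗ₖ (1 : Matrix m m ℂ))ᴴ :=
    Finset.sum_nonneg fun s _ => Finset.sum_nonneg fun t _ => by
      have := conj_mono hY (D.kraus i s t ⊗ₖ (1 : Matrix m m ℂ))
      simpa using this
  have := smul_le_smul_nonneg h0 (c := (D.y i : ℂ)⁻¹) (by
    rw [inv_nonneg]; exact Nat.cast_nonneg _)
  simpa using this

theorem unit_self_nonneg (i : Fin D.r) (q : Fin (D.a i)) : 0 ≤ D.unit i q q :=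
  Matrix.nonneg_iff_posSemidef.2 (Matrix.posSemidef_self_mul_conjTranspose _)

theorem partialTrace_unit_mul_le {Y : Matrix (n × m) (n × m) ℂ} (hY : 0 ≤ Y) (i : Fin D.r)
    (q : Fin (D.a i)) :
    (Matrix.of fun j k => (D.unit i q q * slice Y j k).trace) ≤ partialTrace Y := by
  set M : (Σ i, Fin (D.a i)) → Matrix m m ℂ := fun x =>
    Matrix.of fun j k => (D.unit x.1 x.2 x.2 * slice Y j k).trace with hM_def
  have hM : ∀ x, 0 ≤ M x := by
    rintro ⟨i, q⟩
    have h1 : M ⟨i, q⟩ = partialTrace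
        ((D.unit i q q ⊗ₖ (1 : Matrix m m ℂ)) * Y * (D.unit i q q ⊗ₖ (1 : Matrix m m ℂ))ᴴ) := by
      ext j k
      rw [partialTrace_apply, conjTranspose_kronecker_one, slice_kronecker_one_mul,
        conjTranspose_unit, Matrix.trace_mul_comm, ← Matrix.mul_assoc, unit_mul_unit, if_pos rfl]
      rfl
    rw [h1]
    refine partialTrace_nonneg ?_
    have := conj_mono hY (D.unit i q q ⊗ₖ (1 : Matrix m m ℂ))
    simpa using this
  have hsum : ∑ x, M x = partialTrace Y := by
    ext j k
    rw [Matrix.sum_apply, partialTrace_apply, Fintype.sum_sigma]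
    conv_rhs => rw [← Matrix.one_mul (slice Y j k), ← D.sum_unit]
    simp only [Matrix.sum_mul, Matrix.trace_sum]
    rfl
  have hle : M ⟨i, q⟩ ≤ ∑ x, M x := Finset.single_le_sum (fun x _ => hM x) (Finset.mem_univ _)
  rw [hsum] at hle
  exact hle

theorem kronecker_le_kronecker {A : Matrix n n ℂ} {B C : Matrix m m ℂ} (hA : 0 ≤ A) (h : B ≤ C) :
    A ⊗ₖ B ≤ A ⊗ₖ C := by
  rw [Matrix.le_iff] at h ⊢
  have := (Matrix.nonneg_iff_posSemidef.1 hA).kronecker h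
  convert this using 1
  ext; simp [mul_sub]

/-- A Pimsner-Popa type inequality for the projection onto `S₀`. -/
theorem condExpSlices_le {Y : Matrix (n × m) (n × m) ℂ} (hY : 0 ≤ Y) (h1 : partialTrace Y ≤ 1) :
    D.condExpSlices Y ≤ D.weight ⊗ₖ (1 : Matrix m m ℂ) := by
  have hY₀ := D.condExpSlices_nonneg hY
  have hsum : D.condExpSlices Y = ∑ i, (D.centralProj i ⊗ₖ (1 : Matrix m m ℂ)) *
      D.condExpSlices Y * (D.centralProj i ⊗ₖ (1 : Matrix m m ℂ))ᴴ := by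
    refine slice_ext fun j k => ?_
    simp only [slice_sum, conjTranspose_kronecker_one, slice_kronecker_one_mul,
      conjTranspose_centralProj, slice_condExpSlices]
    exact (D.sum_centralProj_conj (D.condExp_mem _)).symm
  have hw : D.weight ⊗ₖ (1 : Matrix m m ℂ) =
      ∑ i, ((D.a i : ℂ) • ∑ q, ((D.y i : ℂ)⁻¹) • (D.unit i q q ⊗ₖ (1 : Matrix m m ℂ))) := by
    refine slice_ext fun j k => ?_
    simp only [slice_sum, slice_smul, slice_kronecker, weight, Finset.smul_sum, smul_smul,
      div_eq_mul_inv]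
    refine Finset.sum_congr rfl fun i _ => Finset.sum_congr rfl fun q _ => ?_
    congr 1
    ring
  rw [hsum, hw]
  refine Finset.sum_le_sum fun i _ => ?_
  have hc : D.centralProj i ⊗ₖ (1 : Matrix m m ℂ) =
      ∑ q, D.unit i q q ⊗ₖ (1 : Matrix m m ℂ) := by
    refine slice_ext fun j k => ?_
    simp only [slice_sum, slice_kronecker, centralProj, Finset.smul_sum]
  rw [hc]
  refine (sum_conj_le _ hY₀).trans ?_
  rw [Fintype.card_fin]
  refine smul_le_smul_nonneg (Finset.sum_le_sum fun q _ => ?_) (Nat.cast_nonneg _)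
  have h2 : (D.unit i q q ⊗ₖ (1 : Matrix m m ℂ)) * D.condExpSlices Y *
      (D.unit i q q ⊗ₖ (1 : Matrix m m ℂ))ᴴ = ((D.y i : ℂ)⁻¹) • (D.unit i q q ⊗ₖ
        (Matrix.of fun j k => (D.unit i q q * slice Y j k).trace : Matrix m m ℂ)) := by
    refine slice_ext fun j k => ?_
    rw [conjTranspose_kronecker_one, slice_kronecker_one_mul, conjTranspose_unit,
      slice_condExpSlices, unit_mul_condExp_mul_unit, slice_smul, slice_kronecker, smul_smul]
    rfl
  rw [h2]
  refine smul_le_smul_nonneg ?_ (by rw [inv_nonneg]; exact Nat.cast_nonneg _)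
  exact kronecker_le_kronecker (D.unit_self_nonneg i q) ((D.partialTrace_unit_mul_le hY i q).trans h1)

end BlockDecomposition

section AlgGraph

open scoped ComplexOrder

variable {n m : Type*} [Fintype n] [DecidableEq n] [Fintype m] [DecidableEq m]
  {S₀ : StarSubalgebra ℂ (Matrix n n ℂ)} {S : Submodule ℂ (Matrix n n ℂ)}

theorem IsAlgGraph.mul_mem (hS : IsAlgGraph S₀ S) {A X B : Matrix n n ℂ} (hA : A ∈ S₀)
    (hX : X ∈ S) (hB : B ∈ S₀) : A * X * B ∈ S := by
  have h := Submodule.mul_mem_mul (Submodule.mul_mem_mul (show A ∈ algSpace S₀ from hA) hX)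
    (show B ∈ algSpace S₀ from hB)
  rwa [hS.bimodule] at h

theorem IsAlgGraph.mul_mem_perp (hS : IsAlgGraph S₀ S) {A X B : Matrix n n ℂ} (hA : A ∈ S₀)
    (hX : X ∈ perp S) (hB : B ∈ S₀) : A * X * B ∈ perp S := by
  intro Y hY
  have h := hX _ (hS.mul_mem (star_mem hA) hY (star_mem hB))
  rw [Matrix.star_eq_conjTranspose, Matrix.star_eq_conjTranspose, Matrix.conjTranspose_mul,
    Matrix.conjTranspose_mul, Matrix.conjTranspose_conjTranspose,
    Matrix.conjTranspose_conjTranspose, Matrix.mul_assoc, Matrix.trace_mul_comm] at h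
  rw [← h]
  simp only [Matrix.mul_assoc]

theorem IsAlgGraph.graphCompl (hS : IsAlgGraph S₀ S) : IsNCGraph (graphCompl S₀ S) where
  conjTranspose_mem := by
    intro X hX
    obtain ⟨X₁, h₁, X₂, h₂, rfl⟩ := Submodule.mem_sup.1 hX
    rw [Matrix.conjTranspose_add]
    exact Submodule.add_mem_sup (hS.isNCGraph.conjTranspose_mem_perp h₁)
      (show X₂ᴴ ∈ S₀ from star_mem (show X₂ ∈ S₀ from h₂))
  one_mem := Submodule.mem_sup_right (show (1 : Matrix n n ℂ) ∈ S₀ from one_mem S₀)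

variable (D : BlockDecomposition S₀)

theorem psi_mem_level_of_dual (hS : IsAlgGraph S₀ S) {Z : Matrix n n ℂ} (hZ : 0 ≤ Z)
    {T : Matrix (n × n) (n × n) ℂ}
    (hT : ∀ j k, slice T j k - ((1 : Matrix n n ℂ) j k) • (1 : Matrix n n ℂ) ∈ perp S)
    (hZT : rankOne (vec (CFC.sqrt Z)) ≤ T) : D.psi Z ∈ level (graphCompl S₀ S) := by
  have hsl : ∀ (j j' : n) (k l : D.Index),
      slice (stack n D.onb * T * (stack n D.onb)ᴴ) (j, k) (j', l) =
        D.onb k * (slice T j j' - ((1 : Matrix n n ℂ) j j') • 1) * (D.onb l)ᴴ +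
          ((1 : Matrix n n ℂ) j j') • (D.onb k * (D.onb l)ᴴ) := by
    intro j j' k l
    rw [slice_stack_mul, Matrix.mul_sub, Matrix.sub_mul, Matrix.mul_smul, Matrix.mul_one,
      Matrix.smul_mul, sub_add_cancel]
  have hstar : ∀ l, (D.onb l)ᴴ ∈ S₀ := fun l => star_mem (D.onb_mem l)
  have hfeas : Feasible (graphCompl S₀ S) 1 (stackCols D.onb (CFC.sqrt Z)) := by
    refine ⟨stack n D.onb * T * (stack n D.onb)ᴴ, ?_, ?_, ?_⟩
    · rintro ⟨j, k⟩ ⟨j', l⟩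
      rw [hsl]
      refine Submodule.add_mem_sup (hS.mul_mem_perp (D.onb_mem k) (hT j j') (hstar l))
        (Submodule.smul_mem _ _ ?_)
      exact S₀.mul_mem (D.onb_mem k) (hstar l)
    · refine le_of_eq ?_
      ext ⟨j, k⟩ ⟨j', l⟩
      rw [partialTrace_apply, hsl, Matrix.trace_add, Matrix.trace_smul, D.trace_onb_mul]
      have h0 := hS.mul_mem_perp (D.onb_mem k) (hT j j') (hstar l) 1 hS.isNCGraph.one_mem
      rw [Matrix.conjTranspose_one, Matrix.one_mul] at h0
      rw [h0]
      by_cases hj : j = j' <;> by_cases hk : k = l <;> simp [Matrix.one_apply, hj, hk]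
    · have := conj_mono hZT (stack n D.onb)
      rwa [conj_rankOne, stack_mulVec_vec] at this
  have := hfeas.mem_level
  rwa [stackCols_mul_conjTranspose, sqrt_mul_conjTranspose hZ, D.sum_onb_conj] at this

theorem rankOne_trace_mul {ι : Type*} [Fintype ι] [DecidableEq ι] (v w : ι → ℂ) :
    (rankOne v * rankOne w).trace.re = ‖star v ⬝ᵥ w‖ ^ 2 := by
  have h : star w ⬝ᵥ v = star (star v ⬝ᵥ w) := by
    rw [Matrix.star_dotProduct]
  have h1 : rankOne v *ᵥ w = (star v ⬝ᵥ w) • v := by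
    ext i
    simp [rankOne, Matrix.vecMulVec_mulVec, mul_comm]
  rw [trace_mul_rankOne, h1, dotProduct_smul, h, smul_eq_mul]
  change ((star v ⬝ᵥ w) * (starRingEnd ℂ) (star v ⬝ᵥ w)).re = _
  rw [Complex.mul_conj, Complex.ofReal_re, Complex.normSq_eq_norm_sq]

theorem trace_mul_le_of_psi_mem_level (hS : IsAlgGraph S₀ S) {Z W : Matrix n n ℂ} (hZ : 0 ≤ Z)
    (hΨ : D.psi Z ∈ level (graphCompl S₀ S)) (hW : W ∈ level S) : (W * Z).trace.re ≤ 1 := by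
  obtain ⟨hW0, Y, hYS, hY1, hYW⟩ := hW
  have hV' : stackCols D.onb (CFC.sqrt Z) * (stackCols D.onb (CFC.sqrt Z))ᴴ ≤ D.psi Z := by
    rw [stackCols_mul_conjTranspose, sqrt_mul_conjTranspose hZ, D.sum_onb_conj]
  obtain ⟨Y', hYS', hY1', hYV'⟩ := Feasible.of_mem_level hΨ hV'
  rw [Complex.ofReal_one, one_smul] at hY1 hY1'
  have hY0 : 0 ≤ Y := (rankOne_nonneg _).trans hYW
  have hY0' : 0 ≤ Y' := (rankOne_nonneg _).trans hYV'
  set t := (W * Z).trace.re with ht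
  set C := (CFC.sqrt W * CFC.sqrt Z)ᵀ with hC
  have ht' : (CFC.sqrt Z * W * CFC.sqrt Z).trace.re = t := by
    rw [Matrix.trace_mul_comm, ← Matrix.mul_assoc, CFC.sqrt_mul_sqrt_self Z hZ,
      Matrix.trace_mul_comm]
  have ht0 : 0 ≤ t := (Complex.le_def.1 (trace_mul_nonneg hW0 hZ)).1
  have hA0 : 0 ≤ amp C Y := by simpa [amp] using amp_mono C hY0
  set G := stack n D.coOnb with hG
  have hX0 : 0 ≤ G * amp C Y * Gᴴ := by simpa using conj_mono hA0 G
  -- lower bound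
  have hlow : t ^ 2 ≤ (G * amp C Y * Gᴴ * Y').trace.re := by
    refine le_trans ?_ (trace_mul_mono_right hX0 hYV')
    have e1 : (G * amp C Y * Gᴴ * rankOne (vec (stackCols D.onb (CFC.sqrt Z)))).trace =
        (amp C Y * rankOne (vec (CFC.sqrt Z))).trace := by
      have e2 : Gᴴ *ᵥ vec (stackCols D.onb (CFC.sqrt Z)) = vec (CFC.sqrt Z) := by
        rw [← stack_mulVec_vec, Matrix.mulVec_mulVec, hG, conjTranspose_stack_mul_stack,
          D.sum_coOnb_mul_onb, Matrix.one_kronecker_one, Matrix.one_mulVec]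
      have e3 := conj_rankOne Gᴴ (vec (stackCols D.onb (CFC.sqrt Z)))
      rw [e2, Matrix.conjTranspose_conjTranspose] at e3
      rw [← e3, Matrix.mul_assoc, Matrix.mul_assoc, Matrix.trace_mul_comm G]
      simp only [Matrix.mul_assoc]
    rw [e1]
    refine le_trans ?_ (trace_mul_mono_left (rankOne_nonneg _) (amp_mono C hYW))
    rw [amp_rankOne_vec, rankOne_trace_mul, star_vec_dotProduct_vec, hC,
      Matrix.transpose_transpose, ← Matrix.mul_assoc, CFC.sqrt_mul_sqrt_self W hW0,
      Matrix.conjTranspose_mul, isHermitian_sqrt, isHermitian_of_nonneg hW0, ← ht']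
    rw [← sq_abs]
    exact pow_le_pow_left₀ (abs_nonneg _) (Complex.abs_re_le_norm _) 2
  -- upper bound
  have hE : (G * amp C Y * Gᴴ * Y').trace = (G * amp C Y * Gᴴ * D.condExpSlices Y').trace := by
    rw [trace_mul_eq_sum_slice, trace_mul_eq_sum_slice]
    refine Finset.sum_congr rfl fun x _ => Finset.sum_congr rfl fun x' _ => ?_
    obtain ⟨j, k⟩ := x
    obtain ⟨j', l⟩ := x'
    have h1 : slice (G * amp C Y * Gᴴ) (j, k) (j', l) ∈ S := by
      rw [hG, slice_stack_mul]
      exact hS.mul_mem (D.coOnb_mem k) (slice_amp_mem _ hYS _ _) (star_mem (D.coOnb_mem l))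
    obtain ⟨X₁, h₁, X₂, h₂, h12⟩ := Submodule.mem_sup.1 (hYS' (j', l) (j, k))
    rw [D.slice_condExpSlices, ← h12, D.condExp_add, D.condExp_of_perp hS.le h₁,
      D.condExp_of_mem h₂, zero_add, Matrix.mul_add, Matrix.trace_add,
      hS.isNCGraph.trace_mul_eq_zero h₁ h1, zero_add]
  have hup : (G * amp C Y * Gᴴ * Y').trace.re ≤ t := by
    rw [hE]
    refine (trace_mul_mono_right hX0 (D.condExpSlices_le hY0' hY1')).trans ?_
    have e1 : (G * amp C Y * Gᴴ * (D.weight ⊗ₖ (1 : Matrix (n × D.Index) (n × D.Index) ℂ))).trace =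
        (amp C Y).trace := by
      have e2 : Gᴴ * (D.weight ⊗ₖ (1 : Matrix (n × D.Index) (n × D.Index) ℂ)) * G = 1 := by
        rw [Matrix.mul_assoc, hG, kronecker_one_mul_stack, conjTranspose_stack_mul_stack,
          D.sum_coOnb_weight, Matrix.one_kronecker_one]
      rw [Matrix.mul_assoc, Matrix.mul_assoc, Matrix.trace_mul_comm G, Matrix.mul_assoc,
        e2, Matrix.mul_one]
    rw [e1, ← trace_partialTrace, partialTrace_amp]
    refine (trace_re_le_of_le (conj_mono hY1 C)).trans ?_
    rw [Matrix.mul_one, ← ht']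
    refine le_of_eq ?_
    congr 1
    have e3 : C * Cᴴ = ((CFC.sqrt W * CFC.sqrt Z)ᴴ * (CFC.sqrt W * CFC.sqrt Z))ᵀ := by
      rw [Matrix.transpose_mul, hC]
      rfl
    rw [e3, Matrix.trace_transpose, Matrix.conjTranspose_mul, isHermitian_sqrt, isHermitian_sqrt]
    simp only [Matrix.mul_assoc]
    rw [← Matrix.mul_assoc (CFC.sqrt W), CFC.sqrt_mul_sqrt_self W hW0]
  nlinarith

theorem thetaBody_eq_psi [Nonempty n] (hS : IsAlgGraph S₀ S) :
    thetaBody S = {Z | 0 ≤ Z ∧ D.psi Z ∈ level (graphCompl S₀ S)} := by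
  rw [thetaBody_eq hS.isNCGraph.one_mem]
  ext Z
  constructor
  · intro hZ
    obtain ⟨T, hT, hZT⟩ := exists_dual_of_mem_antiblocker hS.isNCGraph hZ
    exact ⟨hZ.1, psi_mem_level_of_dual D hS hZ.1 hT hZT⟩
  · rintro ⟨hZ, hΨ⟩
    exact ⟨hZ, fun W hW => trace_mul_le_of_psi_mem_level D hS hZ hΨ hW⟩

end AlgGraph

section Consequences

open scoped ComplexOrder

variable {n : Type*} [Fintype n] [DecidableEq n] [Nonempty n]
  {S₀ : StarSubalgebra ℂ (Matrix n n ℂ)} {S : Submodule ℂ (Matrix n n ℂ)}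

theorem isCompact_thetaBody (h1 : (1 : Matrix n n ℂ) ∈ S) : IsCompact (thetaBody S) := by
  rw [thetaBody_eq h1]
  obtain ⟨l, hl, hfeas⟩ := exists_feasible h1 (1 : Matrix n n ℂ)
  have hmem := (hfeas.smul (Real.sqrt l)⁻¹)
  rw [inv_pow, Real.sq_sqrt hl.le, inv_mul_cancel₀ hl.ne'] at hmem
  have hmem' := hmem.mem_level
  have e : ((((Real.sqrt l)⁻¹ : ℝ) : ℂ) • (1 : Matrix n n ℂ)) *
      ((((Real.sqrt l)⁻¹ : ℝ) : ℂ) • (1 : Matrix n n ℂ))ᴴ = ((l⁻¹ : ℝ) : ℂ) • 1 := by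
    rw [Matrix.conjTranspose_smul, Matrix.smul_mul, Matrix.mul_smul, smul_smul,
      Matrix.conjTranspose_one, Matrix.mul_one]
    congr 1
    have : star (((Real.sqrt l)⁻¹ : ℝ) : ℂ) = (((Real.sqrt l)⁻¹ : ℝ) : ℂ) := Complex.conj_ofReal _
    rw [this, ← Complex.ofReal_mul, ← mul_inv, Real.mul_self_sqrt hl.le]
  rw [e] at hmem'
  refine (isCompact_nonneg_trace_le l).of_isClosed_subset ?_ ?_
  · have : antiblocker (level S) = {X | 0 ≤ X} ∩ ⋂ A ∈ level S, {X | (A * X).trace.re ≤ 1} := by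
      ext X; simp [antiblocker]
    rw [this]
    refine isClosed_nonneg.inter (isClosed_biInter fun A _ => ?_)
    exact isClosed_le (Complex.continuous_re.comp
      (continuous_const.matrix_mul continuous_id).matrix_trace) continuous_const
  · rintro X ⟨hX, h⟩
    refine ⟨hX, ?_⟩
    have := h _ hmem'
    rwa [Matrix.smul_mul, Matrix.one_mul, Matrix.trace_smul, smul_eq_mul, Complex.re_ofReal_mul,
      inv_mul_le_iff₀ hl, mul_one] at this

theorem convex_antiblocker (C : Set (Matrix n n ℂ)) : Convex ℝ (antiblocker C) := by
  rintro X ⟨hX, hX'⟩ Y ⟨hY, hY'⟩ a b ha hb hab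
  refine ⟨convex_nonneg hX hY ha hb hab, fun A hA => ?_⟩
  rw [Matrix.mul_add, Matrix.mul_smul, Matrix.mul_smul, Matrix.trace_add, Matrix.trace_smul,
    Matrix.trace_smul, Complex.add_re, Complex.real_smul, Complex.real_smul,
    Complex.re_ofReal_mul, Complex.re_ofReal_mul]
  nlinarith [hX' A hA, hY' A hA]

theorem zero_mem_thetaBody (S : Submodule ℂ (Matrix n n ℂ)) : 0 ∈ thetaBody S :=
  ⟨le_rfl, fun W _ _ => by simp⟩

theorem thetaBody_eq_antiblocker_image (D : BlockDecomposition S₀) (hS : IsAlgGraph S₀ S) :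
    thetaBody S = antiblocker (D.psi '' thetaBody (graphCompl S₀ S)) := by
  rw [thetaBody_eq_psi D hS, ← antiblocker_thetaBody hS.graphCompl.one_mem]
  ext Z
  constructor
  · rintro ⟨hZ, -, h⟩
    refine ⟨hZ, ?_⟩
    rintro _ ⟨X, hX, rfl⟩
    rw [D.trace_psi_mul]
    exact h X hX
  · rintro ⟨hZ, h⟩
    refine ⟨hZ, D.psi_nonneg hZ, fun X hX => ?_⟩
    rw [← D.trace_psi_mul]
    exact h _ ⟨X, hX, rfl⟩

theorem subset_antiblocker_antiblocker {C : Set (Matrix n n ℂ)} (hC : ∀ X ∈ C, 0 ≤ X) :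
    C ⊆ antiblocker (antiblocker C) := fun X hX =>
  ⟨hC X hX, fun Z hZ => by rw [Matrix.trace_mul_comm]; exact hZ.2 X hX⟩

theorem exists_mem_commutant_ge (D : BlockDecomposition S₀) (hS : IsAlgGraph S₀ S)
    {W : Matrix n n ℂ} (hW : W ∈ level S) : ∃ X ∈ level S, X ∈ commutant S₀ ∧ W ≤ X := by
  set K := D.psi '' thetaBody (graphCompl S₀ S) with hK
  have h1 := hS.graphCompl.one_mem
  have hKp : ∀ X ∈ K, 0 ≤ X := by
    rintro _ ⟨X, hX, rfl⟩
    exact D.psi_nonneg hX.1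
  have hlev : level S = antiblocker (antiblocker K) := by
    rw [← antiblocker_thetaBody hS.isNCGraph.one_mem, thetaBody_eq_antiblocker_image D hS]
  have hKc : Convex ℝ K := by
    have : Convex ℝ (thetaBody (graphCompl S₀ S)) := by
      rw [thetaBody_eq h1]; exact convex_antiblocker _
    exact this.linear_image (D.psiLinear.restrictScalars ℝ)
  obtain ⟨X, hX, hWX⟩ := exists_le_of_forall_antiblocker
    ((isCompact_thetaBody h1).image D.continuous_psi) hKc
    ⟨_, 0, zero_mem_thetaBody _, rfl⟩ hKp hW.1 fun Z hZ => by
      rw [hlev] at hW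
      rw [Matrix.trace_mul_comm]
      exact hW.2 Z hZ
  refine ⟨X, ?_, ?_, hWX⟩
  · rw [hlev]
    exact subset_antiblocker_antiblocker hKp hX
  · obtain ⟨X', -, rfl⟩ := hX
    exact D.psi_mem_commutant X'

theorem antiblocker_thetaBody_eq_her (D : BlockDecomposition S₀) (hS : IsAlgGraph S₀ S) :
    antiblocker (thetaBody S) = her (antiblocker (thetaBody S) ∩ commutant S₀) := by
  rw [antiblocker_thetaBody hS.isNCGraph.one_mem]
  ext W
  constructor
  · intro hW
    obtain ⟨X, hX, hXc, hWX⟩ := exists_mem_commutant_ge D hS hW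
    exact ⟨hW.1, X, ⟨hX, hXc⟩, hWX⟩
  · rintro ⟨hW, X, ⟨hX, -⟩, hWX⟩
    exact level_of_le hX hW hWX

theorem mem_commutant_of_maximal (D : BlockDecomposition S₀) (hS : IsAlgGraph S₀ S)
    {W : Matrix n n ℂ} (hW : Maximal (fun X => X ∈ antiblocker (thetaBody S)) W) :
    W ∈ commutant S₀ := by
  rw [antiblocker_thetaBody hS.isNCGraph.one_mem] at hW
  obtain ⟨X, hX, hXc, hWX⟩ := exists_mem_commutant_ge D hS hW.1
  rwa [hW.eq_of_le hX hWX]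

theorem trace_mul_le_theta (h1 : (1 : Matrix n n ℂ) ∈ S) {W Z : Matrix n n ℂ} (hW : 0 ≤ W)
    (hZ : Z ∈ thetaBody S) : (W * Z).trace.re ≤ theta S W := by
  refine le_of_forall_gt_imp_ge_of_dense fun l hl => ?_
  have hl0 : 0 < l := (theta_nonneg h1 W).trans_lt hl
  have h := (theta_le_iff_mem_level h1 hW hl0).1 hl.le
  rw [thetaBody_eq h1] at hZ
  have := hZ.2 _ h
  rwa [Matrix.smul_mul, Matrix.trace_smul, smul_eq_mul, Complex.re_ofReal_mul,
    inv_mul_le_iff₀ hl0, mul_one] at this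

theorem exists_trace_mul_eq_theta (h1 : (1 : Matrix n n ℂ) ∈ S) {W : Matrix n n ℂ} (hW : 0 ≤ W) :
    ∃ Z ∈ thetaBody S, (W * Z).trace.re = theta S W := by
  have hcont : Continuous fun Z : Matrix n n ℂ => (W * Z).trace.re :=
    Complex.continuous_re.comp (continuous_const.matrix_mul continuous_id).matrix_trace
  obtain ⟨Z, hZ, hmax⟩ := (isCompact_thetaBody h1).exists_isMaxOn ⟨0, zero_mem_thetaBody S⟩
    hcont.continuousOn
  refine ⟨Z, hZ, le_antisymm (trace_mul_le_theta h1 hW hZ) ?_⟩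
  refine le_of_forall_gt_imp_ge_of_dense fun l hl => ?_
  have hs : 0 ≤ (W * Z).trace.re := (Complex.le_def.1 (trace_mul_nonneg hW hZ.1)).1
  have hl0 : 0 < l := hs.trans_lt hl
  rw [theta_le_iff_mem_level h1 hW hl0, ← antiblocker_thetaBody h1]
  have hli : (0 : ℂ) ≤ ((l⁻¹ : ℝ) : ℂ) := by exact_mod_cast (inv_pos.2 hl0).le
  refine ⟨by simpa using smul_le_smul_nonneg hW hli, fun X hX => ?_⟩
  rw [Matrix.mul_smul, Matrix.trace_smul, smul_eq_mul, Complex.re_ofReal_mul,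
    inv_mul_le_iff₀ hl0, mul_one, Matrix.trace_mul_comm]
  exact (hmax hX).trans hl.le

theorem isGreatest_theta (D : BlockDecomposition S₀) (hS : IsAlgGraph S₀ S) {W : Matrix n n ℂ}
    (hW : 0 ≤ W) :
    IsGreatest {t : ℝ | ∃ Z : Matrix n n ℂ, 0 ≤ Z ∧ theta (graphCompl S₀ S) (D.psi Z) ≤ 1 ∧
      t = (W * Z).trace.re} (theta S W) := by
  have h1 := hS.isNCGraph.one_mem
  have hmem : ∀ Z, Z ∈ thetaBody S ↔ 0 ≤ Z ∧ theta (graphCompl S₀ S) (D.psi Z) ≤ 1 := by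
    intro Z
    rw [thetaBody_eq_psi D hS]
    refine and_congr_right fun hZ => ?_
    rw [mem_level_iff hS.graphCompl.one_mem]
    exact and_iff_right (D.psi_nonneg hZ)
  constructor
  · obtain ⟨Z, hZ, h⟩ := exists_trace_mul_eq_theta h1 hW
    exact ⟨Z, ((hmem Z).1 hZ).1, ((hmem Z).1 hZ).2, h.symm⟩
  · rintro _ ⟨Z, hZ, hZ', rfl⟩
    exact trace_mul_le_theta h1 hW ((hmem Z).2 ⟨hZ, hZ'⟩)

theorem theta_mono (h1 : (1 : Matrix n n ℂ) ∈ S) {W X : Matrix n n ℂ} (hW : 0 ≤ W) (h : W ≤ X) :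
    theta S W ≤ theta S X := by
  have hX : 0 ≤ X := hW.trans h
  rw [theta_le_iff h1]
  refine ((theta_le_iff h1).1 le_rfl : Feasible S (theta S X) (CFC.sqrt X)).of_le
    (theta_nonneg h1 X) ?_
  rwa [sqrt_mul_conjTranspose hW, sqrt_mul_conjTranspose hX]

theorem eq_zero_of_theta_eq_zero (h1 : (1 : Matrix n n ℂ) ∈ S) {W : Matrix n n ℂ} (hW : 0 ≤ W)
    (h : theta S W = 0) : W = 0 := by
  obtain ⟨Y, -, hY, hV⟩ := (theta_le_iff h1).1 h.le
  have ht := trace_le_of_partialTrace_le hY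
  rw [zero_mul] at ht
  have h2 : CFC.sqrt W = 0 := by
    ext i j
    have h3 := (norm_apply_le_trace (rankOne_nonneg (vec (CFC.sqrt W))) (i, j) (i, j)).trans
      ((trace_re_le_of_le hV).trans ht)
    simp only [rankOne, Matrix.vecMulVec_apply, vec, Pi.star_apply, norm_mul, norm_star] at h3
    simpa using le_antisymm h3 (mul_self_nonneg _)
  rw [← sqrt_mul_conjTranspose hW, h2, Matrix.zero_mul]

theorem isLeast_theta_commutant (D : BlockDecomposition S₀) (hS : IsAlgGraph S₀ S)
    {W : Matrix n n ℂ} (hW : 0 ≤ W) :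
    IsLeast {t : ℝ | ∃ X : Matrix n n ℂ, W ≤ X ∧ X ∈ commutant S₀ ∧ t = theta S X}
      (theta S W) := by
  have h1 := hS.isNCGraph.one_mem
  constructor
  · rcases (theta_nonneg h1 W).eq_or_lt with h0 | h0
    · have hW0 := eq_zero_of_theta_eq_zero h1 hW h0.symm
      refine ⟨W, le_rfl, ?_, rfl⟩
      rw [hW0]
      exact Set.zero_mem_centralizer
    · obtain ⟨X, hX, hXc, hWX⟩ := exists_mem_commutant_ge D hS
        ((theta_le_iff_mem_level h1 hW h0).1 le_rfl)
      set l := theta S W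
      have hl0 : (l : ℂ) ≠ 0 := by exact_mod_cast h0.ne'
      have hlX := smul_le_smul_nonneg hWX (c := (l : ℂ)) (by exact_mod_cast h0.le)
      rw [smul_smul, Complex.ofReal_inv, mul_inv_cancel₀ hl0, one_smul] at hlX
      refine ⟨(l : ℂ) • X, hlX, ?_, ?_⟩
      · rw [commutant, Set.mem_centralizer_iff] at hXc ⊢
        intro A hA
        rw [Matrix.mul_smul, Matrix.smul_mul, hXc A hA]
      · refine le_antisymm (theta_mono h1 hW hlX) ?_
        rw [theta_le_iff_mem_level h1 (hW.trans hlX) h0, smul_smul, Complex.ofReal_inv,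
          inv_mul_cancel₀ hl0, one_smul]
        exact hX
  · rintro _ ⟨X, hX, -, rfl⟩
    exact theta_mono h1 hW hX

end Consequences

section Classical

variable {n : Type*} [Fintype n] [DecidableEq n]

/-- The diagonal matrices. -/
def diagonalStarSubalgebra (n : Type*) [Fintype n] [DecidableEq n] :
    StarSubalgebra ℂ (Matrix n n ℂ) where
  carrier := {X | X.IsDiag}
  mul_mem' := by
    intro A B hA hB
    rw [Set.mem_ofPred_eq, ← Matrix.IsDiag.diagonal_diag hA, ← Matrix.IsDiag.diagonal_diag hB,
      Matrix.diagonal_mul_diagonal]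
    exact Matrix.isDiag_diagonal _
  add_mem' := fun hA hB => Matrix.IsDiag.add hA hB
  algebraMap_mem' := fun c => by
    rw [Matrix.algebraMap_eq_diagonal]
    exact Matrix.isDiag_diagonal _
  star_mem' := fun hA => Matrix.IsDiag.conjTranspose hA

theorem mem_classicalGraph_iff {G : SimpleGraph n} {X : Matrix n n ℂ} :
    X ∈ classicalGraph G ↔ ∀ i j, X i j ≠ 0 → i = j ∨ G.Adj i j := by
  constructor
  · intro h
    induction h using Submodule.span_induction with
    | mem x h =>
      obtain ⟨i, j, hij, rfl⟩ := h
      intro i' j' h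
      rw [Matrix.single_apply] at h
      split_ifs at h with h'
      · rwa [← h'.1, ← h'.2]
      · exact absurd rfl h
    | zero => intro i j h; exact absurd rfl h
    | add x y _ _ hx hy =>
      intro i j h
      by_cases h1 : x i j = 0
      · refine hy i j fun h2 => h ?_
        rw [Matrix.add_apply, h1, h2, add_zero]
      · exact hx i j h1
    | smul a x _ hx =>
      intro i j h
      refine hx i j fun h1 => h ?_
      rw [Matrix.smul_apply, h1, smul_zero]
  · intro h
    rw [Matrix.matrix_eq_sum_single X]
    refine Submodule.sum_mem _ fun i _ => Submodule.sum_mem _ fun j _ => ?_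
    by_cases h0 : X i j = 0
    · rw [h0, Matrix.single_zero]
      exact Submodule.zero_mem _
    · have : Matrix.single i j (X i j) = X i j • Matrix.single i j (1 : ℂ) := by
        rw [Matrix.smul_single]; simp
      rw [this]
      exact Submodule.smul_mem _ _ (Submodule.subset_span ⟨i, j, h i j h0, rfl⟩)

theorem isAlgGraph_classicalGraph (G : SimpleGraph n) :
    IsAlgGraph (diagonalStarSubalgebra n) (classicalGraph G) where
  isNCGraph :=
    { conjTranspose_mem := by
        intro X hX
        rw [mem_classicalGraph_iff] at hX ⊢
        intro i j h
        rcases hX j i (by simpa using h) with h1 | h1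
        · exact Or.inl h1.symm
        · exact Or.inr h1.symm
      one_mem := by
        rw [mem_classicalGraph_iff]
        intro i j h
        by_contra hn
        exact h (Matrix.one_apply_ne fun hij => hn (Or.inl hij)) }
  le := by
    intro X hX
    rw [mem_classicalGraph_iff]
    intro i j h
    by_contra hn
    exact h ((show X.IsDiag from hX) fun hij => hn (Or.inl hij))
  bimodule := by
    refine le_antisymm ?_ ?_
    · refine Submodule.mul_le.2 fun M hM B hB => ?_
      have hB' : B.IsDiag := hB
      rw [← hB'.diagonal_diag]
      have hM' : M ∈ classicalGraph G := by
        refine Submodule.mul_le.2 (fun A hA X hX => ?_) hM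
        have hA' : A.IsDiag := hA
        rw [← hA'.diagonal_diag]
        rw [mem_classicalGraph_iff] at hX ⊢
        intro i j h
        refine hX i j fun h0 => h ?_
        rw [Matrix.diagonal_mul, h0, mul_zero]
      rw [mem_classicalGraph_iff] at hM' ⊢
      intro i j h
      refine hM' i j fun h0 => h ?_
      rw [Matrix.mul_diagonal, h0, zero_mul]
    · intro X hX
      have h1 : (1 : Matrix n n ℂ) ∈ algSpace (diagonalStarSubalgebra n) :=
        one_mem (diagonalStarSubalgebra n)
      have := Submodule.mul_mem_mul (Submodule.mul_mem_mul h1 hX) h1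
      rwa [Matrix.one_mul, Matrix.mul_one] at this

theorem isDiag_of_mem_commutant {W : Matrix n n ℂ}
    (hW : W ∈ commutant (diagonalStarSubalgebra n)) : W.IsDiag := by
  intro i j hij
  have h := hW (Matrix.diagonal (Pi.single i 1)) (Matrix.isDiag_diagonal _)
  have h' := congrFun (congrFun h i) j
  rw [Matrix.diagonal_mul, Matrix.mul_diagonal, Pi.single_eq_same, one_mul,
    Pi.single_eq_of_ne hij.symm, mul_zero] at h'
  exact h'

end Classical

section MinimalProjections

open scoped ComplexOrder

variable {n : Type*} [Fintype n] [DecidableEq n]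

theorem exists_polynomial_mul_isIdempotent {y : Matrix n n ℂ} (hy : yᴴ = y) :
    ∃ f : Polynomial ℂ, (Polynomial.aeval y f * y)ᴴ = Polynomial.aeval y f * y ∧
      Polynomial.aeval y f * y * y = y ∧
      Polynomial.aeval y f * y * (Polynomial.aeval y f * y) = Polynomial.aeval y f * y := by
  have hy' : y.IsHermitian := hy
  let d : n → ℂ := RCLike.ofReal ∘ hy'.eigenvalues
  let φ := Unitary.conjStarAlgAut ℂ (Matrix n n ℂ) hy'.eigenvectorUnitary
  have hφ : y = φ (Matrix.diagonal d) := hy'.spectral_theorem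
  let f : Polynomial ℂ := Lagrange.interpolate (Finset.univ.image d) id fun x => x⁻¹
  have hf : ∀ i, f.eval (d i) = (d i)⁻¹ := fun i =>
    Lagrange.eval_interpolate_at_node (i := d i) (v := id) (s := Finset.univ.image d)
      (fun x => x⁻¹) Function.injective_id.injOn (Finset.mem_image_of_mem _ (Finset.mem_univ i))
  have hz : Polynomial.aeval y f = φ (Matrix.diagonal fun i => (d i)⁻¹) := by
    rw [hφ, Polynomial.aeval_algHom_apply]
    congr 1
    have := Polynomial.aeval_algHom_apply (Matrix.diagonalAlgHom (n := n) ℂ) d f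
    rw [Matrix.diagonalAlgHom_apply, Matrix.diagonalAlgHom_apply] at this
    rw [this, Polynomial.aeval_pi_apply]
    congr 1
    ext i
    rw [← hf i]
    rfl
  have he : Polynomial.aeval y f * y = φ (Matrix.diagonal fun i => (d i)⁻¹ * d i) := by
    rw [hz]
    conv_lhs => rw [hφ]
    rw [← map_mul, Matrix.diagonal_mul_diagonal]
  have hd : ∀ i, star (d i) = d i := fun i => Complex.conj_ofReal _
  refine ⟨f, ?_, ?_, ?_⟩
  · rw [he, ← Matrix.star_eq_conjTranspose, ← map_star, Matrix.star_eq_conjTranspose,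
      Matrix.diagonal_conjTranspose]
    congr 2
    ext i
    simp only [Pi.star_apply, star_mul', star_inv₀, hd]
  · rw [he]
    conv_lhs => rw [hφ]
    conv_rhs => rw [hφ]
    rw [← map_mul, Matrix.diagonal_mul_diagonal]
    congr 2
    ext i
    by_cases h : d i = 0
    · simp [h]
    · rw [inv_mul_cancel₀ h, one_mul]
  · rw [he, ← map_mul, Matrix.diagonal_mul_diagonal]
    congr 2
    ext i
    by_cases h : d i = 0
    · simp [h]
    · rw [inv_mul_cancel₀ h, one_mul]

theorem aeval_mem (S₀ : StarSubalgebra ℂ (Matrix n n ℂ)) {y : Matrix n n ℂ} (hy : y ∈ S₀)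
    (f : Polynomial ℂ) : Polynomial.aeval y f ∈ S₀ := by
  have h1 := Polynomial.aeval_mem_adjoin_singleton ℂ (p := f) y
  exact Algebra.adjoin_le (S := S₀.toSubalgebra) (Set.singleton_subset_iff.2 hy) h1

/-- `p` is a projection in `S₀`. -/
structure IsProjIn (S₀ : StarSubalgebra ℂ (Matrix n n ℂ)) (p : Matrix n n ℂ) : Prop where
  mem : p ∈ S₀
  conjTranspose_eq : pᴴ = p
  mul_self : p * p = p

/-- `p` is a minimal projection in `S₀`. -/
structure IsMinProjIn (S₀ : StarSubalgebra ℂ (Matrix n n ℂ)) (p : Matrix n n ℂ) : Prop extends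
    IsProjIn S₀ p where
  ne_zero : p ≠ 0
  compress : ∀ x ∈ S₀, ∃ c : ℂ, p * x * p = c • p

variable {S₀ : StarSubalgebra ℂ (Matrix n n ℂ)}

/-- The range of a matrix. -/
abbrev mulVecRange (p : Matrix n n ℂ) : Submodule ℂ (n → ℂ) := LinearMap.range p.mulVecLin

theorem mem_mulVecRange_iff {p : Matrix n n ℂ} (hp : p * p = p) {v : n → ℂ} :
    v ∈ mulVecRange p ↔ p *ᵥ v = v := by
  constructor
  · rintro ⟨w, rfl⟩
    rw [Matrix.mulVecLin_apply, Matrix.mulVec_mulVec, hp]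
  · intro h
    exact ⟨v, h⟩

theorem exists_eigenvector_of_ne_zero {p h : Matrix n n ℂ} (hp : p * p = p) (hp0 : p ≠ 0)
    (hh : p * h = h) : ∃ (μ : ℂ) (v : n → ℂ), v ≠ 0 ∧ p *ᵥ v = v ∧ h *ᵥ v = μ • v := by
  have hK : mulVecRange p ≠ ⊥ := by
    intro hb
    apply hp0
    have : p.mulVecLin = 0 := LinearMap.range_eq_bot.1 hb
    exact Matrix.mulVec_injective (funext fun v => by
      simpa using LinearMap.congr_fun this v)
  have : Nontrivial (mulVecRange p) := Submodule.nontrivial_iff_ne_bot.2 hK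
  have hmap : ∀ v ∈ mulVecRange p, h.mulVecLin v ∈ mulVecRange p := by
    intro v _
    rw [mem_mulVecRange_iff hp, Matrix.mulVecLin_apply, Matrix.mulVec_mulVec, hh]
  obtain ⟨μ, hμ⟩ := Module.End.exists_eigenvalue (h.mulVecLin.restrict hmap)
  obtain ⟨⟨v, hv⟩, hv'⟩ := hμ.exists_hasEigenvector
  refine ⟨μ, v, fun h0 => hv'.2 (Subtype.ext h0), (mem_mulVecRange_iff hp).1 hv, ?_⟩
  have := congrArg Subtype.val hv'.apply_eq_smul
  simpa using this

theorem exists_isMinProjIn_le {p : Matrix n n ℂ} (hp : IsProjIn S₀ p) (hp0 : p ≠ 0) :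
    ∃ q, IsMinProjIn S₀ q ∧ p * q = q := by
  induction hK : mulVecRange p using WellFoundedLT.induction generalizing p with
  | ind K ih =>
  by_cases hmin : ∀ x ∈ S₀, ∃ c : ℂ, p * x * p = c • p
  · exact ⟨p, ⟨hp, hp0, hmin⟩, hp.mul_self⟩
  push Not at hmin
  obtain ⟨x, hx, hxc⟩ := hmin
  obtain ⟨μ, v, hv0, hpv, hv⟩ := exists_eigenvector_of_ne_zero (h := p * x * p) hp.mul_self hp0
    (by rw [← Matrix.mul_assoc, ← Matrix.mul_assoc, hp.mul_self])
  set k := p * x * p - μ • p with hk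
  have hk0 : k ≠ 0 := sub_ne_zero.2 (hxc μ)
  have hkv : k *ᵥ v = 0 := by
    rw [hk, Matrix.sub_mulVec, hv, Matrix.smul_mulVec, hpv, sub_self]
  have hkp : k * p = k := by
    rw [hk, Matrix.sub_mul, Matrix.mul_assoc, hp.mul_self, Matrix.smul_mul, hp.mul_self]
  have hkS : k ∈ S₀ := S₀.sub_mem (S₀.mul_mem (S₀.mul_mem hp.mem hx) hp.mem) (S₀.smul_mem hp.mem _)
  have hkk : (kᴴ * k)ᴴ = kᴴ * k := by simp
  have hkk0 : kᴴ * k ≠ 0 := fun h => hk0 (Matrix.conjTranspose_mul_self_eq_zero.1 h)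
  have hkS' : kᴴ ∈ S₀ := star_mem hkS
  have hkkS : kᴴ * k ∈ S₀ := S₀.mul_mem hkS' hkS
  obtain ⟨f, hf1, hf2, hf3⟩ := exists_polynomial_mul_isIdempotent hkk
  set e := Polynomial.aeval (kᴴ * k) f * (kᴴ * k) with he
  have hep : e * p = e := by
    rw [he, Matrix.mul_assoc, Matrix.mul_assoc, hkp]
  have hpe : p * e = e := by
    have := congrArg Matrix.conjTranspose hep
    rwa [Matrix.conjTranspose_mul, hf1, hp.conjTranspose_eq] at this
  have he0 : e ≠ 0 := by
    intro h0
    rw [h0, Matrix.zero_mul] at hf2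
    exact hkk0 hf2.symm
  have hev : e *ᵥ v = 0 := by
    rw [he, ← Matrix.mulVec_mulVec, ← Matrix.mulVec_mulVec, hkv]
    simp
  have hlt : mulVecRange e < K := by
    rw [← hK]
    refine lt_of_le_of_ne ?_ ?_
    · intro w hw
      rw [mem_mulVecRange_iff hf3] at hw
      rw [mem_mulVecRange_iff hp.mul_self, ← hw, Matrix.mulVec_mulVec, hpe]
    · intro heq
      have : v ∈ mulVecRange e := by
        rw [heq, mem_mulVecRange_iff hp.mul_self, hpv]
      rw [mem_mulVecRange_iff hf3, hev] at this
      exact hv0 this.symm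
  obtain ⟨q, hq, hqe⟩ := ih _ hlt ⟨S₀.mul_mem (aeval_mem S₀ hkkS f) hkkS, hf1, hf3⟩ he0 rfl
  exact ⟨q, hq, by rw [← hqe, ← Matrix.mul_assoc, hpe]⟩

theorem exists_finset_isMinProjIn {p : Matrix n n ℂ} (hp : IsProjIn S₀ p) :
    ∃ s : Finset (Matrix n n ℂ), (∀ q ∈ s, IsMinProjIn S₀ q) ∧
      (∀ q ∈ s, ∀ q' ∈ s, q ≠ q' → q * q' = 0) ∧ ∑ q ∈ s, q = p := by
  classical
  induction hK : mulVecRange p using WellFoundedLT.induction generalizing p with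
  | ind K ih =>
  by_cases hp0 : p = 0
  · exact ⟨∅, by simp, by simp, by simp [hp0]⟩
  obtain ⟨q, hq, hpq⟩ := exists_isMinProjIn_le hp hp0
  have hqp : q * p = q := by
    have := congrArg Matrix.conjTranspose hpq
    rwa [Matrix.conjTranspose_mul, hq.conjTranspose_eq, hp.conjTranspose_eq] at this
  have hsub : IsProjIn S₀ (p - q) := by
    refine ⟨S₀.sub_mem hp.mem hq.mem, ?_, ?_⟩
    · rw [Matrix.conjTranspose_sub, hp.conjTranspose_eq, hq.conjTranspose_eq]
    · rw [Matrix.mul_sub, Matrix.sub_mul, Matrix.sub_mul, hp.mul_self, hqp, hpq, hq.mul_self]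
      abel
  have hq0 : q * (p - q) = 0 := by rw [Matrix.mul_sub, hqp, hq.mul_self, sub_self]
  have hlt : mulVecRange (p - q) < K := by
    rw [← hK]
    refine lt_of_le_of_ne ?_ ?_
    · intro w hw
      rw [mem_mulVecRange_iff hsub.mul_self] at hw
      rw [mem_mulVecRange_iff hp.mul_self, ← hw, Matrix.mulVec_mulVec, Matrix.mul_sub, hp.mul_self,
        hpq]
    · intro heq
      apply hq.ne_zero
      refine Matrix.mulVec_injective (funext fun v => ?_)
      have h1 : q *ᵥ v ∈ mulVecRange (p - q) := by
        rw [heq, mem_mulVecRange_iff hp.mul_self, Matrix.mulVec_mulVec, hpq]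
      rw [mem_mulVecRange_iff hsub.mul_self] at h1
      have h2 := congrArg (q *ᵥ ·) h1
      simp only [Matrix.mulVec_mulVec] at h2
      rw [← Matrix.mul_assoc, hq0, hq.mul_self] at h2
      rw [← h2, Matrix.zero_mul]
  obtain ⟨s, hs1, hs2, hs3⟩ := ih _ hlt hsub rfl
  have hqs : ∀ q' ∈ s, q * q' = 0 := by
    intro q' hq'
    have h1 : (p - q) * q' = q' := by
      rw [← hs3, Finset.sum_mul, Finset.sum_eq_single q']
      · exact (hs1 q' hq').mul_self
      · intro q'' h'' hne
        exact hs2 q'' h'' q' hq' hne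
      · intro h; exact absurd hq' h
    rw [← h1, ← Matrix.mul_assoc, hq0, Matrix.zero_mul]
  have hnot : q ∉ s := fun h => hq.ne_zero (by rw [← hq.mul_self, hqs q h])
  refine ⟨insert q s, ?_, ?_, ?_⟩
  · intro q' hq'
    rcases Finset.mem_insert.1 hq' with rfl | h
    · exact hq
    · exact hs1 q' h
  · have hsq : ∀ q' ∈ s, q' * q = 0 := by
      intro q' hq'
      have := congrArg Matrix.conjTranspose (hqs q' hq')
      rwa [Matrix.conjTranspose_mul, hq.conjTranspose_eq, (hs1 q' hq').conjTranspose_eq,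
        Matrix.conjTranspose_zero] at this
    intro q₁ h₁ q₂ h₂ hne
    rcases Finset.mem_insert.1 h₁ with e₁ | h₁' <;> rcases Finset.mem_insert.1 h₂ with e₂ | h₂'
    · exact absurd (e₁.trans e₂.symm) hne
    · rw [e₁, hqs _ h₂']
    · rw [e₂, hsq _ h₁']
    · exact hs2 _ h₁' _ h₂' hne
  · rw [Finset.sum_insert hnot, hs3, add_sub_cancel]

/-- Murray-von Neumann equivalence in `S₀`. -/
def MvNEquiv (S₀ : StarSubalgebra ℂ (Matrix n n ℂ)) (q q' : Matrix n n ℂ) : Prop :=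
  ∃ v ∈ S₀, vᴴ * v = q' ∧ v * vᴴ = q

theorem mul_eq_self_of_conjTranspose_mul_self {v q : Matrix n n ℂ} (hq : IsProjIn S₀ q)
    (h : vᴴ * v = q) : v * q = v := by
  have h0 : (v - v * q)ᴴ * (v - v * q) = 0 := by
    rw [Matrix.conjTranspose_sub, Matrix.conjTranspose_mul, hq.conjTranspose_eq, Matrix.mul_sub,
      Matrix.sub_mul, Matrix.sub_mul, h, Matrix.mul_assoc, h, ← Matrix.mul_assoc vᴴ, h,
      Matrix.mul_assoc, ← Matrix.mul_assoc vᴴ, h, hq.mul_self, hq.mul_self]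
    abel
  rw [Matrix.conjTranspose_mul_self_eq_zero, sub_eq_zero] at h0
  exact h0.symm

theorem mvnEquiv_of_ne_zero {q q' : Matrix n n ℂ} (hq : IsMinProjIn S₀ q)
    (hq' : IsMinProjIn S₀ q') {x : Matrix n n ℂ} (hx : x ∈ S₀) (h : q * x * q' ≠ 0) :
    MvNEquiv S₀ q q' := by
  set w := q * x * q' with hw
  have hwS : w ∈ S₀ := S₀.mul_mem (S₀.mul_mem hq.mem hx) hq'.mem
  have hqw : q * w = w := by rw [hw, ← Matrix.mul_assoc, ← Matrix.mul_assoc, hq.mul_self]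
  have hwq : w * q' = w := by rw [hw, Matrix.mul_assoc, hq'.mul_self]
  have hwS' : wᴴ ∈ S₀ := star_mem hwS
  obtain ⟨c, hc⟩ := hq'.compress (wᴴ * w) (S₀.mul_mem hwS' hwS)
  have hqw' : q' * wᴴ = wᴴ := by
    have := congrArg Matrix.conjTranspose hwq
    rwa [Matrix.conjTranspose_mul, hq'.conjTranspose_eq] at this
  have hc' : wᴴ * w = c • q' := by
    rw [← hc, ← Matrix.mul_assoc q', hqw', Matrix.mul_assoc, hwq]
  have htr : ∀ A : Matrix n n ℂ, A ≠ 0 → 0 < (Aᴴ * A).trace := fun A hA =>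
    lt_of_le_of_ne (Matrix.posSemidef_conjTranspose_mul_self A).trace_nonneg
      fun h0 => hA (Matrix.trace_conjTranspose_mul_self_eq_zero_iff.1 h0.symm)
  have h1 := htr w h
  have h2 := htr q' hq'.ne_zero
  rw [hq'.conjTranspose_eq, hq'.mul_self] at h2
  rw [hc', Matrix.trace_smul, smul_eq_mul] at h1
  have hcpos : 0 < c := (pos_iff_pos_of_mul_pos h1).2 h2
  obtain ⟨r, hr, rfl⟩ : ∃ r : ℝ, 0 < r ∧ (r : ℂ) = c := by
    refine ⟨c.re, (Complex.lt_def.1 hcpos).1, Complex.ext rfl ?_⟩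
    exact (Complex.lt_def.1 hcpos).2
  have hr0 : (Real.sqrt r : ℂ) ≠ 0 := by exact_mod_cast (Real.sqrt_pos.2 hr).ne'
  set v := (((Real.sqrt r)⁻¹ : ℝ) : ℂ) • w with hv
  have hvS : v ∈ S₀ := S₀.smul_mem hwS _
  have hvv : vᴴ * v = q' := by
    have : star (((Real.sqrt r)⁻¹ : ℝ) : ℂ) = (((Real.sqrt r)⁻¹ : ℝ) : ℂ) := Complex.conj_ofReal _
    rw [hv, Matrix.conjTranspose_smul, Matrix.smul_mul, Matrix.mul_smul, smul_smul, this, hc',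
      smul_smul, ← Complex.ofReal_mul, ← mul_inv, Real.mul_self_sqrt hr.le, ← Complex.ofReal_mul,
      inv_mul_cancel₀ hr.ne', Complex.ofReal_one, one_smul]
  have hvq := mul_eq_self_of_conjTranspose_mul_self hq'.toIsProjIn hvv
  have hqv : q * v = v := by rw [hv, Matrix.mul_smul, hqw]
  have hvq2 : vᴴ * q = vᴴ := by
    have := congrArg Matrix.conjTranspose hqv
    rwa [Matrix.conjTranspose_mul, hq.conjTranspose_eq] at this
  have hvS' : vᴴ ∈ S₀ := star_mem hvS
  obtain ⟨d, hd⟩ := hq.compress (v * vᴴ) (S₀.mul_mem hvS hvS')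
  have hd' : v * vᴴ = d • q := by
    rw [← hd, ← Matrix.mul_assoc q, hqv, Matrix.mul_assoc, hvq2]
  have hidem : v * vᴴ * (v * vᴴ) = v * vᴴ := by
    rw [Matrix.mul_assoc, ← Matrix.mul_assoc vᴴ, hvv, ← Matrix.mul_assoc, hvq]
  have hd0 : d ≠ 0 := by
    rintro rfl
    rw [zero_smul, Matrix.self_mul_conjTranspose_eq_zero] at hd'
    rw [hd', Matrix.mul_zero] at hvv
    exact hq'.ne_zero hvv.symm
  rw [hd', Matrix.smul_mul, Matrix.mul_smul, hq.mul_self, smul_smul] at hidem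
  have hdd : d * d = d := smul_left_injective ℂ hq.ne_zero hidem
  have hd1 : d = 1 := by
    have := mul_right_cancel₀ hd0 (hdd.trans (one_mul d).symm)
    exact this
  exact ⟨v, hvS, hvv, by rw [hd', hd1, one_smul]⟩

theorem MvNEquiv.refl {q : Matrix n n ℂ} (hq : IsProjIn S₀ q) : MvNEquiv S₀ q q :=
  ⟨q, hq.mem, by rw [hq.conjTranspose_eq, hq.mul_self], by rw [hq.conjTranspose_eq, hq.mul_self]⟩

theorem MvNEquiv.symm {q q' : Matrix n n ℂ} (h : MvNEquiv S₀ q q') : MvNEquiv S₀ q' q := by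
  obtain ⟨v, hv, h1, h2⟩ := h
  exact ⟨vᴴ, star_mem hv, by simpa using h2, by simpa using h1⟩

theorem MvNEquiv.trans {q q' q'' : Matrix n n ℂ} (hq : IsProjIn S₀ q) (hq'' : IsProjIn S₀ q'')
    (h : MvNEquiv S₀ q q') (h' : MvNEquiv S₀ q' q'') : MvNEquiv S₀ q q'' := by
  obtain ⟨v, hv, h1, h2⟩ := h
  obtain ⟨w, hw, h3, h4⟩ := h'
  refine ⟨v * w, S₀.mul_mem hv hw, ?_, ?_⟩
  · rw [Matrix.conjTranspose_mul, Matrix.mul_assoc, ← Matrix.mul_assoc vᴴ, h1, ← h4,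
      Matrix.mul_assoc, h3, ← Matrix.mul_assoc, h3, hq''.mul_self]
  · rw [Matrix.conjTranspose_mul, Matrix.mul_assoc, ← Matrix.mul_assoc w, h4, ← h1,
      Matrix.mul_assoc, h2, ← Matrix.mul_assoc, h2, hq.mul_self]

theorem exists_isometry_of_isProj {q : Matrix n n ℂ} (hq : qᴴ = q) (hqq : q * q = q) :
    ∃ (y : ℕ) (f : Matrix n (Fin y) ℂ), fᴴ * f = 1 ∧ f * fᴴ = q := by
  classical
  have hq' : q.IsHermitian := hq
  let d : n → ℂ := RCLike.ofReal ∘ hq'.eigenvalues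
  let U : Matrix n n ℂ := hq'.eigenvectorUnitary
  have hU1 : Uᴴ * U = 1 := (Matrix.mem_unitaryGroup_iff').1 hq'.eigenvectorUnitary.2
  have hU2 : U * Uᴴ = 1 := (Matrix.mem_unitaryGroup_iff).1 hq'.eigenvectorUnitary.2
  have hspec : q = U * Matrix.diagonal d * Uᴴ := by
    have := hq'.spectral_theorem
    rw [Unitary.conjStarAlgAut_apply] at this
    exact this
  have hdiag : Matrix.diagonal d = Uᴴ * q * U := by
    rw [hspec]
    calc Matrix.diagonal d = (Uᴴ * U) * Matrix.diagonal d * (Uᴴ * U) := by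
          rw [hU1, Matrix.one_mul, Matrix.mul_one]
      _ = _ := by simp only [Matrix.mul_assoc]
  have hdd : ∀ i, d i * d i = d i := by
    have h1 : Matrix.diagonal d * Matrix.diagonal d = Matrix.diagonal d := by
      calc Matrix.diagonal d * Matrix.diagonal d = Uᴴ * q * (U * Uᴴ) * q * U := by
            rw [hdiag]; simp only [Matrix.mul_assoc]
        _ = Matrix.diagonal d := by
            rw [hU2, Matrix.mul_one, Matrix.mul_assoc Uᴴ, hqq, hdiag]
    intro i
    rw [Matrix.diagonal_mul_diagonal] at h1
    exact congrFun (Matrix.diagonal_injective h1) i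
  let e := Fintype.equivFin {i // d i = 1}
  refine ⟨Fintype.card {i // d i = 1}, U.submatrix id fun t => (e.symm t).1, ?_, ?_⟩
  · have : (U.submatrix id fun t => (e.symm t).1)ᴴ * (U.submatrix id fun t => (e.symm t).1) =
        (Uᴴ * U).submatrix (fun t => (e.symm t).1) (fun t => (e.symm t).1) := rfl
    rw [this, hU1]
    exact Matrix.submatrix_one _ (Subtype.val_injective.comp e.symm.injective)
  · have hd01 : ∀ i, d i ≠ 1 → d i = 0 := fun i hi => by
      by_contra h0
      exact hi (mul_right_cancel₀ h0 ((hdd i).trans (one_mul (d i)).symm))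
    have hright : ∀ k l, (U * Matrix.diagonal d * Uᴴ) k l =
        ∑ i, U k i * d i * star (U l i) := fun k l => by
      rw [Matrix.mul_apply]
      simp only [Matrix.mul_diagonal, Matrix.conjTranspose_apply]
    rw [hspec]
    ext k l
    rw [hright, Matrix.mul_apply]
    simp only [Matrix.submatrix_apply, id, Matrix.conjTranspose_apply]
    rw [e.symm.sum_comp (fun i : {i // d i = 1} => U k i.1 * star (U l i.1)),
      ← Finset.sum_subtype (Finset.univ.filter fun i => d i = 1) (by simp)
        (fun i => U k i * star (U l i)), Finset.sum_filter]
    refine Finset.sum_congr rfl fun i _ => ?_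
    split_ifs with h
    · rw [h, mul_one]
    · rw [hd01 i h, mul_zero, zero_mul]

theorem exists_matrixUnits (S₀ : StarSubalgebra ℂ (Matrix n n ℂ)) :
    ∃ (r : ℕ) (a : Fin r → ℕ) (q : Fin r → Matrix n n ℂ)
      (v : (Σ i, Fin (a i)) → Matrix n n ℂ), (∀ i, 0 < a i) ∧ (∀ i, IsMinProjIn S₀ (q i)) ∧
      (∀ i j, i ≠ j → ∀ x ∈ S₀, q i * x * q j = 0) ∧ (∀ k, v k ∈ S₀) ∧
      (∀ k, (v k)ᴴ * v k = q k.1) ∧ (∀ k l, k ≠ l → (v k)ᴴ * v l = 0) ∧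
      ∑ k, v k * (v k)ᴴ = 1 := by
  classical
  obtain ⟨s, hs, horth, hsum⟩ := exists_finset_isMinProjIn (S₀ := S₀) (p := 1)
    ⟨S₀.one_mem, Matrix.conjTranspose_one, Matrix.one_mul 1⟩
  let sd : Setoid s := ⟨fun k l => MvNEquiv S₀ k.1 l.1,
    fun k => MvNEquiv.refl (hs _ k.2).toIsProjIn, fun h => h.symm,
    fun {k _ m} h h' => h.trans (hs _ k.2).toIsProjIn (hs _ m.2).toIsProjIn h'⟩
  let e := Fintype.equivFin (Quotient sd)
  let g : s → Fin (Fintype.card (Quotient sd)) := fun k => e (Quotient.mk sd k)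
  have hg : ∀ k l, g k = g l → MvNEquiv S₀ k.1 l.1 := fun k l h =>
    Quotient.exact (e.injective h)
  let rep : Fin (Fintype.card (Quotient sd)) → s := fun i => (e.symm i).out
  have hrep : ∀ i, g (rep i) = i := fun i => by
    change e (Quotient.mk sd (e.symm i).out) = i
    rw [Quotient.out_eq, Equiv.apply_symm_apply]
  let a : Fin (Fintype.card (Quotient sd)) → ℕ := fun i => Fintype.card {k // g k = i}
  let E : (Σ i, Fin (a i)) ≃ s := (Equiv.sigmaCongrRight fun i =>
    (Fintype.equivFin {k // g k = i}).symm).trans (Equiv.sigmaFiberEquiv g)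
  have hE : ∀ k, g (E k) = k.1 := fun k => ((Fintype.equivFin {l // g l = k.1}).symm k.2).2
  choose v hv1 hv2 hv3 using fun k => hg (E k) (rep k.1) ((hE k).trans (hrep k.1).symm)
  refine ⟨_, a, fun i => (rep i).1, v, fun i => Fintype.card_pos_iff.2 ⟨⟨rep i, hrep i⟩⟩,
    fun i => hs _ (rep i).2, ?_, hv1, hv2, ?_, ?_⟩
  · intro i j hij x hx
    by_contra h
    have h1 := mvnEquiv_of_ne_zero (hs _ (rep i).2) (hs _ (rep j).2) hx h
    have h2 : g (rep i) = g (rep j) := congrArg e (Quotient.sound h1)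
    rw [hrep, hrep] at h2
    exact hij h2
  · intro k l hkl
    have h1 : (E k).1 * (E l).1 = 0 :=
      horth _ (E k).2 _ (E l).2 fun h => hkl (E.injective (Subtype.ext h))
    have h2 : ∀ m, (E m).1 * v m = v m := fun m => by
      rw [← hv3, Matrix.mul_assoc, hv2,
        mul_eq_self_of_conjTranspose_mul_self (hs _ (rep m.1).2).toIsProjIn (hv2 m)]
    calc (v k)ᴴ * v l = ((E k).1 * v k)ᴴ * ((E l).1 * v l) := by rw [h2, h2]
      _ = (v k)ᴴ * ((E k).1 * (E l).1) * v l := by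
        rw [Matrix.conjTranspose_mul, (hs _ (E k).2).conjTranspose_eq]
        simp only [Matrix.mul_assoc]
      _ = 0 := by rw [h1, Matrix.mul_zero, Matrix.zero_mul]
  · simp only [hv3]
    rw [E.sum_comp (fun k : s => k.1), Finset.sum_coe_sort s fun q => q, hsum]

theorem nonempty_blockDecomposition (S₀ : StarSubalgebra ℂ (Matrix n n ℂ)) :
    Nonempty (BlockDecomposition S₀) := by
  obtain ⟨r, a, q, v, ha, hq, hq0, hvS, hvv, hv0, hsum⟩ := exists_matrixUnits S₀
  choose y f hf1 hf2 using fun i =>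
    exists_isometry_of_isProj (hq i).conjTranspose_eq (hq i).mul_self
  have hvq : ∀ k, v k * q k.1 = v k := fun k =>
    mul_eq_self_of_conjTranspose_mul_self (hq k.1).toIsProjIn (hvv k)
  have hqv : ∀ k, q k.1 * (v k)ᴴ = (v k)ᴴ := fun k => by
    have := congrArg Matrix.conjTranspose (hvq k)
    rwa [Matrix.conjTranspose_mul, (hq k.1).conjTranspose_eq] at this
  have hqf : ∀ i, q i * f i = f i := fun i => by
    rw [← hf2, Matrix.mul_assoc, hf1, Matrix.mul_one]
  have hvS' : ∀ k, (v k)ᴴ ∈ S₀ := fun k => star_mem (hvS k)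
  let U : Matrix n (Σ i, Fin (a i) × Fin (y i)) ℂ :=
    Matrix.of fun k x => (v ⟨x.1, x.2.1⟩ * f x.1) k x.2.2
  have hU : ∀ i p, blockCol U i p = v ⟨i, p⟩ * f i := fun i p => rfl
  have hunit : ∀ i p p', blockCol U i p * (blockCol U i p')ᴴ = v ⟨i, p⟩ * (v ⟨i, p'⟩)ᴴ := by
    intro i p p'
    rw [hU, hU, Matrix.conjTranspose_mul, Matrix.mul_assoc, ← Matrix.mul_assoc (f i), hf2,
      hqv ⟨i, p'⟩]
  refine ⟨⟨r, a, y, ha, ?_, U, ?_, ?_, ?_⟩⟩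
  · intro i
    rw [Nat.pos_iff_ne_zero]
    intro h0
    have : IsEmpty (Fin (y i)) := by rw [h0]; infer_instance
    exact (hq i).ne_zero (by rw [← hf2]; ext k l; simp [Matrix.mul_apply])
  · ext ⟨i, p, s⟩ ⟨j, p', t⟩
    have h1 : (Uᴴ * U) ⟨i, p, s⟩ ⟨j, p', t⟩ =
        ((v ⟨i, p⟩ * f i)ᴴ * (v ⟨j, p'⟩ * f j)) s t := rfl
    rw [h1, Matrix.conjTranspose_mul, Matrix.mul_assoc, ← Matrix.mul_assoc (v ⟨i, p⟩)ᴴ]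
    by_cases h : (⟨i, p⟩ : Σ i, Fin (a i)) = ⟨j, p'⟩
    · obtain ⟨rfl, h'⟩ := Sigma.mk.inj_iff.1 h
      obtain rfl := eq_of_heq h'
      rw [hvv, hqf, hf1]
      simp [Matrix.one_apply]
    · rw [hv0 _ _ h, Matrix.zero_mul, Matrix.mul_zero, Matrix.one_apply_ne, Matrix.zero_apply]
      intro h'
      apply h
      obtain ⟨rfl, h''⟩ := Sigma.mk.inj_iff.1 h'
      exact congrArg (Sigma.mk i) (congrArg Prod.fst (eq_of_heq h''))
  · have := mul_blockDiagonal'_kronecker_one_mul (U := U) fun _ => 1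
    simp only [Matrix.one_kronecker_one] at this
    rw [show (fun i => (1 : Matrix (Fin (a i) × Fin (y i)) (Fin (a i) × Fin (y i)) ℂ)) = 1 from rfl,
      Matrix.blockDiagonal'_one, Matrix.mul_one] at this
    rw [this, ← hsum, Fintype.sum_sigma]
    refine Finset.sum_congr rfl fun i _ => Finset.sum_congr rfl fun p _ => ?_
    rw [Finset.sum_eq_single p]
    · rw [Matrix.one_apply_eq, one_smul, hunit]
    · intro p' _ hp
      rw [Matrix.one_apply_ne hp.symm, zero_smul]
    · simp
  · intro X
    simp only [mul_blockDiagonal'_kronecker_one_mul, hunit]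
    constructor
    · intro hX
      have hc : ∀ i (p p' : Fin (a i)), ∃ c : ℂ, (v ⟨i, p⟩)ᴴ * X * v ⟨i, p'⟩ = c • q i := by
        intro i p p'
        obtain ⟨c, hc⟩ := (hq i).compress _
          (S₀.mul_mem (S₀.mul_mem (hvS' ⟨i, p⟩) hX) (hvS ⟨i, p'⟩))
        refine ⟨c, ?_⟩
        rw [← hc]
        conv_lhs => rw [← hqv ⟨i, p⟩, ← hvq ⟨i, p'⟩]
        simp only [Matrix.mul_assoc]
      choose M hM using hc
      refine ⟨M, ?_⟩
      calc X = (∑ k, v k * (v k)ᴴ) * X * ∑ k, v k * (v k)ᴴ := by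
            rw [hsum, Matrix.one_mul, Matrix.mul_one]
        _ = ∑ k, ∑ l, v k * ((v k)ᴴ * X * v l) * (v l)ᴴ := by
            rw [Finset.sum_mul, Finset.sum_mul]
            refine Finset.sum_congr rfl fun k _ => ?_
            rw [Finset.mul_sum]
            refine Finset.sum_congr rfl fun l _ => ?_
            simp only [Matrix.mul_assoc]
        _ = _ := by
            simp only [Fintype.sum_sigma]
            refine Finset.sum_congr rfl fun i _ => Finset.sum_congr rfl fun p _ => ?_
            rw [Finset.sum_eq_single i]
            · refine Finset.sum_congr rfl fun p' _ => ?_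
              rw [hM, Matrix.mul_smul, Matrix.smul_mul, hvq ⟨i, p⟩]
            · intro j _ hij
              refine Finset.sum_eq_zero fun p' _ => ?_
              have : (v ⟨i, p⟩)ᴴ * X * v ⟨j, p'⟩ = 0 := by
                rw [← hq0 i j hij.symm _
                  (S₀.mul_mem (S₀.mul_mem (hvS' ⟨i, p⟩) hX) (hvS ⟨j, p'⟩))]
                conv_lhs => rw [← hqv ⟨i, p⟩, ← hvq ⟨j, p'⟩]
                simp only [Matrix.mul_assoc]
              rw [this, Matrix.mul_zero, Matrix.zero_mul]
            · simp
    · rintro ⟨M, rfl⟩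
      exact sum_mem fun i _ => sum_mem fun p _ => sum_mem fun p' _ =>
        S₀.smul_mem (S₀.mul_mem (hvS ⟨i, p⟩) (hvS' ⟨i, p'⟩)) _

end MinimalProjections

end NCTheta

theorem mainTheorem3 {n : Type*} [Fintype n] [DecidableEq n] [Nonempty n]
    (S₀ : StarSubalgebra ℂ (Matrix n n ℂ)) (S : Submodule ℂ (Matrix n n ℂ))
    (hS : NCTheta.IsAlgGraph S₀ S) :
    -- `S₀` has a block decomposition, and the claims about `Ψ` hold for each of them
    Nonempty (NCTheta.BlockDecomposition S₀) ∧
    -- the minimum that defines `θ(S, W)` is attained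
    (∀ W : Matrix n n ℂ, 0 ≤ W →
      IsLeast (NCTheta.thetaValues S W) (NCTheta.theta S W)) ∧
    -- `TH(S) = {W ≥ 0 : Ψ(W) ∈ TH^♯(Sᶜ)}`
    (∀ D : NCTheta.BlockDecomposition S₀,
      NCTheta.thetaBody S =
        {W | 0 ≤ W ∧ D.psi W ∈
          NCTheta.antiblocker (NCTheta.thetaBody (NCTheta.graphCompl S₀ S))}) ∧
    -- `TH^♯(S) = her (TH^♯(S) ∩ S₀')`
    NCTheta.antiblocker (NCTheta.thetaBody S) =
      NCTheta.her (NCTheta.antiblocker (NCTheta.thetaBody S) ∩ NCTheta.commutant S₀) ∧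
    -- `θ(S, W) = max {Tr(WZ) : Z ≥ 0, θ(Sᶜ, Ψ(Z)) ≤ 1}`
    (∀ D : NCTheta.BlockDecomposition S₀, ∀ W : Matrix n n ℂ, 0 ≤ W →
      IsGreatest
        {t : ℝ | ∃ Z : Matrix n n ℂ, 0 ≤ Z ∧
          NCTheta.theta (NCTheta.graphCompl S₀ S) (D.psi Z) ≤ 1 ∧ t = (W * Z).trace.re}
        (NCTheta.theta S W)) ∧
    -- `θ(S, W) = min {θ(S, X) : X ≥ W, X ∈ S₀'}`
    (∀ W : Matrix n n ℂ, 0 ≤ W →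
      IsLeast
        {t : ℝ | ∃ X : Matrix n n ℂ, W ≤ X ∧ X ∈ NCTheta.commutant S₀ ∧ t = NCTheta.theta S X}
        (NCTheta.theta S W)) ∧
    -- the maximal elements of `TH^♯(S)` lie in `S₀'`
    (∀ W : Matrix n n ℂ,
      Maximal (fun X => X ∈ NCTheta.antiblocker (NCTheta.thetaBody S)) W →
        W ∈ NCTheta.commutant S₀) ∧
    -- for classical graphs the maximal elements are diagonal
    (∀ (G : SimpleGraph n) (W : Matrix n n ℂ),
      Maximal (fun X => X ∈ NCTheta.antiblocker
        (NCTheta.thetaBody (NCTheta.classicalGraph G))) W → W.IsDiag) := by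

  obtain ⟨D₀⟩ := NCTheta.nonempty_blockDecomposition S₀
  have h1 := hS.isNCGraph.one_mem
  refine ⟨⟨D₀⟩, fun W _ => NCTheta.isLeast_theta h1 W, fun D => ?_,
    NCTheta.antiblocker_thetaBody_eq_her D₀ hS, fun D W hW => NCTheta.isGreatest_theta D hS hW,
    fun W hW => NCTheta.isLeast_theta_commutant D₀ hS hW,
    fun W hW => NCTheta.mem_commutant_of_maximal D₀ hS hW, fun G W hW => ?_⟩
  · rw [NCTheta.antiblocker_thetaBody hS.graphCompl.one_mem]
    exact NCTheta.thetaBody_eq_psi D hS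
  · obtain ⟨D⟩ := NCTheta.nonempty_blockDecomposition (NCTheta.diagonalStarSubalgebra n)
    exact NCTheta.isDiag_of_mem_commutant
      (NCTheta.mem_commutant_of_maximal D (NCTheta.isAlgGraph_classicalGraph G) hW)
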